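/- Let $m_1\ge 1$ be an odd integer, $m_2\ge 0$ an even integer, $x_0>0$, and let $\mathcal{O}=-y^{m_1}\partial_x^2-x^{m_2}\partial_y^2$ on $\mathbb{R}^2$. Put $y_{c'}=-\Big[\tfrac12\,\tfrac{m_1+2}{m_2+2}\,(2x_0)^{\frac{m_2+2}{2}}\Big]^{\frac{2}{m_1+2}}$ and consider the arcs of characteristics of $\mathcal{O}$ $$AC'=\Big\{(x,y): x\ge 0,\ y_{c'}\le y\le 0,\ \tfrac{2}{m_1+2}(-y)^{\frac{m_1+2}{2}}=-\tfrac{2}{m_2+2}\big[x^{\frac{m_2+2}{2}}-(2x_0)^{\frac{m_2+2}{2}}\big]\Big\},$$ $$BC'=\Big\{(x,y): x\ge 0,\ y_{c'}\le y\le 0,\ \tfrac{2}{m_1+2}(-y)^{\frac{m_1+2}{2}}=\tfrac{2}{m_2+2}x^{\frac{m_2+2}{2}}\Big\}.$$ Let $\Omega_2\subset\mathbb{R}^2$ be a Tricomi domain for $\mathcal{O}$ with these characteristics, that is, an open, bounded, simply connected set with $\partial\Omega_2=\sigma_2\cup AC'\cup BC'$, where $\sigma_2$ is a simple piecewise $C^1$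 arc (with a parametrization that is $C^1$ with non-vanishing derivative on each closed interval of a finite partition) joining $(2x_0,0)$ to $(0,0)$ and lying in $\{y>0\}$ except for its two end points. Suppose that $\Omega_2$ is $D$-star-shaped for $D=-(m_1+2)x\partial_x-(m_2+2)y\partial_y$, that is, for every $(x,y)\in\overline{\Omega_2}$ and every $t\ge 0$ the point $(xe^{-(m_1+2)t},\,ye^{-(m_2+2)t})$ lies in $\overline{\Omega_2}$, and so does its limit $(0,0)$ as $t\to+\infty$. Let $\alpha\in\mathbb{R}$ satisfy $$\alpha>2^*(m_1,m_2)-1=\frac{m_1+m_2-m_1m_2+8}{m_1+m_2+m_1m_2},\qquad 2^*(m_1,m_2)=\frac{2(m_1+m_2)+8}{m_1+m_2+m_1m_2},$$ and let $u\in C^2(\overline{\Omega_2})$ (that is, $u$ is real-valued, continuous on $\overline{\Omega_2}$, of class $C^2$ in $\Omega_2$, and its partial derivatives of order at most $2$ extend continuously to $\overline{\Omega_2}$) satisfy $$-y^{m_1}u_{xx}-x^{m_2}u_{yy}=u|u|^{\alpha-1}\ \text{ in }\Omega_2,\qquad u=0\ \text{ on } AC'\cup\sigma_2,$$ where $s|s|^{\alpha-1}$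 is understood to be $0$ at $s=0$. Then $u\equiv 0$ in $\Omega_2$. -/

import Mathlib

/-- `Γ` is a simple piecewise `C¹` arc in the plane with end points `P` and `Q`: the injective
continuous image of `[0, 1]`, with a parametrization that is `C¹` with non-vanishing (one-sided at
the ends) derivative on each of the finitely many closed intervals of some partition. -/
def IsPiecewiseC1Arc (Γ : Set (ℝ × ℝ)) (P Q : ℝ × ℝ) : Prop :=
  ∃ γ : ℝ → ℝ × ℝ,
    ContinuousOn γ (Set.Icc 0 1) ∧ Set.InjOn γ (Set.Icc 0 1) ∧
    γ '' Set.Icc 0 1 = Γ ∧ γ 0 = P ∧ γ 1 = Q ∧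
    ∃ (n : ℕ) (t : ℕ → ℝ), t 0 = 0 ∧ t n = 1 ∧
      ∀ i < n, t i < t (i + 1) ∧
        ContDiffOn ℝ 1 γ (Set.Icc (t i) (t (i + 1))) ∧
        ∀ s ∈ Set.Icc (t i) (t (i + 1)), derivWithin γ (Set.Icc (t i) (t (i + 1))) s ≠ 0

/-- The time `t` flow of the vector field `-a x ∂ₓ - b y ∂ᵧ`. -/
noncomputable def dFlow (a b t : ℝ) (p : ℝ × ℝ) : ℝ × ℝ :=
  (p.1 * Real.exp (-a * t), p.2 * Real.exp (-b * t))

/-- `Ω` is star-shaped with respect to the field `D = -a x ∂ₓ - b y ∂ᵧ`: the flow line of each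
point of the closure stays in the closure for all times in `[0, +∞]`
(the position at time `+∞` is the origin). -/
def IsDStarShaped (a b : ℝ) (Ω : Set (ℝ × ℝ)) : Prop :=
  ∀ p ∈ closure Ω, (∀ t : ℝ, 0 ≤ t → dFlow a b t p ∈ closure Ω) ∧ ((0, 0) : ℝ × ℝ) ∈ closure Ω

/-- The ordinate of the point where the two characteristics through `(2 x₀, 0)` and `(0, 0)`
meet. -/
noncomputable def charY (m₁ m₂ : ℕ) (x₀ : ℝ) : ℝ :=
  -(1 / 2 * (((m₁ : ℝ) + 2) / ((m₂ : ℝ) + 2)) * (2 * x₀) ^ (((m₂ : ℝ) + 2) / 2))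
    ^ (2 / ((m₁ : ℝ) + 2))

/-- The characteristic arc from `A' = (2 x₀, 0)` to `C'` in the quadrant `x ≥ 0`, `y ≤ 0`. -/
def charAC (m₁ m₂ : ℕ) (x₀ : ℝ) : Set (ℝ × ℝ) :=
  {p | 0 ≤ p.1 ∧ charY m₁ m₂ x₀ ≤ p.2 ∧ p.2 ≤ 0 ∧
    2 / ((m₁ : ℝ) + 2) * (-p.2) ^ (((m₁ : ℝ) + 2) / 2) =
      -(2 / ((m₂ : ℝ) + 2)) *
        (p.1 ^ (((m₂ : ℝ) + 2) / 2) - (2 * x₀) ^ (((m₂ : ℝ) + 2) / 2))}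

/-- The characteristic arc from `B' = (0, 0)` to `C'` in the quadrant `x ≥ 0`, `y ≤ 0`. -/
def charBC (m₁ m₂ : ℕ) (x₀ : ℝ) : Set (ℝ × ℝ) :=
  {p | 0 ≤ p.1 ∧ charY m₁ m₂ x₀ ≤ p.2 ∧ p.2 ≤ 0 ∧
    2 / ((m₁ : ℝ) + 2) * (-p.2) ^ (((m₁ : ℝ) + 2) / 2) =
      2 / ((m₂ : ℝ) + 2) * p.1 ^ (((m₂ : ℝ) + 2) / 2)}

/-- `Ω` is a Tricomi domain (with its characteristics in `x ≥ 0`, `y ≤ 0`) for the operator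
`-y ^ m₁ ∂ₓ² - x ^ m₂ ∂ᵧ²`, with parabolic diameter from `(0, 0)` to `(2 x₀, 0)` and elliptic
boundary arc `σ`. -/
structure IsTricomiDomain (m₁ m₂ : ℕ) (x₀ : ℝ) (σ Ω : Set (ℝ × ℝ)) : Prop where
  x₀_pos : 0 < x₀
  isOpen : IsOpen Ω
  isBounded : Bornology.IsBounded Ω
  isSimplyConnected : IsSimplyConnected Ω
  arc : IsPiecewiseC1Arc σ (2 * x₀, 0) (0, 0)
  arc_upper : ∀ p ∈ σ, p ≠ (2 * x₀, 0) → p ≠ (0, 0) → 0 < p.2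
  frontier_eq : frontier Ω = σ ∪ charAC m₁ m₂ x₀ ∪ charBC m₁ m₂ x₀

/-- `u ∈ C²(Ω̄)`: `u` is `C²` in the open set `Ω`, and `u` and its derivatives of order one and two
extend continuously to the closure (the extension of `u` being `u` itself). -/
def IsC2UpToBoundary (Ω : Set (ℝ × ℝ)) (u : ℝ × ℝ → ℝ) : Prop :=
  ContDiffOn ℝ 2 u Ω ∧ ContinuousOn u (closure Ω) ∧
  (∃ g : ℝ × ℝ → (ℝ × ℝ →L[ℝ] ℝ),
    ContinuousOn g (closure Ω) ∧ Set.EqOn g (fderiv ℝ u) Ω) ∧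
  (∃ h : ℝ × ℝ → (ℝ × ℝ →L[ℝ] ℝ × ℝ →L[ℝ] ℝ),
    ContinuousOn h (closure Ω) ∧ Set.EqOn h (fderiv ℝ (fderiv ℝ u)) Ω)

/-- The partial derivative with respect to the first variable. -/
noncomputable def partialX (u : ℝ × ℝ → ℝ) (p : ℝ × ℝ) : ℝ := fderiv ℝ u p (1, 0)

/-- The partial derivative with respect to the second variable. -/
noncomputable def partialY (u : ℝ × ℝ → ℝ) (p : ℝ × ℝ) : ℝ := fderiv ℝ u p (0, 1)

/-- The operator `𝒪 u = -y ^ m₁ uₓₓ - x ^ m₂ uᵧᵧ`. -/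
noncomputable def opO (m₁ m₂ : ℕ) (u : ℝ × ℝ → ℝ) (p : ℝ × ℝ) : ℝ :=
  -p.2 ^ m₁ * partialX (partialX u) p - p.1 ^ m₂ * partialY (partialY u) p

/-- The critical exponent `2*(m₁, m₂)`. -/
noncomputable def critExponent (m₁ m₂ : ℕ) : ℝ :=
  (2 * ((m₁ : ℝ) + m₂) + 8) / ((m₁ : ℝ) + m₂ + m₁ * m₂)

/-!
The proof is a Pohožaev argument in which the multiplier `Du` is replaced by finite dilations, so
that no trace of the gradient of `u` on the elliptic arc `σ` is needed.

Put `N = m₁ + m₂ + m₁ m₂`, `A = m₁ + m₂ + 4`, and let `Φ_t` be the flow of `D`. It contracts areas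
by `e^{-At}`, and the quadratic form `Q(u) = y ^ m₁ uₓ² + x ^ m₂ uᵧ²` satisfies
`∫_{Φ_t Ω} Q(v_t) = e^{-Nt} ∫_Ω Q(u)` for `v_t = u ∘ Φ_{-t}`. Star-shapedness gives `Φ_t Ω ⊆ Ω`;
since it is a hypothesis on the closure, this needs that `Ω` is the interior of its closure
(`IsTricomiDomain.interior_closure`), a weak form of the Jordan curve theorem which is obtained from
continuous logarithms of `z - p` (`arc_notMem_interior`).

Green's formula on `Φ_t Ω` with test function `v_t` (`IsTricomiDomain.green`) is proved slice by
slice, for the extension of `u` by zero, which is continuous above the characteristic through the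
origin. On each slice the fundamental theorem of calculus is applied to a function vanishing off an
open set (`setIntegral_deriv_of_eq_zero_off_open`), so that the boundary of the domain plays no
role. Only an integral over the characteristic `BC'` remains: with `φ(τ)` the value of `u` at
`Φ_{-τ} C'`, it is `k J(t)`, where `J(t) = ∫ e^{Nτ} φ(τ + t) φ'(τ) dτ` and `k > 0`. Expanding
`Q(v_t - u)` yields (`IsTricomiDomain.energy_identity`)

  `∫_{Φ_t Ω} Q(v_t - u) + ∫_{Ω \ Φ_t Ω} Q(u) = (e^{-Nt} - 1) ∫_Ω Q(u)`
    `+ 2 (∫_Ω 𝒪u u - ∫_{Φ_t Ω} 𝒪u v_t) - 2 k (J(t) - J(0))`.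

As `t → 0+`, the left-hand side is bounded below by `o(t)`: its first term is `O(t²)`, and on the
thin strip `Ω \ Φ_t Ω` the form `Q(u)` is nonnegative in the elliptic region and tends to zero in
the hyperbolic region, because the gradient of `u` is isotropic on `AC'`, where `u` vanishes
(`IsTricomiDomain.isotropic_grad`). Write `G = ∫_Ω |u| ^ (α + 1)`. The right-hand side divided by
`t` tends to `-N ∫_Ω Q(u) + 2 A G / (α + 1) - 2 k S` with `S = ∫_{τ < 0} e^{Nτ} φ'²`. Now
`∫_Ω Q(u) = G + k J(0)`, and `S + (N / 2) J(0) = ∫ e^{Nτ} (φ' + (N / 2) φ)² ≥ 0` (`exp_hardy`).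
Hence `N G ≤ (2 A / (α + 1)) G` (`IsTricomiDomain.pohozaev`), and `α + 1 > 2* = 2 A / N` forces
`G = 0`.

If `α > 0`, the primitive `|s| ^ (α + 1) / (α + 1)` of the nonlinearity is differentiable
everywhere. Exponents `α ≤ 0` may also be supercritical; then a solution with a zero in `Ω` vanishes
identically, since `𝒪u` is continuous (`eq_zero_or_ne_zero_of_nonpos`), and the primitive is only
differentiated away from zero.
-/

open Set Filter Topology MeasureTheory

/-! ### Continuous logarithms and plane domains -/

/-- On a simply connected space, a nowhere vanishing function has a continuous logarithm: it lifts
through the covering `Complex.exp`. -/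
theorem exists_continuous_log {X : Type*} [TopologicalSpace X] [SimplyConnectedSpace X]
    [LocallyPathConnectedSpace X] {f : X → ℂ} (hf : Continuous f) (h0 : ∀ x, f x ≠ 0) :
    ∃ g : X → ℂ, Continuous g ∧ ∀ x, Complex.exp (g x) = f x := by
  obtain ⟨x₀⟩ := (inferInstance : Nonempty X)
  obtain ⟨F, ⟨-, hF⟩, -⟩ := Complex.isCoveringMapOn_exp.existsUnique_continuousMap_lifts
    ⟨f, hf⟩ (a₀ := x₀) (Complex.exp_log (h0 x₀)) (fun x => h0 x)
  exact ⟨F, F.continuous, fun x => congrFun hF x⟩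

/-- The point of `ℂ` with the same coordinates. -/
def planeToComplex (p : ℝ × ℝ) : ℂ := ⟨p.1, p.2⟩

theorem continuous_planeToComplex : Continuous planeToComplex :=
  Complex.equivRealProdCLM.symm.continuous

theorem planeToComplex_sub_ne_zero {p q : ℝ × ℝ} (h : p ≠ q) :
    planeToComplex p - planeToComplex q ≠ 0 := by
  intro h0
  apply h
  have := sub_eq_zero.1 h0
  simp only [planeToComplex, Complex.mk.injEq] at this
  exact Prod.ext this.1 this.2

/-- The winding number of a large circle: `z ↦ z - p` restricted to the complement of a disc does
not extend to a continuous nowhere vanishing function on the plane. -/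
theorem not_exists_nonvanishing_extension (p : ℝ × ℝ) (R : ℝ) (G : ℝ × ℝ → ℂ)
    (hG : Continuous G) (h0 : ∀ q, G q ≠ 0)
    (hR : ∀ q, R ≤ dist q p → G q = planeToComplex q - planeToComplex p) : False := by
  obtain ⟨l, hl, hexp⟩ := exists_continuous_log hG h0
  set ρ : ℝ := 2 * (|R| + 1) with hρ
  have hρ0 : 0 < ρ := by positivity
  set c : ℝ → ℝ × ℝ := fun θ => (p.1 + ρ * Real.cos θ, p.2 + ρ * Real.sin θ) with hc
  have hcc : Continuous c := by fun_prop
  have hdist : ∀ θ, R ≤ dist (c θ) p := by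
    intro θ
    rw [Prod.dist_eq, Real.dist_eq, Real.dist_eq]
    simp only [hc, add_sub_cancel_left, abs_mul, abs_of_pos hρ0]
    have h1 : 1 / 2 ≤ max |Real.cos θ| |Real.sin θ| := by
      by_contra! hlt
      obtain ⟨h1, h2⟩ := max_lt_iff.1 hlt
      have := Real.sin_sq_add_cos_sq θ
      rw [← sq_abs (Real.sin θ), ← sq_abs (Real.cos θ)] at this
      nlinarith [abs_nonneg (Real.sin θ), abs_nonneg (Real.cos θ)]
    have h2 : R ≤ ρ * (1 / 2) := by rw [hρ]; linarith [le_abs_self R]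
    rcases le_max_iff.1 h1 with h | h
    · exact le_max_of_le_left (h2.trans (by gcongr))
    · exact le_max_of_le_right (h2.trans (by gcongr))
  have hval : ∀ θ : ℝ, Complex.exp (l (c θ)) = ρ * Complex.exp (θ * Complex.I) := by
    intro θ
    rw [hexp, hR _ (hdist θ), Complex.exp_mul_I]
    apply Complex.ext <;> simp [planeToComplex, hc, ← Complex.ofReal_cos, ← Complex.ofReal_sin]
  -- the continuous function `(l (c θ) - iθ) / (2πi)` takes values in a translate of `ℤ`
  set F : ℝ → ℂ := fun θ => l (c θ) - θ * Complex.I - l (c 0) with hF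
  have hFc : Continuous F := by fun_prop
  have hFexp : ∀ θ, Complex.exp (F θ) = 1 := by
    intro θ
    have h00 := hval 0
    simp only [Complex.ofReal_zero, zero_mul, Complex.exp_zero, mul_one] at h00
    rw [hF]
    simp only
    rw [Complex.exp_sub, Complex.exp_sub, hval, h00]
    have : (ρ : ℂ) ≠ 0 := by exact_mod_cast hρ0.ne'
    field_simp
  have hFz : ∀ θ, ∃ n : ℤ, F θ = n * (2 * Real.pi * Complex.I) := fun θ =>
    Complex.exp_eq_one_iff.1 (hFexp θ)
  have hconst : ∀ θ, F θ = 0 := by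
    set φ : ℝ → ℝ := fun θ => (F θ).im / (2 * Real.pi) with hφ
    have hφc : Continuous φ := by fun_prop
    have hφz : ∀ θ, ∃ n : ℤ, φ θ = n := by
      intro θ
      obtain ⟨n, hn⟩ := hFz θ
      refine ⟨n, ?_⟩
      rw [hφ]
      simp only [hn]
      have := Real.pi_pos
      simp
    choose n hn using hφz
    have hnc : Continuous n := by
      have : Continuous fun θ => ((n θ : ℤ) : ℝ) := by
        have h : (fun θ => ((n θ : ℤ) : ℝ)) = φ := by ext θ; rw [hn]
        rw [h]; exact hφc
      exact Int.isClosedEmbedding_coe_real.isEmbedding.continuous_iff.2 this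
    have hloc : IsLocallyConstant n := (IsLocallyConstant.iff_continuous n).2 hnc
    intro θ
    have h1 : n θ = n 0 := hloc.apply_eq_of_preconnectedSpace θ 0
    have h2 : φ 0 = 0 := by simp [hφ, hF]
    have h3 : φ θ = 0 := by rw [hn, h1, ← hn, h2]
    obtain ⟨m, hm⟩ := hFz θ
    have h4 : φ θ = m := by
      rw [hφ]; simp only [hm]
      have := Real.pi_pos
      simp
    rw [h3] at h4
    have : m = 0 := by exact_mod_cast h4.symm
    rw [hm, this]; simp
  have h2π := hconst (2 * Real.pi)
  have hc2 : c (2 * Real.pi) = c 0 := by simp [hc]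
  rw [hF] at h2π
  simp only [hc2] at h2π
  have := congrArg Complex.im h2π
  simp at this

/-- If the boundary of a bounded closed set `K` is contained in a closed set `L` on which `z - p`
has a continuous logarithm, then `p` is not an interior point of `K`. -/
theorem notMem_interior_of_log {K L : Set (ℝ × ℝ)}
    (hKb : Bornology.IsBounded K) (hL : frontier K ⊆ L) {p : ℝ × ℝ} {l : ℝ × ℝ → ℂ}
    (hl : ContinuousOn l L)
    (hexp : ∀ q ∈ L, Complex.exp (l q) = planeToComplex q - planeToComplex p) :
    p ∉ interior K := by
  classical
  intro hp
  obtain ⟨H, hH⟩ := ContinuousMap.exists_restrict_eq (Y := ℂ) (isClosed_frontier (s := K))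
    ⟨(frontier K).domRestrict l, (hl.mono hL).domRestrict⟩
  have hH' : ∀ q ∈ frontier K, H q = l q := by
    intro q hq
    have := DFunLike.congr_fun hH ⟨q, hq⟩
    simpa using this
  set G : ℝ × ℝ → ℂ := K.piecewise (fun q => Complex.exp (H q))
    (fun q => planeToComplex q - planeToComplex p) with hG
  have hGc : Continuous G := by
    refine Continuous.piecewise ?_ (by fun_prop) (continuous_planeToComplex.sub continuous_const)
    intro q hq
    rw [hH' q hq, hexp q (hL hq)]
  have hG0 : ∀ q, G q ≠ 0 := by
    intro q
    by_cases hq : q ∈ K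
    · rw [hG, Set.piecewise_eq_of_mem _ _ _ hq]; exact Complex.exp_ne_zero _
    · rw [hG, Set.piecewise_eq_of_notMem _ _ _ hq]
      exact planeToComplex_sub_ne_zero fun h => hq (h ▸ interior_subset hp)
  obtain ⟨R, hR⟩ := hKb.subset_closedBall p
  refine not_exists_nonvanishing_extension p (R + 1) G hGc hG0 fun q hq => ?_
  rw [hG, Set.piecewise_eq_of_notMem]
  intro h
  have := hR h
  rw [Metric.mem_closedBall] at this
  linarith

/-- Along an arc avoiding `p`, the function `z - p` has a continuous logarithm, with a prescribed
value at one point. -/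
theorem exists_log_on_arc {γ : ℝ → ℝ × ℝ} {c d : ℝ} (hcd : c ≤ d)
    (hγ : ContinuousOn γ (Icc c d)) (hinj : InjOn γ (Icc c d)) {p : ℝ × ℝ}
    (hp : p ∉ γ '' Icc c d) {e : ℝ} (he : e ∈ Icc c d) {w : ℂ}
    (hw : Complex.exp w = planeToComplex (γ e) - planeToComplex p) :
    ∃ l : ℝ × ℝ → ℂ, ContinuousOn l (γ '' Icc c d) ∧ l (γ e) = w ∧
      ∀ q ∈ γ '' Icc c d, Complex.exp (l q) = planeToComplex q - planeToComplex p := by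
  obtain ⟨g, hg, hgexp⟩ := exists_continuous_log (X := ℝ)
    (f := fun s => planeToComplex (γ (projIcc c d hcd s)) - planeToComplex p)
    ((continuous_planeToComplex.comp
      (hγ.comp_continuous (continuous_subtype_val.comp continuous_projIcc)
        fun x => (projIcc c d hcd x).2)).sub continuous_const)
    (fun s => planeToComplex_sub_ne_zero fun h => hp ⟨_, (projIcc c d hcd s).2, h⟩)
  set ψ : ℝ × ℝ → ℝ := Function.invFunOn γ (Icc c d) with hψ
  have hψm : ∀ q ∈ γ '' Icc c d, ψ q ∈ Icc c d ∧ γ (ψ q) = q := fun q hq =>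
    ⟨Function.invFunOn_mem hq, Function.invFunOn_eq hq⟩
  have hψγ : ∀ s ∈ Icc c d, ψ (γ s) = s := fun s hs => hinj.leftInvOn_invFunOn hs
  have hψc : ContinuousOn ψ (γ '' Icc c d) := by
    have hcl : IsClosedEmbedding ((Icc c d).domRestrict γ) := by
      refine Continuous.isClosedEmbedding hγ.domRestrict ?_
      exact injOn_iff_injective.1 hinj
    rw [continuousOn_iff_isClosed]
    intro t ht
    refine ⟨γ '' (Icc c d ∩ t), ?_, ?_⟩
    · exact ((isCompact_Icc.inter_right ht).image_of_continuousOn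
        (hγ.mono inter_subset_left)).isClosed
    · ext q
      constructor
      · rintro ⟨h1, h2⟩
        exact ⟨⟨ψ q, ⟨(hψm q h2).1, h1⟩, (hψm q h2).2⟩, h2⟩
      · rintro ⟨⟨s, ⟨hs, hst⟩, rfl⟩, h2⟩
        exact ⟨by rw [mem_preimage, hψγ s hs]; exact hst, h2⟩
  have hge : Complex.exp (g e) = Complex.exp w := by
    rw [hgexp, projIcc_of_mem hcd he, hw]
  refine ⟨fun q => g (ψ q) + (w - g e), (hg.comp_continuousOn hψc).add continuousOn_const, ?_, ?_⟩
  · simp only [hψγ e he]; ring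
  · intro q hq
    rw [Complex.exp_add, Complex.exp_sub, hge, div_self (Complex.exp_ne_zero _), mul_one, hgexp,
      projIcc_of_mem hcd (hψm q hq).1, (hψm q hq).2]

theorem exists_log_on_lower {p : ℝ × ℝ} (hp : 0 < p.2) :
    ∃ l : ℝ × ℝ → ℂ, ContinuousOn l {q | q.2 ≤ 0} ∧
      ∀ q ∈ {q : ℝ × ℝ | q.2 ≤ 0}, Complex.exp (l q) = planeToComplex q - planeToComplex p := by
  refine ⟨fun q => Complex.log (planeToComplex q - planeToComplex p), ?_, ?_⟩
  · refine ContinuousOn.clog (continuous_planeToComplex.sub continuous_const).continuousOn ?_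
    intro q hq
    right
    simp only [planeToComplex, Complex.sub_im]
    have : q.2 ≤ 0 := hq
    linarith
  · intro q hq
    refine Complex.exp_log (planeToComplex_sub_ne_zero ?_)
    rintro rfl
    have : q.2 ≤ 0 := hq
    linarith

/-- A Jordan-type statement: let `σ` be an arc in the upper half plane joining two points of the
horizontal axis. If the boundary of the bounded closed set `K` is contained in the union of `σ` and
the closed lower half plane, then no point of `σ` of positive ordinate is interior to `K`. -/
theorem arc_notMem_interior {K : Set (ℝ × ℝ)}
    (hKb : Bornology.IsBounded K) {γ : ℝ → ℝ × ℝ} (hγ : ContinuousOn γ (Icc 0 1))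
    (hinj : InjOn γ (Icc 0 1)) (h0 : (γ 0).2 = 0) (h1 : (γ 1).2 = 0)
    (hpos : ∀ s ∈ Ioo (0 : ℝ) 1, 0 < (γ s).2)
    (hK : frontier K ⊆ γ '' Icc 0 1 ∪ {q | q.2 ≤ 0}) {s₀ : ℝ} (hs₀ : s₀ ∈ Ioo (0 : ℝ) 1) :
    γ s₀ ∉ interior K := by
  classical
  intro hint
  set p := γ s₀ with hp
  have hpp : 0 < p.2 := hpos s₀ hs₀
  -- a parameter interval around `s₀` is mapped into the interior of `K`
  obtain ⟨δ, hδ, hδK⟩ : ∃ δ > 0, ∀ s ∈ Icc (0 : ℝ) 1, |s - s₀| < δ → γ s ∈ interior K := by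
    have hc : ContinuousWithinAt γ (Icc 0 1) s₀ := hγ s₀ ⟨hs₀.1.le, hs₀.2.le⟩
    have := hc (isOpen_interior.mem_nhds hint)
    obtain ⟨δ, hδ, h⟩ := Metric.mem_nhdsWithin_iff.1 this
    exact ⟨δ, hδ, fun s hs hsd => h ⟨by rwa [Metric.mem_ball, Real.dist_eq], hs⟩⟩
  obtain ⟨ε, hε, hεδ, hε0, hε1⟩ : ∃ ε > 0, ε < δ ∧ 0 ≤ s₀ - ε ∧ s₀ + ε ≤ 1 := by
    refine ⟨min (δ / 2) (min s₀ (1 - s₀)), ?_, ?_, ?_, ?_⟩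
    · exact lt_min (by linarith) (lt_min hs₀.1 (by linarith [hs₀.2]))
    · exact (min_le_left _ _).trans_lt (by linarith)
    · have := (min_le_right (δ / 2) (min s₀ (1 - s₀))).trans (min_le_left _ _); linarith
    · have := (min_le_right (δ / 2) (min s₀ (1 - s₀))).trans (min_le_right _ _); linarith
  have hsub1 : Icc 0 (s₀ - ε) ⊆ Icc (0 : ℝ) 1 := Icc_subset_Icc le_rfl (by linarith)
  have hsub2 : Icc (s₀ + ε) 1 ⊆ Icc (0 : ℝ) 1 := Icc_subset_Icc (by linarith) le_rfl
  have hp1 : p ∉ γ '' Icc 0 (s₀ - ε) := by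
    rintro ⟨s, hs, h⟩
    have := hinj (hsub1 hs) ⟨hs₀.1.le, hs₀.2.le⟩ h
    linarith [hs.2]
  have hp2 : p ∉ γ '' Icc (s₀ + ε) 1 := by
    rintro ⟨s, hs, h⟩
    have := hinj (hsub2 hs) ⟨hs₀.1.le, hs₀.2.le⟩ h
    linarith [hs.1]
  obtain ⟨l, hl, hle⟩ := exists_log_on_lower hpp
  obtain ⟨l₁, hl₁, hl₁0, hl₁e⟩ := exists_log_on_arc (by linarith) (hγ.mono hsub1)
    (hinj.mono hsub1) hp1 (e := 0) ⟨le_rfl, by linarith⟩ (hle (γ 0) h0.le)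
  obtain ⟨l₂, hl₂, hl₂0, hl₂e⟩ := exists_log_on_arc (by linarith) (hγ.mono hsub2)
    (hinj.mono hsub2) hp2 (e := 1) ⟨by linarith, le_rfl⟩ (hle (γ 1) h1.le)
  set S₁ := γ '' Icc 0 (s₀ - ε)
  set S₂ := γ '' Icc (s₀ + ε) 1
  have hS₁c : IsClosed S₁ := (isCompact_Icc.image_of_continuousOn (hγ.mono hsub1)).isClosed
  have hS₂c : IsClosed S₂ := (isCompact_Icc.image_of_continuousOn (hγ.mono hsub2)).isClosed
  set H : Set (ℝ × ℝ) := {q | q.2 ≤ 0}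
  have hHc : IsClosed H := isClosed_le continuous_snd continuous_const
  -- the three pieces meet only at the end points of the arc
  have hm1 : ∀ q ∈ S₁, q ∈ H → q = γ 0 := by
    rintro q ⟨s, hs, rfl⟩ hq
    rcases eq_or_lt_of_le hs.1 with h | h
    · rw [← h]
    · exact absurd (hpos s ⟨h, by linarith [hs.2, hs₀.2]⟩) (not_lt.2 hq)
  have hm2 : ∀ q ∈ S₂, q ∈ H → q = γ 1 := by
    rintro q ⟨s, hs, rfl⟩ hq
    rcases eq_or_lt_of_le hs.2 with h | h
    · rw [h]
    · exact absurd (hpos s ⟨by linarith [hs.1, hs₀.1], h⟩) (not_lt.2 hq)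
  have hm12 : ∀ q ∈ S₁, q ∉ S₂ := by
    rintro q ⟨s, hs, rfl⟩ ⟨s', hs', h⟩
    have := hinj (hsub2 hs') (hsub1 hs) h
    linarith [hs.2, hs'.1]
  set m : ℝ × ℝ → ℂ := fun q => if q ∈ H then l q else if q ∈ S₁ then l₁ q else l₂ q with hm
  have hmH : EqOn m l H := fun q hq => by simp [hm, hq]
  have hmS₁ : EqOn m l₁ S₁ := fun q hq => by
    by_cases hqH : q ∈ H
    · rw [hmH hqH, hm1 q hq hqH, hl₁0]
    · simp [hm, hqH, hq]
  have hmS₂ : EqOn m l₂ S₂ := fun q hq => by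
    by_cases hqH : q ∈ H
    · rw [hmH hqH, hm2 q hq hqH, hl₂0]
    · have : q ∉ S₁ := fun h => hm12 q h hq
      simp [hm, hqH, this]
  refine notMem_interior_of_log hKb (L := (H ∪ S₁) ∪ S₂) (l := m) ?_ ?_ ?_ hint
  · intro q hq
    rcases hK hq with ⟨s, hs, rfl⟩ | h
    · by_cases hsd : |s - s₀| < δ
      · exact absurd (hδK s hs hsd) hq.2
      · rw [not_lt, le_abs] at hsd
        rcases hsd with h | h
        · exact Or.inr ⟨s, ⟨by linarith, hs.2⟩, rfl⟩
        · exact Or.inl (Or.inr ⟨s, ⟨hs.1, by linarith⟩, rfl⟩)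
    · exact Or.inl (Or.inl h)
  · exact ((hl.congr hmH).union_of_isClosed (hl₁.congr hmS₁) hHc hS₁c).union_of_isClosed
      (hl₂.congr hmS₂) (hHc.union hS₁c) hS₂c
  · rintro q ((hq | hq) | hq)
    · rw [hmH hq]; exact hle q hq
    · rw [hmS₁ hq]; exact hl₁e q hq
    · rw [hmS₂ hq]; exact hl₂e q hq

/-- A preconnected set which meets `t` but not the boundary of `t` is contained in `t`. -/
theorem IsPreconnected.subset_of_disjoint_frontier {X : Type*} [TopologicalSpace X] {s t : Set X}
    (hs : IsPreconnected s) (hst : (s ∩ t).Nonempty) (hd : ∀ x ∈ s, x ∉ frontier t) : s ⊆ t := by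
  intro x hx
  by_contra hxt
  obtain ⟨y, hys, hyt⟩ := hst
  have hint : ∀ z ∈ s, z ∈ t → z ∈ interior t := fun z hz hzt => by
    by_contra h; exact hd z hz ⟨subset_closure hzt, h⟩
  have hext : ∀ z ∈ s, z ∉ t → z ∈ (closure t)ᶜ := fun z hz hzt h =>
    hd z hz ⟨h, fun h' => hzt (interior_subset h')⟩
  obtain ⟨z, -, hz1, hz2⟩ := hs (interior t) (closure t)ᶜ isOpen_interior
    isClosed_closure.isOpen_compl (fun z hz => by
      by_cases h : z ∈ t
      · exact Or.inl (hint z hz h)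
      · exact Or.inr (hext z hz h)) ⟨y, hys, hint y hys hyt⟩ ⟨x, hx, hext x hx hxt⟩
  exact hz2 (subset_closure (interior_subset hz1))

/-! ### The closed domain near the characteristics -/

/-- The function `s ↦ s ^ ((m + 2) / 2) / (m + 2)`, half of the primitive of `s ^ (m / 2)`. In the
variables `charPow m₂ x` and `charPow m₁ (-y)` the characteristics of the operator are straight
lines of slope `±1`. -/
noncomputable def charPow (m : ℕ) (s : ℝ) : ℝ := s ^ (((m : ℝ) + 2) / 2) / ((m : ℝ) + 2)

/-- The inverse of `charPow m` on the nonnegative half line. -/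
noncomputable def charRoot (m : ℕ) (r : ℝ) : ℝ := (((m : ℝ) + 2) * r) ^ (2 / ((m : ℝ) + 2))

theorem two_add_pos (m : ℕ) : (0 : ℝ) < (m : ℝ) + 2 := by positivity

theorem continuous_charPow (m : ℕ) : Continuous (charPow m) :=
  (Real.continuous_rpow_const (by positivity)).div_const _

theorem continuous_charRoot (m : ℕ) : Continuous (charRoot m) :=
  (Real.continuous_rpow_const (by positivity)).comp (continuous_const.mul continuous_id)

@[simp] theorem charPow_zero (m : ℕ) : charPow m 0 = 0 := by
  have := two_add_pos m
  rw [charPow, Real.zero_rpow (by positivity), zero_div]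

theorem charPow_strictMonoOn (m : ℕ) : StrictMonoOn (charPow m) (Ici 0) := by
  intro s hs t _ hst
  exact div_lt_div_of_pos_right (Real.rpow_lt_rpow hs hst (by positivity)) (two_add_pos m)

theorem charPow_lt {m : ℕ} {s t : ℝ} (hs : 0 ≤ s) (h : s < t) : charPow m s < charPow m t :=
  charPow_strictMonoOn m hs (hs.trans h.le) h

theorem charPow_le {m : ℕ} {s t : ℝ} (hs : 0 ≤ s) (h : s ≤ t) : charPow m s ≤ charPow m t :=
  (charPow_strictMonoOn m).monotoneOn hs (hs.trans h) h

theorem charPow_pos {m : ℕ} {s : ℝ} (hs : 0 < s) : 0 < charPow m s := by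
  simpa using charPow_lt (m := m) le_rfl hs

theorem charPow_nonneg {m : ℕ} {s : ℝ} (hs : 0 ≤ s) : 0 ≤ charPow m s := by
  simpa using charPow_le (m := m) le_rfl hs

theorem charRoot_nonneg {m : ℕ} {r : ℝ} (hr : 0 ≤ r) : 0 ≤ charRoot m r := by
  unfold charRoot; positivity

theorem charRoot_pos {m : ℕ} {r : ℝ} (hr : 0 < r) : 0 < charRoot m r := by
  unfold charRoot; positivity

theorem charPow_charRoot {m : ℕ} {r : ℝ} (hr : 0 ≤ r) : charPow m (charRoot m r) = r := by
  have := two_add_pos m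
  rw [charPow, charRoot, ← Real.rpow_mul (by positivity)]
  have h : 2 / ((m : ℝ) + 2) * (((m : ℝ) + 2) / 2) = 1 := by field_simp
  rw [h, Real.rpow_one]
  field_simp

theorem charRoot_charPow {m : ℕ} {s : ℝ} (hs : 0 ≤ s) : charRoot m (charPow m s) = s :=
  (charPow_strictMonoOn m).injOn (charRoot_nonneg (charPow_nonneg hs)) hs
    (charPow_charRoot (charPow_nonneg hs))

theorem charPow_mul_exp (m : ℕ) {s : ℝ} (hs : 0 ≤ s) (c : ℝ) :
    charPow m (s * Real.exp c) = charPow m s * Real.exp (((m : ℝ) + 2) / 2 * c) := by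
  rw [charPow, charPow, Real.mul_rpow hs (Real.exp_pos _).le, ← Real.exp_mul]
  ring_nf

theorem hasDerivAt_charRoot {m : ℕ} {r : ℝ} (hr : 0 < r) :
    HasDerivAt (charRoot m) (2 / charRoot m r ^ ((m : ℝ) / 2)) r := by
  have hm := two_add_pos m
  have hbase : 0 < ((m : ℝ) + 2) * r := by positivity
  have h1 : HasDerivAt (fun r : ℝ => ((m : ℝ) + 2) * r) ((m : ℝ) + 2) r := by
    simpa using (hasDerivAt_id r).const_mul ((m : ℝ) + 2)
  have h2 := h1.rpow_const (p := 2 / ((m : ℝ) + 2)) (Or.inl hbase.ne')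
  convert! h2 using 1
  rw [charRoot, ← Real.rpow_mul hbase.le]
  have e1 : 2 / ((m : ℝ) + 2) - 1 = -(2 / ((m : ℝ) + 2) * ((m : ℝ) / 2)) := by field_simp; ring
  rw [e1, Real.rpow_neg hbase.le]
  field_simp

section Geometry

variable {m₁ m₂ : ℕ} {x₀ : ℝ} {σ Ω : Set (ℝ × ℝ)}

theorem charY_eq (m₁ m₂ : ℕ) (x₀ : ℝ) :
    charY m₁ m₂ x₀ = -charRoot m₁ (charPow m₂ (2 * x₀) / 2) := by
  have := two_add_pos m₂
  rw [charY, charRoot, charPow]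
  congr 2
  field_simp

theorem charY_le_iff (hx : 0 < x₀) {y : ℝ} (hy : y ≤ 0) :
    charY m₁ m₂ x₀ ≤ y ↔ charPow m₁ (-y) ≤ charPow m₂ (2 * x₀) / 2 := by
  have hE : 0 ≤ charPow m₂ (2 * x₀) / 2 := by
    have := charPow_pos (m := m₂) (s := 2 * x₀) (by positivity)
    positivity
  rw [charY_eq, neg_le, ← (charPow_strictMonoOn m₁).le_iff_le (a := -y)
    (mem_Ici.2 (by linarith)) (charRoot_nonneg hE), charPow_charRoot hE]

theorem mem_charAC_iff (hx : 0 < x₀) {p : ℝ × ℝ} :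
    p ∈ charAC m₁ m₂ x₀ ↔ 0 ≤ p.1 ∧ p.2 ≤ 0 ∧ charPow m₁ (-p.2) ≤ charPow m₂ (2 * x₀) / 2 ∧
      charPow m₁ (-p.2) + charPow m₂ p.1 = charPow m₂ (2 * x₀) := by
  have key : (2 / ((m₁ : ℝ) + 2) * (-p.2) ^ (((m₁ : ℝ) + 2) / 2) =
      -(2 / ((m₂ : ℝ) + 2)) *
        (p.1 ^ (((m₂ : ℝ) + 2) / 2) - (2 * x₀) ^ (((m₂ : ℝ) + 2) / 2))) ↔
      charPow m₁ (-p.2) + charPow m₂ p.1 = charPow m₂ (2 * x₀) := by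
    unfold charPow
    constructor <;> intro h
    · linear_combination (1 / 2 : ℝ) * h
    · linear_combination 2 * h
  rw [charAC, mem_ofPred_eq, key]
  constructor
  · rintro ⟨h1, h2, h3, h4⟩
    exact ⟨h1, h3, (charY_le_iff hx h3).1 h2, h4⟩
  · rintro ⟨h1, h3, h2, h4⟩
    exact ⟨h1, (charY_le_iff hx h3).2 h2, h3, h4⟩

theorem mem_charBC_iff (hx : 0 < x₀) {p : ℝ × ℝ} :
    p ∈ charBC m₁ m₂ x₀ ↔ 0 ≤ p.1 ∧ p.2 ≤ 0 ∧ charPow m₁ (-p.2) ≤ charPow m₂ (2 * x₀) / 2 ∧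
      charPow m₁ (-p.2) = charPow m₂ p.1 := by
  have key : (2 / ((m₁ : ℝ) + 2) * (-p.2) ^ (((m₁ : ℝ) + 2) / 2) =
      2 / ((m₂ : ℝ) + 2) * p.1 ^ (((m₂ : ℝ) + 2) / 2)) ↔
      charPow m₁ (-p.2) = charPow m₂ p.1 := by
    unfold charPow
    constructor <;> intro h
    · linear_combination (1 / 2 : ℝ) * h
    · linear_combination 2 * h
  rw [charBC, mem_ofPred_eq, key]
  constructor
  · rintro ⟨h1, h2, h3, h4⟩
    exact ⟨h1, h3, (charY_le_iff hx h3).1 h2, h4⟩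
  · rintro ⟨h1, h3, h2, h4⟩
    exact ⟨h1, (charY_le_iff hx h3).2 h2, h3, h4⟩

/-- The characteristic triangle bounded by the two characteristic arcs and the parabolic segment. -/
def charTriangle (m₁ m₂ : ℕ) (x₀ : ℝ) : Set (ℝ × ℝ) :=
  {p | 0 < p.1 ∧ p.2 < 0 ∧ charPow m₁ (-p.2) < charPow m₂ p.1 ∧
    charPow m₁ (-p.2) + charPow m₂ p.1 < charPow m₂ (2 * x₀)}

/-- The closed region above the complete characteristic through the origin; it is invariant under
the flow of the dilations. -/
def charRegion (m₁ m₂ : ℕ) : Set (ℝ × ℝ) :=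
  {p | p.2 < 0 → 0 ≤ p.1 ∧ charPow m₁ (-p.2) ≤ charPow m₂ p.1}

theorem IsTricomiDomain.mem_sigma_cases (h : IsTricomiDomain m₁ m₂ x₀ σ Ω) {p : ℝ × ℝ}
    (hp : p ∈ σ) : p = (2 * x₀, 0) ∨ p = (0, 0) ∨ 0 < p.2 := by
  by_cases h1 : p = (2 * x₀, 0)
  · exact Or.inl h1
  by_cases h2 : p = (0, 0)
  · exact Or.inr (Or.inl h2)
  exact Or.inr (Or.inr (h.arc_upper p hp h1 h2))

theorem IsTricomiDomain.origin_mem_sigma (h : IsTricomiDomain m₁ m₂ x₀ σ Ω) :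
    ((0, 0) : ℝ × ℝ) ∈ σ := by
  obtain ⟨γ, -, -, him, -, h1, -⟩ := h.arc
  rw [← him, ← h1]
  exact mem_image_of_mem γ ⟨zero_le_one, le_rfl⟩

theorem IsTricomiDomain.charE_pos (h : IsTricomiDomain m₁ m₂ x₀ σ Ω) :
    0 < charPow m₂ (2 * x₀) := charPow_pos (by have := h.x₀_pos; positivity)

theorem IsTricomiDomain.frontier_lower (h : IsTricomiDomain m₁ m₂ x₀ σ Ω) {p : ℝ × ℝ}
    (hp : p ∈ frontier Ω) (hy : p.2 < 0) : p ∈ charAC m₁ m₂ x₀ ∨ p ∈ charBC m₁ m₂ x₀ := by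
  rw [h.frontier_eq] at hp
  rcases hp with (hp | hp) | hp
  · rcases h.mem_sigma_cases hp with h1 | h1 | h1
    · rw [h1] at hy; exact absurd hy (lt_irrefl _)
    · rw [h1] at hy; exact absurd hy (lt_irrefl _)
    · exact absurd hy h1.not_gt
  · exact Or.inl hp
  · exact Or.inr hp

theorem IsTricomiDomain.frontier_axis (h : IsTricomiDomain m₁ m₂ x₀ σ Ω) {p : ℝ × ℝ}
    (hp : p ∈ frontier Ω) (hy : p.2 = 0) : p = (2 * x₀, 0) ∨ p = (0, 0) := by
  rw [h.frontier_eq] at hp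
  rcases hp with (hp | hp) | hp
  · rcases h.mem_sigma_cases hp with h1 | h1 | h1
    · exact Or.inl h1
    · exact Or.inr h1
    · exact absurd hy h1.ne'
  · obtain ⟨h1, -, -, h4⟩ := (mem_charAC_iff h.x₀_pos).1 hp
    rw [hy, neg_zero, charPow_zero, zero_add] at h4
    left
    have hx := h.x₀_pos
    exact Prod.ext ((charPow_strictMonoOn m₂).injOn h1 (mem_Ici.2 (by positivity)) h4) hy
  · obtain ⟨h1, -, -, h4⟩ := (mem_charBC_iff h.x₀_pos).1 hp
    rw [hy, neg_zero, charPow_zero, ← charPow_zero m₂] at h4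
    exact Or.inr (Prod.ext ((charPow_strictMonoOn m₂).injOn h1 (mem_Ici.2 le_rfl) h4.symm) hy)

/-- A point which can escape to infinity on a horizontal ray without crossing the boundary is not in
the bounded set `Ω`. -/
theorem IsTricomiDomain.notMem_of_left_ray (h : IsTricomiDomain m₁ m₂ x₀ σ Ω) {p : ℝ × ℝ}
    (hp : ∀ s ≤ p.1, (s, p.2) ∉ frontier Ω) : p ∉ Ω := by
  intro hpΩ
  have hsub : (fun s : ℝ => (s, p.2)) '' Iic p.1 ⊆ Ω := by
    refine ((convex_Iic p.1).isPreconnected.image _ (by fun_prop)).subset_of_disjoint_frontier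
      ⟨p, ⟨p.1, le_refl p.1, rfl⟩, hpΩ⟩ ?_
    rintro _ ⟨s, hs, rfl⟩
    exact hp s hs
  obtain ⟨R, hR⟩ := (h.isBounded.subset hsub).subset_closedBall p
  have := hR (mem_image_of_mem _ (show p.1 - (|R| + 1) ∈ Iic p.1 by
    simp only [mem_Iic]; linarith [abs_nonneg R]))
  rw [Metric.mem_closedBall, Prod.dist_eq, Real.dist_eq] at this
  have h2 := (le_max_left _ _).trans this
  simp only [sub_sub_cancel_left, abs_neg] at h2
  rw [abs_of_pos (by positivity)] at h2
  linarith [le_abs_self R]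

theorem IsTricomiDomain.notMem_of_right_ray (h : IsTricomiDomain m₁ m₂ x₀ σ Ω) {p : ℝ × ℝ}
    (hp : ∀ s, p.1 ≤ s → (s, p.2) ∉ frontier Ω) : p ∉ Ω := by
  intro hpΩ
  have hsub : (fun s : ℝ => (s, p.2)) '' Ici p.1 ⊆ Ω := by
    refine ((convex_Ici p.1).isPreconnected.image _ (by fun_prop)).subset_of_disjoint_frontier
      ⟨p, ⟨p.1, le_refl p.1, rfl⟩, hpΩ⟩ ?_
    rintro _ ⟨s, hs, rfl⟩
    exact hp s hs
  obtain ⟨R, hR⟩ := (h.isBounded.subset hsub).subset_closedBall p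
  have := hR (mem_image_of_mem _ (show p.1 + (|R| + 1) ∈ Ici p.1 by
    simp only [mem_Ici]; linarith [abs_nonneg R]))
  rw [Metric.mem_closedBall, Prod.dist_eq, Real.dist_eq] at this
  have h2 := (le_max_left _ _).trans this
  simp only [add_sub_cancel_left] at h2
  rw [abs_of_pos (by positivity)] at h2
  linarith [le_abs_self R]

/-- The part of `Ω` below the axis lies in the characteristic triangle: outside of the triangle one
of the two horizontal rays does not meet the boundary. -/
theorem IsTricomiDomain.mem_triangle_of_mem (h : IsTricomiDomain m₁ m₂ x₀ σ Ω) {p : ℝ × ℝ}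
    (hp : p ∈ Ω) (hy : p.2 < 0) : p ∈ charTriangle m₁ m₂ x₀ := by
  have hfr : p ∉ frontier Ω := fun hf => by
    have := h.isOpen.inter_frontier_eq
    exact (this ▸ (⟨hp, hf⟩ : p ∈ Ω ∩ frontier Ω) : p ∈ (∅ : Set (ℝ × ℝ)))
  have hE := h.charE_pos
  have hx0 := h.x₀_pos
  by_cases h1 : p.1 ≤ 0 ∨ charPow m₂ p.1 < charPow m₁ (-p.2)
  · exfalso
    refine h.notMem_of_left_ray (fun s hs hf => ?_) hp
    -- on the ray one stays strictly below the characteristic through the origin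
    have key : 0 ≤ s → charPow m₂ s < charPow m₁ (-p.2) := by
      intro hs0
      rcases h1 with h1 | h1
      · have : s = 0 := le_antisymm (hs.trans h1) hs0
        rw [this, charPow_zero]
        exact charPow_pos (by linarith)
      · exact (charPow_le hs0 hs).trans_lt h1
    rcases h.frontier_lower hf hy with hf | hf
    · obtain ⟨h2, -, h4, h5⟩ := (mem_charAC_iff hx0).1 hf
      have := key h2
      simp only at h4 h5
      linarith
    · obtain ⟨h2, -, h4, h5⟩ := (mem_charBC_iff hx0).1 hf
      have := key h2
      simp only at h4 h5
      linarith
  push Not at h1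
  obtain ⟨hx, h1⟩ := h1
  have h1' : charPow m₁ (-p.2) < charPow m₂ p.1 ∨
      charPow m₂ (2 * x₀) < charPow m₁ (-p.2) + charPow m₂ p.1 := by
    by_contra! hcon
    refine hfr ?_
    rw [h.frontier_eq]
    right
    rw [mem_charBC_iff hx0]
    exact ⟨hx.le, hy.le, by linarith, by linarith⟩
  by_cases h2 : charPow m₁ (-p.2) + charPow m₂ p.1 < charPow m₂ (2 * x₀)
  · exact ⟨hx, hy, by rcases h1' with h | h <;> linarith, h2⟩
  rcases (not_lt.1 h2).eq_or_lt with h3 | h3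
  · exfalso
    refine hfr ?_
    rw [h.frontier_eq]
    left; right
    rw [mem_charAC_iff hx0]
    exact ⟨hx.le, hy.le, by linarith, h3.symm⟩
  · exfalso
    refine h.notMem_of_right_ray (fun s hs hf => ?_) hp
    have hmono := charPow_le (m := m₂) hx.le hs
    rcases h.frontier_lower hf hy with hf | hf
    · obtain ⟨-, -, -, h5⟩ := (mem_charAC_iff hx0).1 hf
      simp only at h5
      linarith
    · obtain ⟨-, -, h4, h5⟩ := (mem_charBC_iff hx0).1 hf
      simp only at h4 h5
      linarith

/-- The inverse of the change of variables `(x, y) ↦ (charPow m₂ x, charPow m₁ (-y))` which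
straightens the characteristics. -/
noncomputable def charMap (m₁ m₂ : ℕ) (r : ℝ × ℝ) : ℝ × ℝ := (charRoot m₂ r.1, -charRoot m₁ r.2)

theorem continuous_charMap (m₁ m₂ : ℕ) : Continuous (charMap m₁ m₂) :=
  ((continuous_charRoot m₂).comp continuous_fst).prodMk
    ((continuous_charRoot m₁).comp continuous_snd).neg

/-- The triangle onto which the characteristic triangle is straightened. -/
def flatTriangle (E : ℝ) : Set (ℝ × ℝ) := {r | 0 < r.2 ∧ r.2 < r.1 ∧ r.1 + r.2 < E}

theorem convex_flatTriangle (E : ℝ) : Convex ℝ (flatTriangle E) := by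
  intro p hp q hq s t hs ht hst
  obtain ⟨h1, h2, h3⟩ := hp
  obtain ⟨h4, h5, h6⟩ := hq
  simp only [flatTriangle, mem_ofPred_eq, Prod.fst_add, Prod.snd_add, Prod.smul_fst, Prod.smul_snd,
    smul_eq_mul]
  rcases hs.eq_or_lt with rfl | hs
  · have : t = 1 := by linarith
    subst this
    refine ⟨?_, ?_, ?_⟩ <;> linarith
  · have e1 := mul_lt_mul_of_pos_left h1 hs
    have e2 := mul_lt_mul_of_pos_left h2 hs
    have e3 := mul_lt_mul_of_pos_left h3 hs
    have e4 := mul_le_mul_of_nonneg_left h4.le ht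
    have e5 := mul_le_mul_of_nonneg_left h5.le ht
    have e6 := mul_le_mul_of_nonneg_left h6.le ht
    have : s * E + t * E = E := by rw [← add_mul, hst, one_mul]
    refine ⟨?_, ?_, ?_⟩ <;> linarith

theorem isOpen_flatTriangle (E : ℝ) : IsOpen (flatTriangle E) :=
  (isOpen_lt continuous_const continuous_snd).inter
    ((isOpen_lt continuous_snd continuous_fst).inter
      (isOpen_lt (continuous_fst.add continuous_snd) continuous_const))

theorem charMap_image_flatTriangle :
    charMap m₁ m₂ '' flatTriangle (charPow m₂ (2 * x₀)) = charTriangle m₁ m₂ x₀ := by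
  ext p
  constructor
  · rintro ⟨r, ⟨h1, h2, h3⟩, rfl⟩
    have h4 : 0 < r.1 := h1.trans h2
    simp only [charMap, charTriangle, mem_ofPred_eq, neg_neg, charPow_charRoot h1.le,
      charPow_charRoot h4.le, Left.neg_neg_iff]
    exact ⟨charRoot_pos h4, charRoot_pos h1, h2, by linarith⟩
  · rintro ⟨h1, h2, h3, h4⟩
    refine ⟨(charPow m₂ p.1, charPow m₁ (-p.2)), ⟨charPow_pos (by linarith), h3, ?_⟩, ?_⟩
    · simp only; linarith
    · rw [charMap, charRoot_charPow h1.le, charRoot_charPow (by linarith), neg_neg]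

/-- The characteristic triangle is contained in `Ω`: it is connected, free of boundary points, and
it meets `Ω` near the boundary point `C'`. -/
theorem IsTricomiDomain.triangle_subset (h : IsTricomiDomain m₁ m₂ x₀ σ Ω) :
    charTriangle m₁ m₂ x₀ ⊆ Ω := by
  have hx0 := h.x₀_pos
  have hE := h.charE_pos
  have hpre : IsPreconnected (charTriangle m₁ m₂ x₀) := by
    rw [← charMap_image_flatTriangle]
    exact (convex_flatTriangle _).isPreconnected.image _ (continuous_charMap _ _).continuousOn
  refine hpre.subset_of_disjoint_frontier ?_ ?_
  · -- the vertex of the triangle is a limit of points of `Ω` of negative ordinate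
    set E := charPow m₂ (2 * x₀) with hEdef
    set c : ℝ × ℝ := charMap m₁ m₂ (E / 2, E / 2) with hc
    have hc2 : c.2 < 0 := by
      have := charRoot_pos (m := m₁) (half_pos hE)
      simp only [hc, charMap]; linarith
    have hcAC : c ∈ charAC m₁ m₂ x₀ := by
      rw [mem_charAC_iff hx0, ← hEdef]
      refine ⟨charRoot_nonneg (half_pos hE).le, hc2.le, ?_, ?_⟩
      · simp only [hc, charMap, neg_neg, charPow_charRoot (half_pos hE).le, le_refl]
      · simp only [hc, charMap, neg_neg, charPow_charRoot (half_pos hE).le, add_halves]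
    have hcl : c ∈ closure Ω := by
      refine frontier_subset_closure ?_
      rw [h.frontier_eq]
      exact Or.inl (Or.inr hcAC)
    obtain ⟨q, hq1, hq2⟩ := mem_closure_iff.1 hcl {p | p.2 < 0}
      (isOpen_lt continuous_snd continuous_const) hc2
    exact ⟨q, h.mem_triangle_of_mem hq2 hq1, hq2⟩
  · rintro p ⟨h1, h2, h3, h4⟩ hf
    rcases h.frontier_lower hf h2 with hf | hf
    · have := ((mem_charAC_iff hx0).1 hf).2.2.2
      linarith
    · have := ((mem_charBC_iff hx0).1 hf).2.2.2
      linarith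

theorem isClosed_charRegion (m₁ m₂ : ℕ) : IsClosed (charRegion m₁ m₂) := by
  have : charRegion m₁ m₂ = {p | 0 ≤ p.2} ∪
      {p | 0 ≤ p.1 ∧ charPow m₁ (-p.2) ≤ charPow m₂ p.1} := by
    ext p
    simp only [charRegion, mem_ofPred_eq, mem_union]
    constructor
    · intro h
      rcases lt_or_ge p.2 0 with h1 | h1
      · exact Or.inr (h h1)
      · exact Or.inl h1
    · rintro (h | h) h1
      · exact absurd h1 (not_lt.2 h)
      · exact h
  rw [this]
  exact (isClosed_le continuous_const continuous_snd).union
    ((isClosed_le continuous_const continuous_fst).inter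
      (isClosed_le ((continuous_charPow _).comp continuous_snd.neg)
        ((continuous_charPow _).comp continuous_fst)))

theorem IsTricomiDomain.subset_charRegion (h : IsTricomiDomain m₁ m₂ x₀ σ Ω) :
    closure Ω ⊆ charRegion m₁ m₂ := by
  refine closure_minimal (fun p hp hy => ?_) (isClosed_charRegion _ _)
  obtain ⟨h1, -, h3, -⟩ := h.mem_triangle_of_mem hp hy
  exact ⟨h1.le, h3.le⟩

theorem IsTricomiDomain.mem_of_mem_closure (h : IsTricomiDomain m₁ m₂ x₀ σ Ω) {p : ℝ × ℝ}
    (hp : p ∈ closure Ω) : p ∈ Ω ∨ p ∈ charAC m₁ m₂ x₀ ∪ σ ∨ p ∈ charBC m₁ m₂ x₀ := by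
  rw [closure_eq_self_union_frontier, h.frontier_eq] at hp
  rcases hp with hp | (hp | hp) | hp
  · exact Or.inl hp
  · exact Or.inr (Or.inl (Or.inr hp))
  · exact Or.inr (Or.inl (Or.inl hp))
  · exact Or.inr (Or.inr hp)

theorem IsTricomiDomain.notMem_closure_left (h : IsTricomiDomain m₁ m₂ x₀ σ Ω) {x : ℝ}
    (hx : x < 0) : ((x, 0) : ℝ × ℝ) ∉ closure Ω := by
  have hx0 := h.x₀_pos
  have key : ∀ s ≤ x, ((s, 0) : ℝ × ℝ) ∉ frontier Ω := by
    intro s hs hf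
    rcases h.frontier_axis hf rfl with h1 | h1
    · rw [Prod.mk.injEq] at h1; linarith [h1.1]
    · rw [Prod.mk.injEq] at h1; linarith [h1.1]
  rw [closure_eq_self_union_frontier]
  rintro (h1 | h1)
  · exact h.notMem_of_left_ray (p := (x, 0)) key h1
  · exact key x le_rfl h1

theorem IsTricomiDomain.notMem_closure_right (h : IsTricomiDomain m₁ m₂ x₀ σ Ω) {x : ℝ}
    (hx : 2 * x₀ < x) : ((x, 0) : ℝ × ℝ) ∉ closure Ω := by
  have hx0 := h.x₀_pos
  have key : ∀ s, x ≤ s → ((s, 0) : ℝ × ℝ) ∉ frontier Ω := by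
    intro s hs hf
    rcases h.frontier_axis hf rfl with h1 | h1
    · rw [Prod.mk.injEq] at h1; linarith [h1.1]
    · rw [Prod.mk.injEq] at h1; linarith [h1.1]
  rw [closure_eq_self_union_frontier]
  rintro (h1 | h1)
  · exact h.notMem_of_right_ray (p := (x, 0)) key h1
  · exact key x le_rfl h1

/-- A Tricomi domain is regular open: no boundary point is interior to the closure. -/
theorem IsTricomiDomain.interior_closure (h : IsTricomiDomain m₁ m₂ x₀ σ Ω) :
    interior (closure Ω) = Ω := by
  have hx0 := h.x₀_pos
  refine Subset.antisymm (fun p hp => ?_) (interior_maximal subset_closure h.isOpen)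
  have hnear : ∀ {c : ℝ → ℝ × ℝ}, Continuous c → c 0 = p → ∀ᶠ s in 𝓝 (0 : ℝ), c s ∈ closure Ω := by
    intro c hc hc0
    have := hc.continuousAt.eventually_mem (x := (0 : ℝ)) (s := interior (closure Ω))
      (by rw [hc0]; exact isOpen_interior.mem_nhds hp)
    exact this.mono fun s hs => interior_subset hs
  by_contra hpΩ
  have hfr : p ∈ frontier Ω := by
    have := interior_subset hp
    rw [closure_eq_self_union_frontier] at this
    exact this.resolve_left hpΩ
  rcases lt_trichotomy p.2 0 with hy | hy | hy
  · -- points to the right of `AC'` and to the left of `BC'` are outside of the closure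
    rcases h.frontier_lower hfr hy with hf | hf
    · obtain ⟨h1, h2, h3, h4⟩ := (mem_charAC_iff hx0).1 hf
      set U : Set (ℝ × ℝ) :=
        {q | q.2 < 0 ∧ charPow m₂ (2 * x₀) < charPow m₁ (-q.2) + charPow m₂ q.1}
      have hU : IsOpen U := (isOpen_lt continuous_snd continuous_const).inter
        (isOpen_lt continuous_const (((continuous_charPow _).comp continuous_snd.neg).add
          ((continuous_charPow _).comp continuous_fst)))
      have hUΩ : Disjoint U (closure Ω) := by
        refine Disjoint.closure_right (disjoint_left.2 fun q hq hqΩ => ?_) hU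
        have := (h.mem_triangle_of_mem hqΩ hq.1).2.2.2
        linarith [hq.2]
      have := hnear (c := fun s => (p.1 + s, p.2)) (by fun_prop) (by simp)
      obtain ⟨s, hs1, hs2⟩ := ((this.filter_mono nhdsWithin_le_nhds).and
        (self_mem_nhdsWithin : Ioi (0 : ℝ) ∈ 𝓝[>] 0)).exists
      have hs2 : (0 : ℝ) < s := hs2
      refine disjoint_left.1 hUΩ (⟨hy, ?_⟩ : ((p.1 + s, p.2) : ℝ × ℝ) ∈ U) hs1
      have := charPow_lt (m := m₂) h1 (show p.1 < p.1 + s by linarith)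
      simp only
      linarith
    · obtain ⟨h1, h2, h3, h4⟩ := (mem_charBC_iff hx0).1 hf
      have hxpos : 0 < p.1 := by
        rcases h1.eq_or_lt with h | h
        · rw [← h, charPow_zero] at h4
          exact absurd h4 (charPow_pos (by linarith)).ne'
        · exact h
      have := hnear (c := fun s => (p.1 - s, p.2)) (by fun_prop) (by simp)
      obtain ⟨s, hs1, hs2, hs3⟩ := ((this.filter_mono nhdsWithin_le_nhds).and
        (Ioo_mem_nhdsGT hxpos)).exists
      obtain ⟨-, h5⟩ := h.subset_charRegion hs1 hy
      have := charPow_lt (m := m₂) (s := p.1 - s) (t := p.1) (by linarith) (by linarith)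
      simp only at h5
      linarith
  · rcases h.frontier_axis hfr hy with h1 | h1
    · have := hnear (c := fun s => (p.1 + s, p.2)) (by fun_prop) (by simp)
      obtain ⟨s, hs1, hs2⟩ := ((this.filter_mono nhdsWithin_le_nhds).and
        (self_mem_nhdsWithin : Ioi (0 : ℝ) ∈ 𝓝[>] 0)).exists
      have hs2 : (0 : ℝ) < s := hs2
      rw [h1] at hs1
      exact h.notMem_closure_right (by linarith) hs1
    · have := hnear (c := fun s => (p.1 - s, p.2)) (by fun_prop) (by simp)
      obtain ⟨s, hs1, hs2⟩ := ((this.filter_mono nhdsWithin_le_nhds).and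
        (self_mem_nhdsWithin : Ioi (0 : ℝ) ∈ 𝓝[>] 0)).exists
      have hs2 : (0 : ℝ) < s := hs2
      rw [h1] at hs1
      exact h.notMem_closure_left (by simp only [zero_sub]; linarith) hs1
  · obtain ⟨γ, hγ, hinj, him, h0, h1, -⟩ := h.arc
    have hpσ : p ∈ σ := by
      rw [h.frontier_eq] at hfr
      rcases hfr with (hf | hf) | hf
      · exact hf
      · exact absurd hy (not_lt.2 ((mem_charAC_iff hx0).1 hf).2.1)
      · exact absurd hy (not_lt.2 ((mem_charBC_iff hx0).1 hf).2.1)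
    rw [← him] at hpσ
    obtain ⟨s, hs, rfl⟩ := hpσ
    have hpos : ∀ s ∈ Ioo (0 : ℝ) 1, 0 < (γ s).2 := by
      intro s hs
      have hs' : s ∈ Icc (0 : ℝ) 1 := ⟨hs.1.le, hs.2.le⟩
      refine h.arc_upper _ (him ▸ mem_image_of_mem γ hs') (fun he => ?_) (fun he => ?_)
      · have := hinj hs' ⟨le_rfl, zero_le_one⟩ (he.trans h0.symm)
        exact hs.1.ne' this
      · have := hinj hs' ⟨zero_le_one, le_rfl⟩ (he.trans h1.symm)
        exact hs.2.ne this
    refine arc_notMem_interior (K := closure Ω) h.isBounded.closure hγ hinj (by rw [h0])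
      (by rw [h1]) hpos ?_ (s₀ := s) ⟨?_, ?_⟩ hp
    · refine frontier_closure_subset.trans ?_
      rw [h.frontier_eq, him]
      rintro q ((hq | hq) | hq)
      · exact Or.inl hq
      · exact Or.inr ((mem_charAC_iff hx0).1 hq).2.1
      · exact Or.inr ((mem_charBC_iff hx0).1 hq).2.1
    · rcases hs.1.eq_or_lt with h | h
      · rw [← h, h0] at hy; exact absurd hy (lt_irrefl _)
      · exact h
    · rcases hs.2.eq_or_lt with h | h
      · rw [h, h1] at hy; exact absurd hy (lt_irrefl _)
      · exact h

end Geometry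

/-! ### Dilations and extension by zero -/

theorem dFlow_zero (a b : ℝ) (p : ℝ × ℝ) : dFlow a b 0 p = p := by simp [dFlow]

theorem dFlow_dFlow (a b s t : ℝ) (p : ℝ × ℝ) :
    dFlow a b s (dFlow a b t p) = dFlow a b (s + t) p := by
  simp only [dFlow, mul_assoc, ← Real.exp_add]
  ring_nf

theorem dFlow_neg_dFlow (a b t : ℝ) (p : ℝ × ℝ) : dFlow a b (-t) (dFlow a b t p) = p := by
  rw [dFlow_dFlow, neg_add_cancel, dFlow_zero]

theorem dFlow_dFlow_neg (a b t : ℝ) (p : ℝ × ℝ) : dFlow a b t (dFlow a b (-t) p) = p := by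
  rw [dFlow_dFlow, add_neg_cancel, dFlow_zero]

theorem continuous_dFlow (a b t : ℝ) : Continuous (dFlow a b t) := by
  unfold dFlow; fun_prop

theorem continuous_dFlow_time (a b : ℝ) (p : ℝ × ℝ) : Continuous fun t => dFlow a b t p := by
  unfold dFlow; fun_prop

theorem dFlow_image_eq_preimage (a b t : ℝ) (S : Set (ℝ × ℝ)) :
    dFlow a b t '' S = dFlow a b (-t) ⁻¹' S := by
  ext p
  constructor
  · rintro ⟨q, hq, rfl⟩
    rwa [mem_preimage, dFlow_neg_dFlow]
  · intro hp
    exact ⟨_, hp, dFlow_dFlow_neg a b t p⟩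

theorem hasDerivAt_dFlow_neg (a b : ℝ) (p : ℝ × ℝ) (s : ℝ) :
    HasDerivAt (fun s => dFlow a b (-s) p)
      (a * (dFlow a b (-s) p).1, b * (dFlow a b (-s) p).2) s := by
  have h1 : ∀ c z : ℝ, HasDerivAt (fun s => z * Real.exp (-c * -s))
      (c * (z * Real.exp (-c * -s))) s := by
    intro c z
    have h : HasDerivAt (fun s : ℝ => -c * -s) c s := by
      simpa using (hasDerivAt_id s).const_mul c
    convert! (h.exp.const_mul z) using 1
    ring
  exact (h1 a p.1).prodMk (h1 b p.2)

section Flow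

variable {m₁ m₂ : ℕ} {x₀ : ℝ} {σ Ω : Set (ℝ × ℝ)} {u : ℝ × ℝ → ℝ}

/-- The flow of the dilations for which the operator is homogeneous. -/
noncomputable abbrev dil (m₁ m₂ : ℕ) (t : ℝ) (p : ℝ × ℝ) : ℝ × ℝ :=
  dFlow ((m₁ : ℝ) + 2) ((m₂ : ℝ) + 2) t p

theorem charPow_dil_fst {p : ℝ × ℝ} (hp : 0 ≤ p.1) (t : ℝ) :
    charPow m₂ (dil m₁ m₂ t p).1 =
      charPow m₂ p.1 * Real.exp (-(((m₁ : ℝ) + 2) * ((m₂ : ℝ) + 2) / 2 * t)) := by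
  change charPow m₂ (p.1 * Real.exp (-((m₁ : ℝ) + 2) * t)) = _
  rw [charPow_mul_exp m₂ hp]
  congr 2; ring

theorem charPow_dil_snd {p : ℝ × ℝ} (hp : p.2 ≤ 0) (t : ℝ) :
    charPow m₁ (-(dil m₁ m₂ t p).2) =
      charPow m₁ (-p.2) * Real.exp (-(((m₁ : ℝ) + 2) * ((m₂ : ℝ) + 2) / 2 * t)) := by
  change charPow m₁ (-(p.2 * Real.exp (-((m₂ : ℝ) + 2) * t))) = _
  rw [← neg_mul, charPow_mul_exp m₁ (by linarith)]
  congr 2; ring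

theorem dil_snd_neg_iff {t : ℝ} {p : ℝ × ℝ} : (dil m₁ m₂ t p).2 < 0 ↔ p.2 < 0 := by
  simp only [dFlow]
  constructor
  · intro h; by_contra! h'; exact absurd h (not_lt.2 (by positivity))
  · intro h; exact mul_neg_of_neg_of_pos h (Real.exp_pos _)

theorem dil_mem_charRegion {p : ℝ × ℝ} (hp : p ∈ charRegion m₁ m₂) (t : ℝ) :
    dil m₁ m₂ t p ∈ charRegion m₁ m₂ := by
  intro hy
  have hy' := dil_snd_neg_iff.1 hy
  obtain ⟨h1, h2⟩ := hp hy'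
  refine ⟨mul_nonneg h1 (Real.exp_pos _).le, ?_⟩
  rw [charPow_dil_fst h1, charPow_dil_snd hy'.le]
  exact mul_le_mul_of_nonneg_right h2 (Real.exp_pos _).le

/-- Star-shapedness of the closure passes to the domain itself. -/
theorem IsTricomiDomain.dil_mem (h : IsTricomiDomain m₁ m₂ x₀ σ Ω)
    (hs : IsDStarShaped ((m₁ : ℝ) + 2) ((m₂ : ℝ) + 2) Ω) {t : ℝ} (ht : 0 ≤ t) {p : ℝ × ℝ}
    (hp : p ∈ Ω) : dil m₁ m₂ t p ∈ Ω := by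
  rw [← h.interior_closure]
  have hop : IsOpen (dil m₁ m₂ t '' Ω) := by
    rw [dFlow_image_eq_preimage]
    exact h.isOpen.preimage (continuous_dFlow _ _ _)
  refine interior_maximal ?_ hop (mem_image_of_mem _ hp)
  rintro _ ⟨q, hq, rfl⟩
  exact (hs q (subset_closure hq)).1 t ht

/-- The extension of `u` by zero outside of the closure of `Ω`. -/
noncomputable def zeroExt (Ω : Set (ℝ × ℝ)) (u : ℝ × ℝ → ℝ) : ℝ × ℝ → ℝ :=
  (closure Ω).indicator u

theorem zeroExt_of_mem {p : ℝ × ℝ} (hp : p ∈ closure Ω) : zeroExt Ω u p = u p :=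
  indicator_of_mem hp u

theorem zeroExt_of_notMem {p : ℝ × ℝ} (hp : p ∉ closure Ω) : zeroExt Ω u p = 0 :=
  indicator_of_notMem hp u

theorem continuousAt_zeroExt_of_eq_zero (hu : ContinuousOn u (closure Ω)) {p : ℝ × ℝ}
    (hp : p ∈ closure Ω) (h0 : u p = 0) : ContinuousAt (zeroExt Ω u) p := by
  have hz : zeroExt Ω u p = 0 := by rw [zeroExt_of_mem hp, h0]
  rw [ContinuousAt, hz, ← nhdsWithin_univ, ← union_compl_self (closure Ω), nhdsWithin_union,
    tendsto_sup]
  constructor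
  · have := hu p hp
    rw [ContinuousWithinAt, h0] at this
    exact this.congr' (eventually_nhdsWithin_of_forall fun q hq => (zeroExt_of_mem hq).symm)
  · exact tendsto_const_nhds.congr'
      (eventually_nhdsWithin_of_forall fun q hq => (zeroExt_of_notMem hq).symm)

/-- If `u` vanishes on `AC' ∪ σ`, then its extension by zero is continuous on the region above the
characteristic through the origin. -/
theorem IsTricomiDomain.continuousOn_zeroExt (h : IsTricomiDomain m₁ m₂ x₀ σ Ω)
    (hu : ContinuousOn u (closure Ω)) (h0 : ∀ p ∈ charAC m₁ m₂ x₀ ∪ σ, u p = 0) :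
    ContinuousOn (zeroExt Ω u) (charRegion m₁ m₂) := by
  have hx0 := h.x₀_pos
  intro p hp
  by_cases hpK : p ∈ closure Ω
  · by_cases hpz : p ∈ charAC m₁ m₂ x₀ ∪ σ
    · exact (continuousAt_zeroExt_of_eq_zero hu hpK (h0 p hpz)).continuousWithinAt
    -- near the remaining points the region and the closure of the domain coincide
    obtain ⟨U, hU, hpU, hUK⟩ : ∃ U, IsOpen U ∧ p ∈ U ∧ U ∩ charRegion m₁ m₂ ⊆ closure Ω := by
      rcases h.mem_of_mem_closure hpK with h1 | h1 | h1
      · exact ⟨Ω, h.isOpen, h1, fun q hq => subset_closure hq.1⟩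
      · exact absurd h1 hpz
      · obtain ⟨h2, h3, h4, h5⟩ := (mem_charBC_iff hx0).1 h1
        have hy : p.2 < 0 := by
          rcases h3.eq_or_lt with h3 | h3
          · rw [h3, neg_zero, charPow_zero, ← charPow_zero m₂] at h5
            have : p = (0, 0) := Prod.ext
              ((charPow_strictMonoOn m₂).injOn h2 (mem_Ici.2 le_rfl) h5.symm) h3
            exact absurd (Or.inr (this ▸ h.origin_mem_sigma)) hpz
          · exact h3
        have hE : charPow m₁ (-p.2) + charPow m₂ p.1 < charPow m₂ (2 * x₀) := by
          refine lt_of_le_of_ne (by linarith) fun he => hpz (Or.inl ?_)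
          exact (mem_charAC_iff hx0).2 ⟨h2, h3, h4, he⟩
        refine ⟨{q | q.2 < 0 ∧ charPow m₁ (-q.2) + charPow m₂ q.1 < charPow m₂ (2 * x₀)},
          (isOpen_lt continuous_snd continuous_const).inter
            (isOpen_lt (((continuous_charPow _).comp continuous_snd.neg).add
              ((continuous_charPow _).comp continuous_fst)) continuous_const), ⟨hy, hE⟩, ?_⟩
        rintro q ⟨⟨hq1, hq2⟩, hq3⟩
        obtain ⟨hq4, hq5⟩ := hq3 hq1
        rcases hq5.eq_or_lt with hq5 | hq5
        · refine frontier_subset_closure ?_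
          rw [h.frontier_eq]
          right
          rw [mem_charBC_iff hx0]
          exact ⟨hq4, hq1.le, by linarith, hq5⟩
        · refine subset_closure (h.triangle_subset ⟨?_, hq1, hq5, hq2⟩)
          rcases hq4.eq_or_lt with h6 | h6
          · rw [← h6, charPow_zero] at hq5
            exact absurd hq5 (not_lt.2 (charPow_nonneg (by linarith)))
          · exact h6
    have h1 : ContinuousWithinAt (zeroExt Ω u) (U ∩ charRegion m₁ m₂) p := by
      refine ((hu p hpK).mono hUK).congr (fun q hq => zeroExt_of_mem (hUK hq)) (zeroExt_of_mem hpK)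
    exact h1.mono_of_mem_nhdsWithin
      (inter_mem (mem_nhdsWithin_of_mem_nhds (hU.mem_nhds hpU)) self_mem_nhdsWithin)
  · have : ContinuousAt (zeroExt Ω u) p := by
      refine (continuousAt_const (y := (0 : ℝ))).congr ?_
      filter_upwards [isClosed_closure.isOpen_compl.mem_nhds hpK] with q hq
      exact (zeroExt_of_notMem hq).symm
    exact this.continuousWithinAt

end Flow

/-! ### The fundamental theorem of calculus for functions vanishing off an open set -/

/-- A continuous function that vanishes outside of an open set and has a bounded derivative there
is Lipschitz. -/
theorem lipschitzOnWith_of_eq_zero_off_open {O : Set ℝ} {a b C : ℝ} {g g' : ℝ → ℝ}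
    (hO : IsOpen O) (hg : ContinuousOn g (Icc a b)) (h0 : ∀ x ∈ Icc a b, x ∉ O → x ≠ a → g x = 0)
    (hd : ∀ x ∈ O, HasDerivAt g (g' x) x) (hC : ∀ x ∈ O, |g' x| ≤ C) (hC0 : 0 ≤ C) :
    LipschitzOnWith (Real.toNNReal C) g (Icc a b) := by
  -- the mean value inequality on intervals whose interior is contained in `O`
  have mv : ∀ x y, a ≤ x → x ≤ y → y ≤ b → Ioo x y ⊆ O → |g y - g x| ≤ C * (y - x) := by
    intro x y hx hxy hy hsub
    rcases hxy.eq_or_lt with rfl | hlt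
    · simp
    obtain ⟨c, hc, he⟩ := exists_hasDerivAt_eq_slope g g' hlt
      (hg.mono (Icc_subset_Icc hx hy)) (fun z hz => hd z (hsub hz))
    have : g y - g x = g' c * (y - x) := by
      rw [he]; field_simp [(sub_pos.2 hlt).ne']
    rw [this, abs_mul, abs_of_pos (sub_pos.2 hlt)]
    exact mul_le_mul_of_nonneg_right (hC c (hsub hc)) (sub_pos.2 hlt).le
  refine LipschitzOnWith.of_dist_le_mul fun x hx y hy => ?_
  rw [Real.coe_toNNReal C hC0]
  wlog hxy : x ≤ y generalizing x y
  · rw [dist_comm, dist_comm x y]; exact this y hy x hx (le_of_not_ge hxy)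
  rw [dist_comm, dist_comm x y, Real.dist_eq, Real.dist_eq, abs_of_nonneg (sub_nonneg.2 hxy)]
  by_cases hsub : Ioo x y ⊆ O
  · exact mv x y hx.1 hxy hy.2 hsub
  obtain ⟨z, hz, hzO⟩ := not_subset.1 hsub
  -- first and last point outside of `O`
  set Z : Set ℝ := Icc x y ∩ Oᶜ ∩ {w | g w = 0} with hZ
  have hZc : IsCompact Z := by
    have hcl : IsClosed (Icc x y ∩ {w | g w = 0}) :=
      (hg.mono (Icc_subset_Icc hx.1 hy.2)).preimage_isClosed_of_isClosed isClosed_Icc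
        (isClosed_singleton (x := (0 : ℝ)))
    have : Z = Icc x y ∩ ((Icc x y ∩ {w | g w = 0}) ∩ Oᶜ) := by ext w; simp [hZ]; tauto
    rw [this]
    exact isCompact_Icc.inter_right (hcl.inter hO.isClosed_compl)
  have hZne : Z.Nonempty := ⟨z, ⟨⟨hz.1.le, hz.2.le⟩, hzO⟩,
    h0 z ⟨hx.1.trans hz.1.le, hz.2.le.trans hy.2⟩ hzO (hx.1.trans_lt hz.1).ne'⟩
  obtain ⟨z₁, hz₁, hmin⟩ := hZc.exists_isLeast hZne
  obtain ⟨z₂, hz₂, hmax⟩ := hZc.exists_isGreatest hZne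
  have hsub1 : Ioo x z₁ ⊆ O := by
    intro w hw
    by_contra hwO
    have hw' : w ∈ Icc x y := ⟨hw.1.le, hw.2.le.trans hz₁.1.1.2⟩
    have := hmin ⟨⟨hw', hwO⟩, h0 w ⟨hx.1.trans hw'.1, hw'.2.trans hy.2⟩ hwO
      (hx.1.trans_lt hw.1).ne'⟩
    exact absurd hw.2 (not_lt.2 this)
  have hsub2 : Ioo z₂ y ⊆ O := by
    intro w hw
    by_contra hwO
    have hw' : w ∈ Icc x y := ⟨hz₂.1.1.1.trans hw.1.le, hw.2.le⟩
    have := hmax ⟨⟨hw', hwO⟩, h0 w ⟨hx.1.trans hw'.1, hw'.2.trans hy.2⟩ hwO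
      ((hx.1.trans hz₂.1.1.1).trans_lt hw.1).ne'⟩
    exact absurd hw.1 (not_lt.2 this)
  have e1 := mv x z₁ hx.1 hz₁.1.1.1 (hz₁.1.1.2.trans hy.2) hsub1
  have e2 := mv z₂ y (hx.1.trans hz₂.1.1.1) hz₂.1.1.2 hy.2 hsub2
  have g1 : g z₁ = 0 := hz₁.2
  have g2 : g z₂ = 0 := hz₂.2
  have h12 : z₁ ≤ z₂ := hmin hz₂
  rw [g1] at e1
  rw [g2] at e2
  calc |g y - g x| ≤ |g y - 0| + |0 - g x| := by
        simpa using abs_sub (g y) (g x)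
    _ ≤ C * (y - z₂) + C * (z₁ - x) := add_le_add e2 e1
    _ ≤ C * (y - x) := by nlinarith

/-- The nondegenerate zeros of a function of one variable form a countable set. -/
theorem countable_zeros_deriv_ne_zero (g : ℝ → ℝ) : {x | g x = 0 ∧ deriv g x ≠ 0}.Countable := by
  set S := {x | g x = 0 ∧ deriv g x ≠ 0}
  have : DiscreteTopology S := by
    rw [discreteTopology_subtype_iff]
    rintro x ⟨-, hx⟩
    rw [inf_principal_eq_bot]
    filter_upwards [(differentiableAt_of_deriv_ne_zero hx).hasDerivAt.eventually_ne (c := 0) hx]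
      with z hz hzS using hz hzS.1
  exact countable_coe_iff.1 countable_of_Lindelof_of_discrete

/-- The fundamental theorem of calculus for a function which vanishes outside of an open set `O`,
except possibly at the left end point of the interval. -/
theorem setIntegral_deriv_of_eq_zero_off_open {O : Set ℝ} {a b C : ℝ} {g g' : ℝ → ℝ}
    (hab : a ≤ b) (hO : IsOpen O) (hOab : O ⊆ Ioo a b) (hg : ContinuousOn g (Icc a b))
    (h0 : ∀ x ∈ Icc a b, x ∉ O → x ≠ a → g x = 0) (hb : g b = 0)
    (hd : ∀ x ∈ O, HasDerivAt g (g' x) x) (hC : ∀ x ∈ O, |g' x| ≤ C) (hC0 : 0 ≤ C) :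
    ∫ x in O, g' x = -g a := by
  have hlip := lipschitzOnWith_of_eq_zero_off_open hO hg h0 hd hC hC0
  rw [← uIcc_of_le hab] at hlip
  have hftc := hlip.absolutelyContinuousOnInterval.integral_deriv_eq_sub
  rw [hb, zero_sub, intervalIntegral.integral_of_le hab, integral_Ioc_eq_integral_Ioo] at hftc
  rw [← hftc]
  have h1 : ∫ x in O, g' x = ∫ x in O, deriv g x :=
    setIntegral_congr_fun hO.measurableSet fun x hx => (hd x hx).deriv.symm
  rw [h1]
  refine (setIntegral_eq_of_subset_of_ae_sdiff_eq_zero measurableSet_Ioo.nullMeasurableSet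
    hOab ?_).symm
  filter_upwards [(countable_zeros_deriv_ne_zero g).ae_notMem volume] with x hx hxO
  by_contra hne
  exact hx ⟨h0 x (Ioo_subset_Icc_self hxO.1) hxO.2 hxO.1.1.ne', hne⟩

/-! ### Integration over slices up to the characteristic -/

section Green

variable {m₁ m₂ : ℕ}

/-- The abscissa of the point of ordinate `y` on the characteristic through the origin. -/
noncomputable def edgeX (m₁ m₂ : ℕ) (y : ℝ) : ℝ := charRoot m₂ (charPow m₁ (-y))

/-- The ordinate of the point of abscissa `x` on the characteristic through the origin. -/
noncomputable def edgeY (m₁ m₂ : ℕ) (x : ℝ) : ℝ := -charRoot m₁ (charPow m₂ x)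

/-- The open region above the complete characteristic through the origin. -/
def openCharRegion (m₁ m₂ : ℕ) : Set (ℝ × ℝ) :=
  {p | p.2 < 0 → 0 < p.1 ∧ charPow m₁ (-p.2) < charPow m₂ p.1}

theorem lt_iff_edgeX_lt {x y : ℝ} (hy : y < 0) :
    edgeX m₁ m₂ y < x ↔ 0 < x ∧ charPow m₁ (-y) < charPow m₂ x := by
  have h0 : 0 ≤ charPow m₁ (-y) := charPow_nonneg (by linarith)
  constructor
  · intro h
    have hx : 0 < x := (charRoot_nonneg h0).trans_lt h
    refine ⟨hx, ?_⟩
    have := charPow_lt (m := m₂) (charRoot_nonneg h0) h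
    rwa [charPow_charRoot h0] at this
  · rintro ⟨hx, h⟩
    rw [edgeX, ← (charPow_strictMonoOn m₂).lt_iff_lt (charRoot_nonneg h0) hx.le,
      charPow_charRoot h0]
    exact h

theorem edgeY_neg {x : ℝ} (hx : 0 < x) : edgeY m₁ m₂ x < 0 := by
  rw [edgeY, neg_neg_iff_pos]
  exact charRoot_pos (charPow_pos hx)

theorem edgeY_lt_iff {x y : ℝ} (hx : 0 < x) (hy : y < 0) :
    edgeY m₁ m₂ x < y ↔ charPow m₁ (-y) < charPow m₂ x := by
  have h0 : 0 ≤ charPow m₂ x := charPow_nonneg hx.le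
  rw [edgeY, neg_lt, ← (charPow_strictMonoOn m₁).lt_iff_lt (mem_Ici.2 (by linarith))
    (charRoot_nonneg h0), charPow_charRoot h0]

theorem edgeX_mem {y : ℝ} (hy : y < 0) : ((edgeX m₁ m₂ y, y) : ℝ × ℝ) ∈ charRegion m₁ m₂ := by
  intro _
  have h0 : 0 ≤ charPow m₁ (-y) := charPow_nonneg (by linarith)
  exact ⟨charRoot_nonneg h0, by rw [edgeX, charPow_charRoot h0]⟩

theorem edgeY_mem {x : ℝ} (hx : 0 < x) : ((x, edgeY m₁ m₂ x) : ℝ × ℝ) ∈ charRegion m₁ m₂ := by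
  intro _
  have h0 : 0 ≤ charPow m₂ x := charPow_nonneg hx.le
  exact ⟨hx.le, by simp only [edgeY, neg_neg]; rw [charPow_charRoot h0]⟩

theorem openCharRegion_subset : openCharRegion m₁ m₂ ⊆ charRegion m₁ m₂ := fun _ hp hy =>
  ⟨(hp hy).1.le, (hp hy).2.le⟩

theorem exists_abs_lt_of_isBounded {O : Set (ℝ × ℝ)} (hO : Bornology.IsBounded O) :
    ∃ M : ℝ, 0 < M ∧ ∀ p ∈ O, |p.1| < M ∧ |p.2| < M := by
  obtain ⟨R, hR⟩ := hO.subset_closedBall (0, 0)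
  refine ⟨|R| + 1, by positivity, fun p hp => ?_⟩
  have := hR hp
  rw [Metric.mem_closedBall, Prod.dist_eq, Real.dist_eq, Real.dist_eq, sub_zero, sub_zero] at this
  have hR' := le_abs_self R
  exact ⟨by linarith [(le_max_left _ _).trans this], by linarith [(le_max_right _ _).trans this]⟩

variable {O : Set (ℝ × ℝ)} {P P' : ℝ × ℝ → ℝ} {C : ℝ}

theorem integrableOn_of_continuousOn_of_bounded (hO : IsOpen O) (hOb : Bornology.IsBounded O)
    (hP : ContinuousOn P O) (hC : ∀ p ∈ O, |P p| ≤ C) : IntegrableOn P O := by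
  have : IsFiniteMeasure (volume.restrict O) := ⟨by simpa using hOb.measure_lt_top⟩
  refine Integrable.of_bound (hP.aestronglyMeasurable hO.measurableSet) C ?_
  filter_upwards [ae_restrict_mem hO.measurableSet] with p hp
  exact hC p hp

/-- The divergence theorem for a horizontal field `P` on an open set above the characteristic, if
`P` vanishes at all boundary points which are not on the characteristic. -/
theorem setIntegral_partial_fst (hO : IsOpen O) (hOb : Bornology.IsBounded O)
    (hOR : O ⊆ openCharRegion m₁ m₂) (hP : ContinuousOn P (charRegion m₁ m₂))
    (h0 : ∀ p ∈ openCharRegion m₁ m₂, p ∉ O → P p = 0)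
    (hd : ∀ p ∈ O, HasDerivAt (fun x => P (x, p.2)) (P' p) p.1)
    (hP' : ContinuousOn P' O) (hC : ∀ p ∈ O, |P' p| ≤ C) (hC0 : 0 ≤ C) :
    ∫ p in O, P' p = ∫ y in Iio (0 : ℝ), -P (edgeX m₁ m₂ y, y) := by
  obtain ⟨M, hM0, hM⟩ := exists_abs_lt_of_isBounded hOb
  have hint := integrableOn_of_continuousOn_of_bounded hO hOb hP' hC
  rw [← integral_indicator hO.measurableSet, Measure.volume_eq_prod, integral_prod_symm _
    (by rw [← Measure.volume_eq_prod]; exact hint.integrable_indicator hO.measurableSet),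
    ← integral_indicator measurableSet_Iio]
  congr 1
  ext y
  set S : Set ℝ := (fun x => ((x, y) : ℝ × ℝ)) ⁻¹' O with hS
  have hSo : IsOpen S := hO.preimage (by fun_prop)
  have hslice : ∫ x, O.indicator P' (x, y) = ∫ x in S, P' (x, y) := by
    rw [← integral_indicator hSo.measurableSet]
    rfl
  rw [hslice]
  by_cases hy : y < 0
  · rw [indicator_of_mem (show y ∈ Iio (0 : ℝ) from hy)]
    have hlt : ∀ x, edgeX m₁ m₂ y < x → ((x, y) : ℝ × ℝ) ∈ openCharRegion m₁ m₂ :=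
      fun x hx _ => (lt_iff_edgeX_lt hy).1 hx
    refine setIntegral_deriv_of_eq_zero_off_open (a := edgeX m₁ m₂ y)
      (b := max M (edgeX m₁ m₂ y + 1)) (C := C) (g := fun x => P (x, y))
      ?_ hSo ?_ ?_ ?_ ?_ ?_ ?_ hC0
    · exact le_max_of_le_right (by linarith)
    · intro x hx
      refine ⟨(lt_iff_edgeX_lt hy).2 (hOR hx hy), lt_max_of_lt_left ?_⟩
      exact (le_abs_self _).trans_lt (hM _ hx).1
    · refine hP.comp (by fun_prop) fun x hx => ?_
      rcases hx.1.eq_or_lt with h | h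
      · simp only [← h]; exact edgeX_mem hy
      · exact openCharRegion_subset (hlt x h)
    · intro x hx hxS hne
      exact h0 _ (hlt x (lt_of_le_of_ne hx.1 (Ne.symm hne))) hxS
    · refine h0 _ (hlt _ (lt_max_of_lt_right (by linarith))) fun h => ?_
      exact absurd ((le_max_left _ _).trans (le_abs_self _)) (not_le.2 (hM _ h).1)
    · exact fun x hx => hd (x, y) hx
    · exact fun x hx => hC (x, y) hx
  · rw [indicator_of_notMem (by simpa using hy)]
    have hmem : ∀ x, ((x, y) : ℝ × ℝ) ∈ openCharRegion m₁ m₂ := fun x h => absurd h hy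
    have hend : P (-M, y) = 0 := by
      refine h0 _ (hmem _) fun h => ?_
      have := (hM _ h).1
      rw [abs_neg, abs_of_pos hM0] at this
      exact lt_irrefl _ this
    rw [← neg_eq_zero.2 hend]
    refine setIntegral_deriv_of_eq_zero_off_open (a := -M)
      (b := M) (C := C) (g := fun x => P (x, y)) (by linarith) hSo ?_ ?_ ?_ ?_ ?_ ?_ hC0
    · intro x hx
      exact abs_lt.1 (hM _ hx).1
    · exact hP.comp (by fun_prop) fun x hx => openCharRegion_subset (hmem x)
    · intro x hx hxS hne
      exact h0 _ (hmem x) hxS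
    · refine h0 _ (hmem _) fun h => ?_
      exact absurd (le_abs_self _) (not_le.2 (hM _ h).1)
    · exact fun x hx => hd (x, y) hx
    · exact fun x hx => hC (x, y) hx

/-- The divergence theorem for a vertical field `P` on an open set above the characteristic, if
`P` vanishes at all boundary points which are not on the characteristic. -/
theorem setIntegral_partial_snd (hO : IsOpen O) (hOb : Bornology.IsBounded O)
    (hOR : O ⊆ openCharRegion m₁ m₂) (hP : ContinuousOn P (charRegion m₁ m₂))
    (h0 : ∀ p ∈ openCharRegion m₁ m₂, p ∉ O → P p = 0)
    (hd : ∀ p ∈ O, HasDerivAt (fun y => P (p.1, y)) (P' p) p.2)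
    (hP' : ContinuousOn P' O) (hC : ∀ p ∈ O, |P' p| ≤ C) (hC0 : 0 ≤ C) :
    ∫ p in O, P' p = ∫ x in Ioi (0 : ℝ), -P (x, edgeY m₁ m₂ x) := by
  obtain ⟨M, hM0, hM⟩ := exists_abs_lt_of_isBounded hOb
  have hint := integrableOn_of_continuousOn_of_bounded hO hOb hP' hC
  rw [← integral_indicator hO.measurableSet, Measure.volume_eq_prod, integral_prod _
    (by rw [← Measure.volume_eq_prod]; exact hint.integrable_indicator hO.measurableSet),
    ← integral_indicator measurableSet_Ioi]
  congr 1
  ext x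
  set S : Set ℝ := (fun y => ((x, y) : ℝ × ℝ)) ⁻¹' O with hS
  have hSo : IsOpen S := hO.preimage (by fun_prop)
  have hslice : ∫ y, O.indicator P' (x, y) = ∫ y in S, P' (x, y) := by
    rw [← integral_indicator hSo.measurableSet]
    rfl
  rw [hslice]
  by_cases hx : 0 < x
  · rw [indicator_of_mem (show x ∈ Ioi (0 : ℝ) from hx)]
    have hlt : ∀ y, edgeY m₁ m₂ x < y → ((x, y) : ℝ × ℝ) ∈ openCharRegion m₁ m₂ :=
      fun y hy hy0 => ⟨hx, (edgeY_lt_iff hx hy0).1 hy⟩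
    have hneg := edgeY_neg (m₁ := m₁) (m₂ := m₂) hx
    refine setIntegral_deriv_of_eq_zero_off_open (a := edgeY m₁ m₂ x)
      (b := M) (C := C) (g := fun y => P (x, y)) (by linarith) hSo ?_ ?_ ?_ ?_ ?_ ?_ hC0
    · intro y hy
      refine ⟨?_, (le_abs_self _).trans_lt (hM _ hy).2⟩
      by_cases hy0 : y < 0
      · exact (edgeY_lt_iff hx hy0).2 (hOR hy hy0).2
      · linarith
    · refine hP.comp (by fun_prop) fun y hy => ?_
      rcases hy.1.eq_or_lt with h | h
      · simp only [← h]; exact edgeY_mem hx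
      · exact openCharRegion_subset (hlt y h)
    · intro y hy hyS hne
      exact h0 _ (hlt y (lt_of_le_of_ne hy.1 (Ne.symm hne))) hyS
    · refine h0 _ (hlt _ (by linarith)) fun h => ?_
      exact absurd (le_abs_self _) (not_le.2 (hM _ h).2)
    · exact fun y hy => hd (x, y) hy
    · exact fun y hy => hC (x, y) hy
  · rw [indicator_of_notMem (by simpa using hx)]
    have hmem : ∀ y, 0 ≤ y → ((x, y) : ℝ × ℝ) ∈ openCharRegion m₁ m₂ :=
      fun y hy h => absurd h (not_lt.2 hy)
    have hSpos : ∀ y ∈ S, 0 < y := by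
      intro y hy
      by_contra! hy0
      -- an open set containing `(x, 0)` contains points of negative ordinate
      obtain ⟨z, hz, hzS⟩ : ∃ z < 0, z ∈ S := by
        rcases hy0.lt_or_eq with h | h
        · exact ⟨y, h, hy⟩
        · subst h
          obtain ⟨z, hz1, hz2⟩ := (((hSo.eventually_mem hy).filter_mono
            (nhdsWithin_le_nhds (s := Iio 0))).and self_mem_nhdsWithin).exists
          exact ⟨z, hz2, hz1⟩
      exact hx (hOR hzS hz).1
    have hend : P (x, 0) = 0 := h0 _ (hmem 0 le_rfl) fun h => lt_irrefl _ (hSpos 0 h)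
    rw [← neg_eq_zero.2 hend]
    refine setIntegral_deriv_of_eq_zero_off_open (a := 0)
      (b := M) (C := C) (g := fun y => P (x, y)) hM0.le hSo ?_ ?_ ?_ ?_ ?_ ?_ hC0
    · intro y hy
      exact ⟨hSpos y hy, (le_abs_self _).trans_lt (hM _ hy).2⟩
    · exact hP.comp (by fun_prop) fun y hy => openCharRegion_subset (hmem y hy.1)
    · intro y hy hyS hne
      exact h0 _ (hmem y hy.1) hyS
    · refine h0 _ (hmem _ hM0.le) fun h => ?_
      exact absurd (le_abs_self _) (not_le.2 (hM _ h).2)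
    · exact fun y hy => hd (x, y) hy
    · exact fun y hy => hC (x, y) hy

/-- The characteristic through the origin and the point `c`, parametrized by the flow of the
dilations. -/
noncomputable def edgeCurve (m₁ m₂ : ℕ) (c : ℝ × ℝ) (τ : ℝ) : ℝ × ℝ := dil m₁ m₂ (-τ) c

theorem edgeCurve_eq (c : ℝ × ℝ) (τ : ℝ) : edgeCurve m₁ m₂ c τ =
    (c.1 * Real.exp (((m₁ : ℝ) + 2) * τ), c.2 * Real.exp (((m₂ : ℝ) + 2) * τ)) := by
  simp only [edgeCurve, dFlow, neg_mul_neg]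

variable {c : ℝ × ℝ}

theorem edgeX_edgeCurve (hc1 : 0 < c.1) (hc2 : c.2 < 0) (hc : charPow m₁ (-c.2) = charPow m₂ c.1)
    (τ : ℝ) : edgeX m₁ m₂ (edgeCurve m₁ m₂ c τ).2 = (edgeCurve m₁ m₂ c τ).1 := by
  rw [edgeX, edgeCurve, charPow_dil_snd hc2.le, hc, ← charPow_dil_fst hc1.le, charRoot_charPow]
  exact mul_nonneg hc1.le (Real.exp_pos _).le

theorem edgeY_edgeCurve (hc1 : 0 < c.1) (hc2 : c.2 < 0) (hc : charPow m₁ (-c.2) = charPow m₂ c.1)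
    (τ : ℝ) : edgeY m₁ m₂ (edgeCurve m₁ m₂ c τ).1 = (edgeCurve m₁ m₂ c τ).2 := by
  rw [edgeY, edgeCurve, charPow_dil_fst hc1.le, ← hc, ← charPow_dil_snd hc2.le, charRoot_charPow,
    neg_neg]
  have := (dil_snd_neg_iff (m₁ := m₁) (m₂ := m₂) (t := -τ)).2 hc2
  linarith

/-- The substitution `s = x e^{kτ}`. -/
theorem setIntegral_Ioi_exp (G : ℝ → ℝ) {k x : ℝ} (hk : 0 < k) (hx : 0 < x) :
    ∫ s in Ioi (0 : ℝ), G s = ∫ τ : ℝ, k * (x * Real.exp (k * τ)) * G (x * Real.exp (k * τ)) := by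
  have him : (fun τ : ℝ => x * Real.exp (k * τ)) '' univ = Ioi 0 := by
    ext s
    simp only [image_univ, mem_range, mem_Ioi]
    constructor
    · rintro ⟨τ, rfl⟩; positivity
    · intro hs
      refine ⟨Real.log (s / x) / k, ?_⟩
      rw [mul_div_cancel₀ _ hk.ne', Real.exp_log (by positivity)]
      field_simp
  have hder : ∀ τ ∈ (univ : Set ℝ), HasDerivWithinAt (fun τ : ℝ => x * Real.exp (k * τ))
      (k * (x * Real.exp (k * τ))) univ τ := by
    intro τ _
    have h : HasDerivAt (fun τ : ℝ => k * τ) k τ := by simpa using (hasDerivAt_id τ).const_mul k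
    have := (h.exp.const_mul x).hasDerivWithinAt (s := univ)
    convert! this using 1
    ring
  have hinj : InjOn (fun τ : ℝ => x * Real.exp (k * τ)) univ := by
    intro s _ t _ hst
    have := Real.exp_injective (mul_left_cancel₀ hx.ne' hst)
    exact mul_left_cancel₀ hk.ne' this
  have := integral_image_eq_integral_abs_deriv_smul MeasurableSet.univ hder hinj G
  rw [him, setIntegral_univ] at this
  rw [this]
  congr 1
  ext τ
  rw [abs_of_pos (by positivity), smul_eq_mul]

theorem setIntegral_edgeX (hc1 : 0 < c.1) (hc2 : c.2 < 0)
    (hc : charPow m₁ (-c.2) = charPow m₂ c.1) (P : ℝ × ℝ → ℝ) :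
    ∫ y in Iio (0 : ℝ), -P (edgeX m₁ m₂ y, y) = ∫ τ : ℝ,
      ((m₂ : ℝ) + 2) * (edgeCurve m₁ m₂ c τ).2 * P (edgeCurve m₁ m₂ c τ) := by
  have h := integral_comp_neg_Ioi (0 : ℝ) (fun y => -P (edgeX m₁ m₂ y, y))
  rw [neg_zero] at h
  rw [← integral_Iic_eq_integral_Iio, ← h, setIntegral_Ioi_exp _ (two_add_pos m₂) (neg_pos.2 hc2)]
  congr 1
  ext τ
  have e : -c.2 * Real.exp (((m₂ : ℝ) + 2) * τ) = -(edgeCurve m₁ m₂ c τ).2 := by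
    rw [edgeCurve_eq]; ring
  rw [e, neg_neg, edgeX_edgeCurve hc1 hc2 hc]
  ring

theorem setIntegral_edgeY (hc1 : 0 < c.1) (hc2 : c.2 < 0)
    (hc : charPow m₁ (-c.2) = charPow m₂ c.1) (P : ℝ × ℝ → ℝ) :
    ∫ x in Ioi (0 : ℝ), -P (x, edgeY m₁ m₂ x) = ∫ τ : ℝ,
      -(((m₁ : ℝ) + 2) * (edgeCurve m₁ m₂ c τ).1 * P (edgeCurve m₁ m₂ c τ)) := by
  rw [setIntegral_Ioi_exp _ (two_add_pos m₁) hc1]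
  congr 1
  ext τ
  have e : c.1 * Real.exp (((m₁ : ℝ) + 2) * τ) = (edgeCurve m₁ m₂ c τ).1 := by
    rw [edgeCurve_eq]
  rw [e, edgeY_edgeCurve hc1 hc2 hc]
  ring

end Green

/-! ### Regularity up to the boundary and boundary gradients -/

/-- The linear form on the plane with the given coefficients. -/
noncomputable def gradForm (α β : ℝ) : ℝ × ℝ →L[ℝ] ℝ :=
  α • ContinuousLinearMap.fst ℝ ℝ ℝ + β • ContinuousLinearMap.snd ℝ ℝ ℝ

@[simp] theorem gradForm_apply (α β : ℝ) (v : ℝ × ℝ) : gradForm α β v = α * v.1 + β * v.2 := by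
  simp [gradForm]

theorem eq_gradForm (L : ℝ × ℝ →L[ℝ] ℝ) : L = gradForm (L (1, 0)) (L (0, 1)) := by
  ext <;> simp

theorem continuous_gradForm : Continuous fun q : ℝ × ℝ => gradForm q.1 q.2 := by
  unfold gradForm; fun_prop

/-- `u` is of class `C²` up to the boundary of `Ω`; `ux` and `uy` are continuous functions on the
plane which extend the partial derivatives, and `C` bounds all the quantities involved. -/
structure HasC2Bounds (Ω : Set (ℝ × ℝ)) (u ux uy : ℝ × ℝ → ℝ) (C : ℝ) : Prop where
  C_nonneg : 0 ≤ C
  isOpen : IsOpen Ω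
  isBounded : Bornology.IsBounded Ω
  cont : ContinuousOn u (closure Ω)
  cont_x : Continuous ux
  cont_y : Continuous uy
  deriv : ∀ p ∈ Ω, HasFDerivAt u (gradForm (ux p) (uy p)) p
  deriv_x : ∀ p ∈ Ω,
    HasFDerivAt ux (gradForm (partialX (partialX u) p) (partialY (partialX u) p)) p
  deriv_y : ∀ p ∈ Ω,
    HasFDerivAt uy (gradForm (partialX (partialY u) p) (partialY (partialY u) p)) p
  cont_xx : ContinuousOn (partialX (partialX u)) Ω
  cont_yy : ContinuousOn (partialY (partialY u)) Ω
  bound_pos : ∀ p ∈ Ω, |p.1| ≤ C ∧ |p.2| ≤ C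
  bound : ∀ p ∈ Ω, |u p| ≤ C
  bound_x : ∀ p ∈ Ω, |ux p| ≤ C
  bound_y : ∀ p ∈ Ω, |uy p| ≤ C
  bound_xx : ∀ p ∈ Ω, |partialX (partialX u) p| ≤ C
  bound_xy : ∀ p ∈ Ω, |partialY (partialX u) p| ≤ C
  bound_yx : ∀ p ∈ Ω, |partialX (partialY u) p| ≤ C
  bound_yy : ∀ p ∈ Ω, |partialY (partialY u) p| ≤ C

theorem exists_continuous_extension {K : Set (ℝ × ℝ)} (hK : IsClosed K) {f : ℝ × ℝ → ℝ}
    (hf : ContinuousOn f K) : ∃ F : ℝ × ℝ → ℝ, Continuous F ∧ EqOn F f K := by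
  obtain ⟨F, hF⟩ := ContinuousMap.exists_restrict_eq (Y := ℝ) hK ⟨K.domRestrict f, hf.domRestrict⟩
  refine ⟨F, F.continuous, fun q hq => ?_⟩
  have := DFunLike.congr_fun hF ⟨q, hq⟩
  simpa using this

theorem exists_bound_of_eqOn {Ω : Set (ℝ × ℝ)} (hΩ : Bornology.IsBounded Ω) {f F : ℝ × ℝ → ℝ}
    (hF : ContinuousOn F (closure Ω)) (h : EqOn F f Ω) : ∃ C, ∀ p ∈ Ω, |f p| ≤ C := by
  obtain ⟨C, hC⟩ := hΩ.isCompact_closure.exists_bound_of_continuousOn hF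
  exact ⟨C, fun p hp => by rw [← h hp]; exact hC p (subset_closure hp)⟩

/-- The first derivatives are extended to the plane by Tietze's theorem. -/
theorem IsC2UpToBoundary.exists_hasC2Bounds {Ω : Set (ℝ × ℝ)} {u : ℝ × ℝ → ℝ}
    (hu : IsC2UpToBoundary Ω u) (hO : IsOpen Ω) (hb : Bornology.IsBounded Ω) :
    ∃ ux uy C, HasC2Bounds Ω u ux uy C := by
  obtain ⟨hd, hc, ⟨g, hg, hgu⟩, ⟨h, hh, hhu⟩⟩ := hu
  obtain ⟨ux, hux, huxe⟩ := exists_continuous_extension isClosed_closure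
    (f := fun p => g p (1, 0)) (hg.clm_apply continuousOn_const)
  obtain ⟨uy, huy, huye⟩ := exists_continuous_extension isClosed_closure
    (f := fun p => g p (0, 1)) (hg.clm_apply continuousOn_const)
  have hux' : ∀ p ∈ Ω, ux p = partialX u p := fun p hp => by
    rw [huxe (subset_closure hp)]; simp only [hgu hp, partialX]
  have huy' : ∀ p ∈ Ω, uy p = partialY u p := fun p hp => by
    rw [huye (subset_closure hp)]; simp only [hgu hp, partialY]
  have hdiff : ∀ p ∈ Ω, ContDiffAt ℝ 2 u p := fun p hp => hd.contDiffAt (hO.mem_nhds hp)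
  have hu1 : ∀ p ∈ Ω, HasFDerivAt u (gradForm (ux p) (uy p)) p := by
    intro p hp
    have := ((hdiff p hp).differentiableAt (by norm_num)).hasFDerivAt
    rw [eq_gradForm (fderiv ℝ u p)] at this
    rw [hux' p hp, huy' p hp]
    exact this
  have hu2 : ∀ p ∈ Ω, HasFDerivAt (fderiv ℝ u) (fderiv ℝ (fderiv ℝ u) p) p := fun p hp =>
    (((hdiff p hp).fderiv_right (m := 1) (by norm_num)).differentiableAt (by norm_num)).hasFDerivAt
  -- derivatives of the partial derivatives
  have hpart : ∀ e : ℝ × ℝ, ∀ p ∈ Ω, HasFDerivAt (fun q => fderiv ℝ u q e)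
      ((fderiv ℝ (fderiv ℝ u) p).flip e) p := by
    intro e p hp
    have := (hu2 p hp).clm_apply (hasFDerivAt_const e p)
    simpa using this
  have hval : ∀ e e' : ℝ × ℝ, ∀ p ∈ Ω, h p e' e = fderiv ℝ (fun q => fderiv ℝ u q e) p e' := by
    intro e e' p hp
    rw [(hpart e p hp).fderiv, hhu hp]; rfl
  have hcont : ∀ e e' : ℝ × ℝ, ContinuousOn (fun p => h p e' e) (closure Ω) := fun e e' =>
    (hh.clm_apply continuousOn_const).clm_apply continuousOn_const
  have hcong : ∀ (f : ℝ × ℝ → ℝ) (e : ℝ × ℝ), (∀ p ∈ Ω, f p = fderiv ℝ u p e) → ∀ p ∈ Ω,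
      HasFDerivAt f (gradForm (fderiv ℝ (fun q => fderiv ℝ u q e) p (1, 0))
        (fderiv ℝ (fun q => fderiv ℝ u q e) p (0, 1))) p := by
    intro f e hf p hp
    rw [← eq_gradForm, (hpart e p hp).fderiv]
    refine (hpart e p hp).congr_of_eventuallyEq ?_
    filter_upwards [hO.mem_nhds hp] with q hq using hf q hq
  obtain ⟨C₀, hC₀⟩ := exists_abs_lt_of_isBounded hb
  obtain ⟨C₁, hC₁⟩ := exists_bound_of_eqOn hb hc (fun p _ => rfl)
  obtain ⟨C₂, hC₂⟩ := exists_bound_of_eqOn hb hux.continuousOn (fun p _ => rfl)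
  obtain ⟨C₃, hC₃⟩ := exists_bound_of_eqOn hb huy.continuousOn (fun p _ => rfl)
  obtain ⟨C₄, hC₄⟩ := exists_bound_of_eqOn hb (hcont (1, 0) (1, 0)) (hval (1, 0) (1, 0))
  obtain ⟨C₅, hC₅⟩ := exists_bound_of_eqOn hb (hcont (1, 0) (0, 1)) (hval (1, 0) (0, 1))
  obtain ⟨C₆, hC₆⟩ := exists_bound_of_eqOn hb (hcont (0, 1) (1, 0)) (hval (0, 1) (1, 0))
  obtain ⟨C₇, hC₇⟩ := exists_bound_of_eqOn hb (hcont (0, 1) (0, 1)) (hval (0, 1) (0, 1))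
  refine ⟨ux, uy, |C₀| + |C₁| + |C₂| + |C₃| + |C₄| + |C₅| + |C₆| + |C₇|, ?_⟩
  have n0 := abs_nonneg C₀; have n1 := abs_nonneg C₁; have n2 := abs_nonneg C₂
  have n3 := abs_nonneg C₃; have n4 := abs_nonneg C₄; have n5 := abs_nonneg C₅
  have n6 := abs_nonneg C₆; have n7 := abs_nonneg C₇
  have l0 := le_abs_self C₀; have l1 := le_abs_self C₁; have l2 := le_abs_self C₂
  have l3 := le_abs_self C₃; have l4 := le_abs_self C₄; have l5 := le_abs_self C₅
  have l6 := le_abs_self C₆; have l7 := le_abs_self C₇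
  exact
    { C_nonneg := by positivity
      isOpen := hO
      isBounded := hb
      cont := hc
      cont_x := hux
      cont_y := huy
      deriv := hu1
      deriv_x := hcong ux (1, 0) hux'
      deriv_y := hcong uy (0, 1) huy'
      cont_xx := ((hcont (1, 0) (1, 0)).mono subset_closure).congr
        fun p hp => (hval (1, 0) (1, 0) p hp).symm
      cont_yy := ((hcont (0, 1) (0, 1)).mono subset_closure).congr
        fun p hp => (hval (0, 1) (0, 1) p hp).symm
      bound_pos := fun p hp => by
        have := hC₀.2 p hp; constructor <;> linarith [this.1, this.2]
      bound := fun p hp => (hC₁ p hp).trans (by linarith)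
      bound_x := fun p hp => (hC₂ p hp).trans (by linarith)
      bound_y := fun p hp => (hC₃ p hp).trans (by linarith)
      bound_xx := fun p hp => (hC₄ p hp).trans (by linarith)
      bound_xy := fun p hp => (hC₅ p hp).trans (by linarith)
      bound_yx := fun p hp => (hC₆ p hp).trans (by linarith)
      bound_yy := fun p hp => (hC₇ p hp).trans (by linarith) }

section Edges

variable {m₁ m₂ : ℕ} {x₀ C : ℝ} {σ Ω : Set (ℝ × ℝ)} {u ux uy : ℝ × ℝ → ℝ}

theorem closure_flatTriangle_superset {E : ℝ} (hE : 0 < E) {r : ℝ × ℝ} (h1 : 0 ≤ r.2)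
    (h2 : r.2 ≤ r.1) (h3 : r.1 + r.2 ≤ E) : r ∈ closure (flatTriangle E) := by
  -- move slightly towards the interior point `(E / 2, E / 4)`
  refine mem_closure_of_tendsto (b := 𝓝[>] (0 : ℝ))
    (f := fun ε : ℝ => ((1 - ε) * r.1 + ε * (E / 2), (1 - ε) * r.2 + ε * (E / 4))) ?_ ?_
  · have : Continuous fun ε : ℝ =>
        (((1 - ε) * r.1 + ε * (E / 2), (1 - ε) * r.2 + ε * (E / 4)) : ℝ × ℝ) := by fun_prop
    have := this.tendsto 0
    simp only [sub_zero, one_mul, zero_mul, add_zero] at this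
    exact this.mono_left nhdsWithin_le_nhds
  · filter_upwards [Ioo_mem_nhdsGT zero_lt_one] with ε hε
    have h4 : 0 < ε := hε.1
    have h5 : 0 < 1 - ε := by linarith [hε.2]
    have e1 := mul_nonneg h5.le h1
    have e2 := mul_nonneg h5.le (sub_nonneg.2 h2)
    have e3 := mul_nonneg h5.le (sub_nonneg.2 h3)
    have e4 := mul_pos h4 hE
    refine ⟨?_, ?_, ?_⟩
    · simp only; nlinarith
    · simp only; nlinarith
    · simp only; nlinarith

theorem hasFDerivAt_charMap {r : ℝ × ℝ} (h1 : 0 < r.1) (h2 : 0 < r.2) :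
    HasFDerivAt (charMap m₁ m₂)
      (((2 / (charMap m₁ m₂ r).1 ^ ((m₂ : ℝ) / 2)) • ContinuousLinearMap.fst ℝ ℝ ℝ).prod
        (-((2 / (-(charMap m₁ m₂ r).2) ^ ((m₁ : ℝ) / 2)) • ContinuousLinearMap.snd ℝ ℝ ℝ))) r := by
  have e1 := (hasDerivAt_charRoot (m := m₂) h1).comp_hasFDerivAt r
    (hasFDerivAt_fst (𝕜 := ℝ) (E := ℝ) (F := ℝ) (p := r))
  have e2 := (hasDerivAt_charRoot (m := m₁) h2).comp_hasFDerivAt r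
    (hasFDerivAt_snd (𝕜 := ℝ) (E := ℝ) (F := ℝ) (p := r))
  have := e1.prodMk e2.neg
  simp only [charMap, neg_neg]
  exact this

theorem IsTricomiDomain.charMap_mem_closure (h : IsTricomiDomain m₁ m₂ x₀ σ Ω) {r : ℝ × ℝ}
    (hr : r ∈ closure (flatTriangle (charPow m₂ (2 * x₀)))) : charMap m₁ m₂ r ∈ closure Ω := by
  have h1 : MapsTo (charMap m₁ m₂) (flatTriangle (charPow m₂ (2 * x₀))) Ω := fun q hq =>
    h.triangle_subset (charMap_image_flatTriangle (m₁ := m₁) ▸ mem_image_of_mem _ hq)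
  exact h1.closure (continuous_charMap m₁ m₂) hr

/-- The differential of `u` in the straightened variables. -/
noncomputable def flatGrad (m₁ m₂ : ℕ) (ux uy : ℝ × ℝ → ℝ) (r : ℝ × ℝ) : ℝ × ℝ →L[ℝ] ℝ :=
  gradForm (ux (charMap m₁ m₂ r) * (2 / (charMap m₁ m₂ r).1 ^ ((m₂ : ℝ) / 2)))
    (-(uy (charMap m₁ m₂ r) * (2 / (-(charMap m₁ m₂ r).2) ^ ((m₁ : ℝ) / 2))))

/-- In the straightened variables, `u` is differentiable up to the sides of the triangle. -/
theorem IsTricomiDomain.hasFDerivWithinAt_charMap (h : IsTricomiDomain m₁ m₂ x₀ σ Ω)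
    (hu : HasC2Bounds Ω u ux uy C) {r : ℝ × ℝ} (h1 : 0 < r.1) (h2 : 0 < r.2) :
    HasFDerivWithinAt (u ∘ charMap m₁ m₂) (flatGrad m₁ m₂ ux uy r)
      (closure (flatTriangle (charPow m₂ (2 * x₀)))) r := by
  set Δ := flatTriangle (charPow m₂ (2 * x₀)) with hΔ
  have hmaps : ∀ q ∈ Δ, charMap m₁ m₂ q ∈ Ω := fun q hq =>
    h.triangle_subset (charMap_image_flatTriangle (m₁ := m₁) ▸ mem_image_of_mem _ hq)
  have hder : ∀ q ∈ Δ, HasFDerivAt (u ∘ charMap m₁ m₂) (flatGrad m₁ m₂ ux uy q) q := by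
    intro q hq
    have := (hu.deriv _ (hmaps q hq)).comp q (hasFDerivAt_charMap (hq.1.trans hq.2.1) hq.1)
    convert! this using 1
    ext <;> simp [flatGrad]
  refine hasFDerivWithinAt_closure_of_tendsto_fderiv
    (fun q hq => (hder q hq).differentiableAt.differentiableWithinAt)
    (convex_flatTriangle _) (isOpen_flatTriangle _) ?_ ?_
  · intro q hq
    exact ((hu.cont _ (h.charMap_mem_closure hq)).comp (t := closure Ω)
      (continuous_charMap m₁ m₂).continuousWithinAt
      (fun z hz => h.charMap_mem_closure (subset_closure hz)))
  · have hc := continuous_charMap m₁ m₂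
    have p1 : 0 < (charMap m₁ m₂ r).1 := charRoot_pos h1
    have p2 : 0 < -(charMap m₁ m₂ r).2 := by simpa [charMap] using charRoot_pos h2
    have c1 : ContinuousAt (fun q => (charMap m₁ m₂ q).1 ^ ((m₂ : ℝ) / 2)) r :=
      (continuous_fst.comp hc).continuousAt.rpow_const (Or.inr (by positivity))
    have c2 : ContinuousAt (fun q => (-(charMap m₁ m₂ q).2) ^ ((m₁ : ℝ) / 2)) r :=
      (continuous_snd.comp hc).neg.continuousAt.rpow_const (Or.inr (by positivity))
    have hlim : ContinuousAt (flatGrad m₁ m₂ ux uy) r := by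
      refine continuous_gradForm.continuousAt.comp (f := fun q =>
        ((ux (charMap m₁ m₂ q) * (2 / (charMap m₁ m₂ q).1 ^ ((m₂ : ℝ) / 2)),
          -(uy (charMap m₁ m₂ q) * (2 / (-(charMap m₁ m₂ q).2) ^ ((m₁ : ℝ) / 2)))) : ℝ × ℝ)) ?_
      exact ((hu.cont_x.comp hc).continuousAt.mul
          (continuousAt_const.div c1 (Real.rpow_pos_of_pos p1 _).ne')).prodMk
        ((hu.cont_y.comp hc).continuousAt.mul
          (continuousAt_const.div c2 (Real.rpow_pos_of_pos p2 _).ne')).neg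
    refine (hlim.tendsto.mono_left nhdsWithin_le_nhds).congr' ?_
    filter_upwards [self_mem_nhdsWithin] with q hq using (hder q hq).fderiv.symm

theorem charPow_eq_rpow_mul {m : ℕ} {s : ℝ} (hs : 0 < s) :
    charPow m s = s ^ ((m : ℝ) / 2) * s / ((m : ℝ) + 2) := by
  rw [charPow, ← Real.rpow_add_one hs.ne']
  congr 2
  ring

/-- The common end point of the two characteristic arcs. -/
noncomputable def vertex (m₁ m₂ : ℕ) (x₀ : ℝ) : ℝ × ℝ :=
  charMap m₁ m₂ (charPow m₂ (2 * x₀) / 2, charPow m₂ (2 * x₀) / 2)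

theorem vertex_fst_pos (hx : 0 < x₀) : 0 < (vertex m₁ m₂ x₀).1 :=
  charRoot_pos (half_pos (charPow_pos (by positivity)))

theorem vertex_snd_neg (hx : 0 < x₀) : (vertex m₁ m₂ x₀).2 < 0 :=
  neg_neg_iff_pos.2 (charRoot_pos (half_pos (charPow_pos (by positivity))))

theorem charPow_vertex_fst (hx : 0 < x₀) :
    charPow m₂ (vertex m₁ m₂ x₀).1 = charPow m₂ (2 * x₀) / 2 :=
  charPow_charRoot (half_pos (charPow_pos (by positivity))).le

theorem charPow_vertex_snd (hx : 0 < x₀) :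
    charPow m₁ (-(vertex m₁ m₂ x₀).2) = charPow m₂ (2 * x₀) / 2 := by
  simp only [vertex, charMap, neg_neg]
  exact charPow_charRoot (half_pos (charPow_pos (by positivity))).le

theorem charMap_edge (hx : 0 < x₀) (τ : ℝ) :
    charMap m₁ m₂ (charPow m₂ (2 * x₀) / 2 * Real.exp (((m₁ : ℝ) + 2) * ((m₂ : ℝ) + 2) / 2 * τ),
      charPow m₂ (2 * x₀) / 2 * Real.exp (((m₁ : ℝ) + 2) * ((m₂ : ℝ) + 2) / 2 * τ)) =
      edgeCurve m₁ m₂ (vertex m₁ m₂ x₀) τ := by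
  have h1 := charPow_dil_fst (m₁ := m₁) (m₂ := m₂) (vertex_fst_pos (m₁ := m₁) (m₂ := m₂) hx).le (-τ)
  have h2 := charPow_dil_snd (m₁ := m₁) (m₂ := m₂) (vertex_snd_neg (m₁ := m₁) (m₂ := m₂) hx).le (-τ)
  rw [charPow_vertex_fst hx, mul_neg, neg_neg] at h1
  rw [charPow_vertex_snd hx, mul_neg, neg_neg] at h2
  have h3 := (dil_snd_neg_iff (m₁ := m₁) (m₂ := m₂) (t := -τ)).2
    (vertex_snd_neg (m₁ := m₁) (m₂ := m₂) hx)
  refine Prod.ext ?_ ?_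
  · simp only [charMap, edgeCurve]
    rw [← h1]
    exact charRoot_charPow (mul_nonneg (vertex_fst_pos hx).le (Real.exp_pos _).le)
  · simp only [charMap, edgeCurve]
    rw [← h2, charRoot_charPow (by linarith), neg_neg]

theorem edgeCurve_fst_pos (hx : 0 < x₀) (τ : ℝ) :
    0 < (edgeCurve m₁ m₂ (vertex m₁ m₂ x₀) τ).1 :=
  mul_pos (vertex_fst_pos hx) (Real.exp_pos _)

theorem edgeCurve_snd_neg (hx : 0 < x₀) (τ : ℝ) :
    (edgeCurve m₁ m₂ (vertex m₁ m₂ x₀) τ).2 < 0 :=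
  dil_snd_neg_iff.2 (vertex_snd_neg hx)

theorem flat_edge_mem_closure (hx : 0 < x₀) {τ : ℝ} (hτ : τ ≤ 0) :
    (charPow m₂ (2 * x₀) / 2 * Real.exp (((m₁ : ℝ) + 2) * ((m₂ : ℝ) + 2) / 2 * τ),
      charPow m₂ (2 * x₀) / 2 * Real.exp (((m₁ : ℝ) + 2) * ((m₂ : ℝ) + 2) / 2 * τ)) ∈
      closure (flatTriangle (charPow m₂ (2 * x₀))) := by
  have hE : 0 < charPow m₂ (2 * x₀) := charPow_pos (by positivity)
  refine closure_flatTriangle_superset hE (by positivity) le_rfl ?_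
  have : Real.exp (((m₁ : ℝ) + 2) * ((m₂ : ℝ) + 2) / 2 * τ) ≤ 1 := by
    rw [Real.exp_le_one_iff]
    exact mul_nonpos_of_nonneg_of_nonpos (by positivity) hτ
  simp only
  nlinarith

theorem IsTricomiDomain.edgeCurve_mem_closure (h : IsTricomiDomain m₁ m₂ x₀ σ Ω) {τ : ℝ}
    (hτ : τ ≤ 0) : edgeCurve m₁ m₂ (vertex m₁ m₂ x₀) τ ∈ closure Ω := by
  rw [← charMap_edge h.x₀_pos]
  exact h.charMap_mem_closure (flat_edge_mem_closure h.x₀_pos hτ)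

/-- The derivative of `u` along the characteristic `BC'`. -/
theorem IsTricomiDomain.hasDerivAt_edge (h : IsTricomiDomain m₁ m₂ x₀ σ Ω)
    (hu : HasC2Bounds Ω u ux uy C) {τ : ℝ} (hτ : τ < 0) :
    HasDerivAt (fun τ => u (edgeCurve m₁ m₂ (vertex m₁ m₂ x₀) τ))
      (((m₁ : ℝ) + 2) * (edgeCurve m₁ m₂ (vertex m₁ m₂ x₀) τ).1 *
          ux (edgeCurve m₁ m₂ (vertex m₁ m₂ x₀) τ) +
        ((m₂ : ℝ) + 2) * (edgeCurve m₁ m₂ (vertex m₁ m₂ x₀) τ).2 *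
          uy (edgeCurve m₁ m₂ (vertex m₁ m₂ x₀) τ)) τ := by
  have hx := h.x₀_pos
  have hE := h.charE_pos
  set κ : ℝ := ((m₁ : ℝ) + 2) * ((m₂ : ℝ) + 2) / 2 with hκ
  set E := charPow m₂ (2 * x₀) with hEdef
  set ρ : ℝ → ℝ := fun τ => E / 2 * Real.exp (κ * τ) with hρ
  have hρpos : ∀ τ, 0 < ρ τ := fun τ => by positivity
  have hρd : HasDerivAt ρ (κ * ρ τ) τ := by
    have h1 : HasDerivAt (fun τ : ℝ => κ * τ) κ τ := by simpa using (hasDerivAt_id τ).const_mul κ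
    convert! (h1.exp.const_mul (E / 2)) using 1
    simp only [hρ]; ring
  have hF := (h.hasFDerivWithinAt_charMap hu (r := (ρ τ, ρ τ))
    (hρpos τ) (hρpos τ)).comp_hasDerivWithinAt τ (s := Iio 0) (hρd.prodMk hρd).hasDerivWithinAt
    (fun t ht => flat_edge_mem_closure hx (le_of_lt ht))
  have hF' := hF.hasDerivAt (Iio_mem_nhds hτ)
  have hedge : ∀ t, charMap m₁ m₂ (ρ t, ρ t) = edgeCurve m₁ m₂ (vertex m₁ m₂ x₀) t := fun t =>
    charMap_edge hx t
  have hfun : ((u ∘ charMap m₁ m₂) ∘ fun t => (ρ t, ρ t)) =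
      fun t => u (edgeCurve m₁ m₂ (vertex m₁ m₂ x₀) t) := by
    ext t; simp only [Function.comp, hedge]
  rw [hfun] at hF'
  convert! hF' using 1
  rw [flatGrad, gradForm_apply, hedge]
  set q := edgeCurve m₁ m₂ (vertex m₁ m₂ x₀) τ with hq
  have q1 : 0 < q.1 := edgeCurve_fst_pos hx τ
  have q2 : 0 < -q.2 := neg_pos.2 (edgeCurve_snd_neg hx τ)
  have r1 : ρ τ = q.1 ^ ((m₂ : ℝ) / 2) * q.1 / ((m₂ : ℝ) + 2) := by
    rw [← charPow_eq_rpow_mul q1, hq, ← hedge]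
    exact (charPow_charRoot (hρpos τ).le).symm
  have r2 : ρ τ = (-q.2) ^ ((m₁ : ℝ) / 2) * (-q.2) / ((m₁ : ℝ) + 2) := by
    rw [← charPow_eq_rpow_mul q2, hq, ← hedge]
    simp only [charMap, neg_neg]
    exact (charPow_charRoot (hρpos τ).le).symm
  have p1 := Real.rpow_pos_of_pos q1 ((m₂ : ℝ) / 2)
  have p2 := Real.rpow_pos_of_pos q2 ((m₁ : ℝ) / 2)
  have e1 : 2 / q.1 ^ ((m₂ : ℝ) / 2) * (κ * ρ τ) = ((m₁ : ℝ) + 2) * q.1 := by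
    rw [r1, hκ]; field_simp
  have e2 : 2 / (-q.2) ^ ((m₁ : ℝ) / 2) * (κ * ρ τ) = -(((m₂ : ℝ) + 2) * q.2) := by
    rw [r2, hκ]; field_simp
  linear_combination (-ux q) * e1 + (uy q) * e2

/-- On the characteristic `AC'`, where `u` vanishes, the gradient of `u` is isotropic: the
derivative of `u` along the straightened characteristic is zero. -/
theorem IsTricomiDomain.isotropic_grad (h : IsTricomiDomain m₁ m₂ x₀ σ Ω) (hm₁ : Odd m₁)
    (hu : HasC2Bounds Ω u ux uy C) (h0 : ∀ p ∈ charAC m₁ m₂ x₀ ∪ σ, u p = 0) {q : ℝ × ℝ}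
    (hy : q.2 < 0) (hq1 : 0 < q.1) (hq2 : charPow m₁ (-q.2) < charPow m₂ q.1)
    (hq3 : charPow m₁ (-q.2) + charPow m₂ q.1 = charPow m₂ (2 * x₀)) :
    q.2 ^ m₁ * ux q ^ 2 + q.1 ^ m₂ * uy q ^ 2 = 0 := by
  have hx := h.x₀_pos
  have hE := h.charE_pos
  set E := charPow m₂ (2 * x₀) with hEdef
  set X := charPow m₂ q.1 with hX
  set Y := charPow m₁ (-q.2) with hY
  have hXpos : 0 < X := charPow_pos hq1
  have hYpos : 0 < Y := charPow_pos (by linarith)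
  have hmap : charMap m₁ m₂ (X, Y) = q := by
    simp only [charMap, hX, hY]
    rw [charRoot_charPow hq1.le, charRoot_charPow (by linarith), neg_neg]
  have hline : HasDerivAt (fun s : ℝ => ((X + s, Y - s) : ℝ × ℝ)) (1, -1) 0 :=
    ((hasDerivAt_id (0 : ℝ)).const_add X).prodMk ((hasDerivAt_id (0 : ℝ)).const_sub Y)
  have hmem : ∀ s ∈ Ioo (-((X - Y) / 2)) Y,
      charMap m₁ m₂ (X + s, Y - s) ∈ charAC m₁ m₂ x₀ ∧
      ((X + s, Y - s) : ℝ × ℝ) ∈ closure (flatTriangle E) := by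
    intro s hs
    have s1 : 0 ≤ Y - s := by linarith [hs.2]
    have s2 : 0 ≤ X + s := by linarith [hs.1]
    constructor
    · rw [mem_charAC_iff hx]
      simp only [charMap, neg_neg, charPow_charRoot s1, charPow_charRoot s2]
      refine ⟨charRoot_nonneg s2, by linarith [charRoot_nonneg (m := m₁) s1], ?_, by linarith⟩
      rw [← hEdef]
      linarith [hs.1]
    · exact closure_flatTriangle_superset hE s1 (by simp only; linarith [hs.1])
        (by simp only; linarith)
  have hnhds : Ioo (-((X - Y) / 2)) Y ∈ 𝓝 (0 : ℝ) := Ioo_mem_nhds (by linarith) hYpos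
  have hF0 := h.hasFDerivWithinAt_charMap hu (r := (X, Y)) hXpos hYpos
  rw [show ((X, Y) : ℝ × ℝ) = (X + 0, Y - 0) by simp] at hF0
  have hF := (hF0.comp_hasDerivWithinAt 0 (s := Ioo (-((X - Y) / 2)) Y) hline.hasDerivWithinAt
    (fun s hs => (hmem s hs).2)).hasDerivAt hnhds
  have hzero : HasDerivAt ((u ∘ charMap m₁ m₂) ∘ fun s : ℝ => ((X + s, Y - s) : ℝ × ℝ)) 0 0 := by
    refine (hasDerivAt_const (0 : ℝ) (0 : ℝ)).congr_of_eventuallyEq ?_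
    filter_upwards [hnhds] with s hs
    exact h0 _ (Or.inl (hmem s hs).1)
  have hval := hF.unique hzero
  rw [add_zero, sub_zero, flatGrad, gradForm_apply, hmap] at hval
  have q2 : 0 < -q.2 := by linarith
  have p1 := Real.rpow_pos_of_pos hq1 ((m₂ : ℝ) / 2)
  have p2 := Real.rpow_pos_of_pos q2 ((m₁ : ℝ) / 2)
  have s1 : (q.1 ^ ((m₂ : ℝ) / 2)) ^ 2 = q.1 ^ m₂ := by
    rw [← Real.rpow_natCast, ← Real.rpow_mul hq1.le, ← Real.rpow_natCast]
    congr 1; push_cast; ring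
  have s2 : ((-q.2) ^ ((m₁ : ℝ) / 2)) ^ 2 = -q.2 ^ m₁ := by
    rw [← hm₁.neg_pow, ← Real.rpow_natCast, ← Real.rpow_mul q2.le, ← Real.rpow_natCast]
    congr 1; push_cast; ring
  set A := q.1 ^ ((m₂ : ℝ) / 2)
  set B := (-q.2) ^ ((m₁ : ℝ) / 2)
  have hlin : ux q * B + uy q * A = 0 := by
    simp only at hval
    field_simp at hval
    linarith
  rw [← s1, show q.2 ^ m₁ = -B ^ 2 by rw [s2]; ring]
  linear_combination (uy q * A - ux q * B) * hlin

end Edges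

/-! ### The values on the characteristic through the origin -/

section Identity

variable {m₁ m₂ : ℕ} {x₀ C : ℝ} {σ Ω : Set (ℝ × ℝ)} {u ux uy : ℝ × ℝ → ℝ}

theorem IsTricomiDomain.subset_openCharRegion (h : IsTricomiDomain m₁ m₂ x₀ σ Ω) :
    Ω ⊆ openCharRegion m₁ m₂ := fun _ hp hy =>
  ⟨(h.mem_triangle_of_mem hp hy).1, (h.mem_triangle_of_mem hp hy).2.2.1⟩

theorem dil_mem_openCharRegion {p : ℝ × ℝ} (hp : p ∈ openCharRegion m₁ m₂) (t : ℝ) :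
    dil m₁ m₂ t p ∈ openCharRegion m₁ m₂ := by
  intro hy
  have hy' := dil_snd_neg_iff.1 hy
  obtain ⟨h1, h2⟩ := hp hy'
  refine ⟨mul_pos h1 (Real.exp_pos _), ?_⟩
  rw [charPow_dil_fst h1.le, charPow_dil_snd hy'.le]
  exact mul_lt_mul_of_pos_right h2 (Real.exp_pos _)

/-- Above the characteristic through the origin, the zero extension of `u` vanishes off `Ω` itself,
not only off the closure. -/
theorem IsTricomiDomain.zeroExt_eq_zero (h : IsTricomiDomain m₁ m₂ x₀ σ Ω)
    (h0 : ∀ p ∈ charAC m₁ m₂ x₀ ∪ σ, u p = 0) {p : ℝ × ℝ} (hp : p ∈ openCharRegion m₁ m₂)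
    (hpΩ : p ∉ Ω) : zeroExt Ω u p = 0 := by
  by_cases hK : p ∈ closure Ω
  · rw [zeroExt_of_mem hK]
    rcases h.mem_of_mem_closure hK with h1 | h1 | h1
    · exact absurd h1 hpΩ
    · exact h0 _ h1
    · obtain ⟨h2, h3, -, h5⟩ := (mem_charBC_iff h.x₀_pos).1 h1
      rcases h3.eq_or_lt with h3 | h3
      · rw [h3, neg_zero, charPow_zero, ← charPow_zero m₂] at h5
        have : p = (0, 0) := Prod.ext
          ((charPow_strictMonoOn m₂).injOn h2 (mem_Ici.2 le_rfl) h5.symm) h3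
        rw [this]
        exact h0 _ (Or.inr h.origin_mem_sigma)
      · exact absurd h5 (hp h3).2.ne
  · exact zeroExt_of_notMem hK

theorem IsTricomiDomain.zeroExt_edge_eq_zero (h : IsTricomiDomain m₁ m₂ x₀ σ Ω)
    (h0 : ∀ p ∈ charAC m₁ m₂ x₀ ∪ σ, u p = 0) {τ : ℝ} (hτ : 0 ≤ τ) :
    zeroExt Ω u (edgeCurve m₁ m₂ (vertex m₁ m₂ x₀) τ) = 0 := by
  have hx := h.x₀_pos
  have hE := h.charE_pos
  have hy := edgeCurve_snd_neg (m₁ := m₁) (m₂ := m₂) hx τ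
  by_cases hK : edgeCurve m₁ m₂ (vertex m₁ m₂ x₀) τ ∈ closure Ω
  · rw [zeroExt_of_mem hK]
    have key : charPow m₂ (edgeCurve m₁ m₂ (vertex m₁ m₂ x₀) τ).1 =
        charPow m₁ (-(edgeCurve m₁ m₂ (vertex m₁ m₂ x₀) τ).2) := by
      rw [edgeCurve, charPow_dil_fst (vertex_fst_pos hx).le, charPow_dil_snd (vertex_snd_neg hx).le,
        charPow_vertex_fst hx, charPow_vertex_snd hx]
    rcases h.mem_of_mem_closure hK with h1 | h1 | h1
    · exact absurd key (h.subset_openCharRegion h1 hy).2.ne'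
    · exact h0 _ h1
    · obtain ⟨h2, h3, h4, h5⟩ := (mem_charBC_iff hx).1 h1
      refine h0 _ (Or.inl ((mem_charAC_iff hx).2 ⟨h2, h3, h4, ?_⟩))
      have h6 : charPow m₂ (vertex m₁ m₂ x₀).1 ≤
          charPow m₂ (edgeCurve m₁ m₂ (vertex m₁ m₂ x₀) τ).1 := by
        refine charPow_le (vertex_fst_pos hx).le ?_
        rw [edgeCurve_eq]
        exact le_mul_of_one_le_right (vertex_fst_pos hx).le
          (Real.one_le_exp (by positivity))
      rw [charPow_vertex_fst hx] at h6
      linarith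
  · exact zeroExt_of_notMem hK

theorem edgeCurve_mem_charRegion (hx : 0 < x₀) (τ : ℝ) :
    edgeCurve m₁ m₂ (vertex m₁ m₂ x₀) τ ∈ charRegion m₁ m₂ := by
  refine dil_mem_charRegion (fun _ => ⟨(vertex_fst_pos hx).le, ?_⟩) _
  rw [charPow_vertex_fst hx, charPow_vertex_snd hx]

theorem continuous_edgeCurve (c : ℝ × ℝ) : Continuous (edgeCurve m₁ m₂ c) :=
  (continuous_dFlow_time _ _ c).comp continuous_neg

theorem dil_edgeCurve (c : ℝ × ℝ) (t τ : ℝ) :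
    dil m₁ m₂ (-t) (edgeCurve m₁ m₂ c τ) = edgeCurve m₁ m₂ c (τ + t) := by
  change dFlow _ _ (-t) (dFlow _ _ (-τ) c) = dFlow _ _ (-(τ + t)) c
  rw [dFlow_dFlow]
  congr 1; ring

/-- The values of `u` along the characteristic through the origin, parametrized by the flow so that
`τ = 0` is the point `C'` and `τ → -∞` is the origin; they are extended by zero to `τ > 0`. -/
noncomputable def edgeVal (m₁ m₂ : ℕ) (x₀ : ℝ) (Ω : Set (ℝ × ℝ)) (u : ℝ × ℝ → ℝ) (τ : ℝ) : ℝ :=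
  zeroExt Ω u (edgeCurve m₁ m₂ (vertex m₁ m₂ x₀) τ)

/-- The derivative of `u` along the characteristic through the origin. -/
noncomputable def edgeDeriv (m₁ m₂ : ℕ) (x₀ : ℝ) (ux uy : ℝ × ℝ → ℝ) (τ : ℝ) : ℝ :=
  ((m₁ : ℝ) + 2) * (edgeCurve m₁ m₂ (vertex m₁ m₂ x₀) τ).1 *
      ux (edgeCurve m₁ m₂ (vertex m₁ m₂ x₀) τ) +
    ((m₂ : ℝ) + 2) * (edgeCurve m₁ m₂ (vertex m₁ m₂ x₀) τ).2 *
      uy (edgeCurve m₁ m₂ (vertex m₁ m₂ x₀) τ)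

theorem IsTricomiDomain.continuous_edgeVal (h : IsTricomiDomain m₁ m₂ x₀ σ Ω)
    (hu : ContinuousOn u (closure Ω)) (h0 : ∀ p ∈ charAC m₁ m₂ x₀ ∪ σ, u p = 0) :
    Continuous (edgeVal m₁ m₂ x₀ Ω u) :=
  (h.continuousOn_zeroExt hu h0).comp_continuous (continuous_edgeCurve _)
    (edgeCurve_mem_charRegion h.x₀_pos)

theorem HasC2Bounds.continuous_edgeDeriv (hu : HasC2Bounds Ω u ux uy C) :
    Continuous (edgeDeriv m₁ m₂ x₀ ux uy) := by
  have hc := continuous_edgeCurve (m₁ := m₁) (m₂ := m₂) (vertex m₁ m₂ x₀)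
  have h1 := hu.cont_x.comp hc
  have h2 := hu.cont_y.comp hc
  exact ((continuous_const.mul (continuous_fst.comp hc)).mul h1).add
    ((continuous_const.mul (continuous_snd.comp hc)).mul h2)

theorem HasC2Bounds.bound_closure (hu : HasC2Bounds Ω u ux uy C) {p : ℝ × ℝ}
    (hp : p ∈ closure Ω) : |u p| ≤ C ∧ |ux p| ≤ C ∧ |uy p| ≤ C ∧ |p.1| ≤ C ∧ |p.2| ≤ C :=
  ⟨le_on_closure hu.bound hu.cont.abs continuousOn_const hp,
    le_on_closure hu.bound_x hu.cont_x.abs.continuousOn continuousOn_const hp,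
    le_on_closure hu.bound_y hu.cont_y.abs.continuousOn continuousOn_const hp,
    le_on_closure (fun q hq => (hu.bound_pos q hq).1) continuous_fst.abs.continuousOn
      continuousOn_const hp,
    le_on_closure (fun q hq => (hu.bound_pos q hq).2) continuous_snd.abs.continuousOn
      continuousOn_const hp⟩

theorem HasC2Bounds.abs_zeroExt_le (hu : HasC2Bounds Ω u ux uy C) (p : ℝ × ℝ) :
    |zeroExt Ω u p| ≤ C := by
  by_cases hp : p ∈ closure Ω
  · rw [zeroExt_of_mem hp]; exact (hu.bound_closure hp).1
  · rw [zeroExt_of_notMem hp, abs_zero]; exact hu.C_nonneg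

theorem IsTricomiDomain.abs_edgeDeriv_le (h : IsTricomiDomain m₁ m₂ x₀ σ Ω)
    (hu : HasC2Bounds Ω u ux uy C) {τ : ℝ} (hτ : τ ≤ 0) :
    |edgeDeriv m₁ m₂ x₀ ux uy τ| ≤ ((m₁ : ℝ) + 2) * C * C + ((m₂ : ℝ) + 2) * C * C := by
  obtain ⟨-, b1, b2, b3, b4⟩ := hu.bound_closure (h.edgeCurve_mem_closure hτ)
  have hC := hu.C_nonneg
  refine (abs_add_le _ _).trans (add_le_add ?_ ?_)
  · rw [abs_mul, abs_mul, abs_of_pos (two_add_pos m₁)]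
    gcongr
  · rw [abs_mul, abs_mul, abs_of_pos (two_add_pos m₂)]
    gcongr

/-- Functions on the line which decay exponentially at `-∞` and vanish near `+∞` are integrable. -/
theorem integrable_of_exp_bound {f : ℝ → ℝ} (hf : AEStronglyMeasurable f volume) {M k T : ℝ}
    (hk : 0 < k) (h1 : ∀ τ ≤ T, |f τ| ≤ M * Real.exp (k * τ)) (h2 : ∀ τ, T < τ → f τ = 0) :
    Integrable f := by
  have hexp : IntegrableOn (fun τ => M * Real.exp (k * τ)) (Iic T) :=
    (integrableOn_exp_mul_Iic hk T).const_mul M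
  have h3 : IntegrableOn f (Iic T) := by
    refine hexp.mono' hf.restrict ?_
    filter_upwards [ae_restrict_mem measurableSet_Iic] with τ hτ using h1 τ hτ
  refine (integrableOn_iff_integrable_of_support_subset ?_).1 h3
  intro τ hτ
  by_contra hcon
  exact hτ (h2 τ (not_le.1 hcon))

/-- The constant in front of the boundary integral over the characteristic. -/
noncomputable def edgeConst (m₁ m₂ : ℕ) (x₀ : ℝ) : ℝ :=
  ((m₂ : ℝ) + 2) * (vertex m₁ m₂ x₀).2 ^ (m₁ + 1) / (((m₁ : ℝ) + 2) * (vertex m₁ m₂ x₀).1)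

/-- The degree of homogeneity `m₁ + m₂ + m₁ m₂` of the energy under the dilations. -/
def homDeg (m₁ m₂ : ℕ) : ℝ := (m₁ : ℝ) + m₂ + m₁ * m₂

theorem edgeConst_pos (hm₁ : Odd m₁) (hx : 0 < x₀) : 0 < edgeConst m₁ m₂ x₀ := by
  have h1 := vertex_fst_pos (m₁ := m₁) (m₂ := m₂) hx
  have h2 := vertex_snd_neg (m₁ := m₁) (m₂ := m₂) hx
  have h3 : 0 < (vertex m₁ m₂ x₀).2 ^ (m₁ + 1) := hm₁.add_one.pow_pos h2.ne
  unfold edgeConst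
  positivity

theorem charPow_sq {m : ℕ} {s : ℝ} (hs : 0 ≤ s) :
    charPow m s ^ 2 = s ^ (m + 2) / ((m : ℝ) + 2) ^ 2 := by
  rw [charPow, div_pow, ← Real.rpow_natCast (s ^ _), ← Real.rpow_mul hs, ← Real.rpow_natCast s]
  congr 2; push_cast; ring

theorem exp_homDeg_fst (τ : ℝ) : Real.exp (((m₂ : ℝ) + 2) * τ) ^ (m₁ + 1) =
    Real.exp (homDeg m₁ m₂ * τ) * Real.exp (((m₁ : ℝ) + 2) * τ) := by
  rw [← Real.exp_nat_mul, ← Real.exp_add, homDeg]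
  congr 1; push_cast; ring

theorem exp_homDeg_snd (τ : ℝ) : Real.exp (((m₁ : ℝ) + 2) * τ) ^ (m₂ + 1) =
    Real.exp (homDeg m₁ m₂ * τ) * Real.exp (((m₂ : ℝ) + 2) * τ) := by
  rw [← Real.exp_nat_mul, ← Real.exp_add, homDeg]
  congr 1; push_cast; ring

/-- On a characteristic, the conormal is tangential; this is the first component, with the powers of
the coordinates expressed by the parameter of the flow. -/
theorem conormal_edge_fst (hx : 0 < x₀) (τ : ℝ) :
    ((m₂ : ℝ) + 2) * (edgeCurve m₁ m₂ (vertex m₁ m₂ x₀) τ).2 *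
        (edgeCurve m₁ m₂ (vertex m₁ m₂ x₀) τ).2 ^ m₁ =
      edgeConst m₁ m₂ x₀ * Real.exp (homDeg m₁ m₂ * τ) *
        (((m₁ : ℝ) + 2) * (edgeCurve m₁ m₂ (vertex m₁ m₂ x₀) τ).1) := by
  have h1 := (vertex_fst_pos (m₁ := m₁) (m₂ := m₂) hx).ne'
  have h2 := two_add_pos m₁
  have h3 := exp_homDeg_fst (m₁ := m₁) (m₂ := m₂) τ
  rw [edgeCurve_eq]
  simp only
  have : ((m₂ : ℝ) + 2) * ((vertex m₁ m₂ x₀).2 * Real.exp (((m₂ : ℝ) + 2) * τ)) *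
      ((vertex m₁ m₂ x₀).2 * Real.exp (((m₂ : ℝ) + 2) * τ)) ^ m₁ =
      ((m₂ : ℝ) + 2) * (vertex m₁ m₂ x₀).2 ^ (m₁ + 1) *
        Real.exp (((m₂ : ℝ) + 2) * τ) ^ (m₁ + 1) := by ring
  rw [this, h3, edgeConst]
  field_simp

/-- The second component of the tangential conormal. -/
theorem conormal_edge_snd (hm₁ : Odd m₁) (hx : 0 < x₀) (τ : ℝ) :
    ((m₁ : ℝ) + 2) * (edgeCurve m₁ m₂ (vertex m₁ m₂ x₀) τ).1 *
        (edgeCurve m₁ m₂ (vertex m₁ m₂ x₀) τ).1 ^ m₂ =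
      -(edgeConst m₁ m₂ x₀ * Real.exp (homDeg m₁ m₂ * τ) *
        (((m₂ : ℝ) + 2) * (edgeCurve m₁ m₂ (vertex m₁ m₂ x₀) τ).2)) := by
  have h1 := (vertex_fst_pos (m₁ := m₁) (m₂ := m₂) hx)
  have hv2 := (vertex_snd_neg (m₁ := m₁) (m₂ := m₂) hx)
  have h2 := two_add_pos m₁
  have h2' := two_add_pos m₂
  have h3 := exp_homDeg_snd (m₁ := m₁) (m₂ := m₂) τ
  have hsq : charPow m₁ (-(vertex m₁ m₂ x₀).2) ^ 2 = charPow m₂ (vertex m₁ m₂ x₀).1 ^ 2 := by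
    rw [charPow_vertex_fst hx, charPow_vertex_snd hx]
  rw [charPow_sq (by linarith), charPow_sq h1.le, (hm₁.add_even even_two).neg_pow,
    div_eq_div_iff (by positivity) (by positivity)] at hsq
  rw [edgeCurve_eq]
  simp only
  have : ((m₁ : ℝ) + 2) * ((vertex m₁ m₂ x₀).1 * Real.exp (((m₁ : ℝ) + 2) * τ)) *
      ((vertex m₁ m₂ x₀).1 * Real.exp (((m₁ : ℝ) + 2) * τ)) ^ m₂ =
      ((m₁ : ℝ) + 2) * (vertex m₁ m₂ x₀).1 ^ (m₂ + 1) *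
        Real.exp (((m₁ : ℝ) + 2) * τ) ^ (m₂ + 1) := by ring
  rw [this, h3, edgeConst]
  field_simp
  rw [pow_succ] at hsq
  linear_combination -hsq

theorem hasDerivAt_slice_fst {F : ℝ × ℝ → ℝ} {α β : ℝ} {p : ℝ × ℝ}
    (hF : HasFDerivAt F (gradForm α β) p) : HasDerivAt (fun x => F (x, p.2)) α p.1 := by
  have h1 : HasDerivAt (fun x : ℝ => ((x, p.2) : ℝ × ℝ)) (1, 0) p.1 :=
    (hasDerivAt_id p.1).prodMk (hasDerivAt_const _ _)
  have := hF.comp_hasDerivAt_of_eq p.1 h1 rfl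
  rw [gradForm_apply] at this
  simp only [mul_one, mul_zero, add_zero] at this
  exact this

theorem hasDerivAt_slice_snd {F : ℝ × ℝ → ℝ} {α β : ℝ} {p : ℝ × ℝ}
    (hF : HasFDerivAt F (gradForm α β) p) : HasDerivAt (fun y => F (p.1, y)) β p.2 := by
  have h1 : HasDerivAt (fun y : ℝ => ((p.1, y) : ℝ × ℝ)) (0, 1) p.2 :=
    (hasDerivAt_const _ _).prodMk (hasDerivAt_id p.2)
  have := hF.comp_hasDerivAt_of_eq p.2 h1 rfl
  rw [gradForm_apply] at this
  simp only [mul_one, mul_zero, zero_add] at this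
  exact this

/-- The derivative of a dilated function. -/
theorem hasFDerivAt_comp_dil {F : ℝ × ℝ → ℝ} {α β t : ℝ} {p : ℝ × ℝ}
    (hF : HasFDerivAt F (gradForm α β) (dil m₁ m₂ (-t) p)) :
    HasFDerivAt (fun q => F (dil m₁ m₂ (-t) q))
      (gradForm (Real.exp (((m₁ : ℝ) + 2) * t) * α) (Real.exp (((m₂ : ℝ) + 2) * t) * β)) p := by
  have h1 : HasFDerivAt (dil m₁ m₂ (-t))
      ((Real.exp (((m₁ : ℝ) + 2) * t) • ContinuousLinearMap.fst ℝ ℝ ℝ).prod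
        (Real.exp (((m₂ : ℝ) + 2) * t) • ContinuousLinearMap.snd ℝ ℝ ℝ)) p := by
    have : dil m₁ m₂ (-t) = ((Real.exp (((m₁ : ℝ) + 2) * t) • ContinuousLinearMap.fst ℝ ℝ ℝ).prod
        (Real.exp (((m₂ : ℝ) + 2) * t) • ContinuousLinearMap.snd ℝ ℝ ℝ)) := by
      ext q <;> simp only [dFlow, neg_mul_neg] <;> simp [mul_comm]
    rw [this]
    exact ContinuousLinearMap.hasFDerivAt _
  convert! hF.comp p h1 using 1
  ext <;> simp [mul_comm]

end Identity

/-! ### Green's formula on the dilated domain -/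

section GreenIdentity

variable {m₁ m₂ : ℕ} {x₀ C : ℝ} {σ Ω : Set (ℝ × ℝ)} {u ux uy : ℝ × ℝ → ℝ}

theorem opO_eq (m₁ m₂ : ℕ) (u : ℝ × ℝ → ℝ) (p : ℝ × ℝ) : opO m₁ m₂ u p =
    -p.2 ^ m₁ * partialX (partialX u) p - p.1 ^ m₂ * partialY (partialY u) p := rfl

theorem IsTricomiDomain.dil_image_subset (h : IsTricomiDomain m₁ m₂ x₀ σ Ω)
    (hs : IsDStarShaped ((m₁ : ℝ) + 2) ((m₂ : ℝ) + 2) Ω) {t : ℝ} (ht : 0 ≤ t) :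
    dil m₁ m₂ t '' Ω ⊆ Ω := by
  rintro _ ⟨q, hq, rfl⟩
  exact h.dil_mem hs ht hq

theorem isOpen_dil_image (hΩ : IsOpen Ω) (t : ℝ) : IsOpen (dil m₁ m₂ t '' Ω) := by
  rw [dFlow_image_eq_preimage]
  exact hΩ.preimage (continuous_dFlow _ _ _)

theorem mem_dil_image {t : ℝ} {p : ℝ × ℝ} :
    p ∈ dil m₁ m₂ t '' Ω ↔ dil m₁ m₂ (-t) p ∈ Ω := by
  rw [dFlow_image_eq_preimage]; rfl

/-- The dilated function, extended by zero, is differentiable in the dilated domain. -/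
theorem HasC2Bounds.hasFDerivAt_zeroExt_dil (hu : HasC2Bounds Ω u ux uy C) {t : ℝ} {p : ℝ × ℝ}
    (hp : dil m₁ m₂ (-t) p ∈ Ω) :
    HasFDerivAt (fun q => zeroExt Ω u (dil m₁ m₂ (-t) q))
      (gradForm (Real.exp (((m₁ : ℝ) + 2) * t) * ux (dil m₁ m₂ (-t) p))
        (Real.exp (((m₂ : ℝ) + 2) * t) * uy (dil m₁ m₂ (-t) p))) p := by
  refine (hasFDerivAt_comp_dil (hu.deriv _ hp)).congr_of_eventuallyEq ?_
  filter_upwards [(isOpen_dil_image hu.isOpen t).mem_nhds (mem_dil_image.2 hp)] with q hq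
  exact zeroExt_of_mem (subset_closure (mem_dil_image.1 hq))

theorem IsTricomiDomain.continuousOn_zeroExt_dil (h : IsTricomiDomain m₁ m₂ x₀ σ Ω)
    (hu : HasC2Bounds Ω u ux uy C) (h0 : ∀ p ∈ charAC m₁ m₂ x₀ ∪ σ, u p = 0) (t : ℝ) :
    ContinuousOn (fun q => zeroExt Ω u (dil m₁ m₂ t q)) (charRegion m₁ m₂) :=
  (h.continuousOn_zeroExt hu.cont h0).comp (continuous_dFlow _ _ _).continuousOn
    fun _ hp => dil_mem_charRegion hp _

theorem IsTricomiDomain.zeroExt_dil_eq_zero (h : IsTricomiDomain m₁ m₂ x₀ σ Ω)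
    (h0 : ∀ p ∈ charAC m₁ m₂ x₀ ∪ σ, u p = 0) {t : ℝ} {p : ℝ × ℝ}
    (hp : p ∈ openCharRegion m₁ m₂) (ht : dil m₁ m₂ t p ∉ Ω) :
    zeroExt Ω u (dil m₁ m₂ t p) = 0 :=
  h.zeroExt_eq_zero h0 (dil_mem_openCharRegion hp t) ht

/-- The horizontal part of Green's formula. -/
theorem IsTricomiDomain.green_fst (h : IsTricomiDomain m₁ m₂ x₀ σ Ω)
    (hs : IsDStarShaped ((m₁ : ℝ) + 2) ((m₂ : ℝ) + 2) Ω)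
    (hu : HasC2Bounds Ω u ux uy C) (h0 : ∀ p ∈ charAC m₁ m₂ x₀ ∪ σ, u p = 0) {t : ℝ}
    (ht : 0 ≤ t) :
    IntegrableOn (fun p => p.2 ^ m₁ * ux p *
      (Real.exp (((m₁ : ℝ) + 2) * t) * ux (dil m₁ m₂ (-t) p)) +
      zeroExt Ω u (dil m₁ m₂ (-t) p) * (p.2 ^ m₁ * partialX (partialX u) p)) (dil m₁ m₂ t '' Ω) ∧
    ∫ p in dil m₁ m₂ t '' Ω, (p.2 ^ m₁ * ux p *
      (Real.exp (((m₁ : ℝ) + 2) * t) * ux (dil m₁ m₂ (-t) p)) +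
      zeroExt Ω u (dil m₁ m₂ (-t) p) * (p.2 ^ m₁ * partialX (partialX u) p)) =
    ∫ τ : ℝ, ((m₂ : ℝ) + 2) * (edgeCurve m₁ m₂ (vertex m₁ m₂ x₀) τ).2 *
      (edgeVal m₁ m₂ x₀ Ω u (τ + t) * ((edgeCurve m₁ m₂ (vertex m₁ m₂ x₀) τ).2 ^ m₁ *
        ux (edgeCurve m₁ m₂ (vertex m₁ m₂ x₀) τ))) := by
  have hsub := h.dil_image_subset hs ht
  have hO := isOpen_dil_image (m₁ := m₁) (m₂ := m₂) hu.isOpen t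
  have hC := hu.C_nonneg
  have hx := h.x₀_pos
  have hv := h.continuousOn_zeroExt_dil hu h0 (-t)
  have hreg := h.subset_openCharRegion
  have hcP' : ContinuousOn (fun p => p.2 ^ m₁ * ux p *
      (Real.exp (((m₁ : ℝ) + 2) * t) * ux (dil m₁ m₂ (-t) p)) +
      zeroExt Ω u (dil m₁ m₂ (-t) p) * (p.2 ^ m₁ * partialX (partialX u) p))
      (dil m₁ m₂ t '' Ω) := by
    have c1 : Continuous fun p : ℝ × ℝ => p.2 ^ m₁ * ux p *
        (Real.exp (((m₁ : ℝ) + 2) * t) * ux (dil m₁ m₂ (-t) p)) :=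
      ((continuous_snd.pow _).mul hu.cont_x).mul
        (continuous_const.mul (hu.cont_x.comp (continuous_dFlow _ _ _)))
    exact c1.continuousOn.add ((hv.mono (hsub.trans (hreg.trans openCharRegion_subset))).mul
      ((continuous_snd.pow _).continuousOn.mul (hu.cont_xx.mono hsub)))
  have hbP' : ∀ p ∈ dil m₁ m₂ t '' Ω, |p.2 ^ m₁ * ux p *
      (Real.exp (((m₁ : ℝ) + 2) * t) * ux (dil m₁ m₂ (-t) p)) +
      zeroExt Ω u (dil m₁ m₂ (-t) p) * (p.2 ^ m₁ * partialX (partialX u) p)| ≤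
      C ^ m₁ * C * (Real.exp (((m₁ : ℝ) + 2) * t) * C) + C * (C ^ m₁ * C) := by
    intro p hp
    have hp' := hsub hp
    have b1 := (hu.bound_pos p hp').2
    have b2 := hu.bound_x p hp'
    have b3 := hu.bound_x _ (mem_dil_image.1 hp)
    have b4 := hu.abs_zeroExt_le (dil m₁ m₂ (-t) p)
    have b5 := hu.bound_xx p hp'
    refine (abs_add_le _ _).trans (add_le_add ?_ ?_)
    · rw [abs_mul, abs_mul, abs_mul, abs_pow, abs_of_pos (Real.exp_pos _)]
      gcongr
    · rw [abs_mul, abs_mul, abs_pow]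
      gcongr
  refine ⟨integrableOn_of_continuousOn_of_bounded hO (hu.isBounded.subset hsub) hcP' hbP', ?_⟩
  have key := setIntegral_partial_fst (m₁ := m₁) (m₂ := m₂) (O := dil m₁ m₂ t '' Ω)
    (P := fun p => zeroExt Ω u (dil m₁ m₂ (-t) p) * (p.2 ^ m₁ * ux p))
    hO (hu.isBounded.subset hsub) (hsub.trans hreg)
    (hv.mul ((continuous_snd.pow _).mul hu.cont_x).continuousOn)
    (fun p hp hpO => by
      rw [h.zeroExt_dil_eq_zero h0 hp (fun hcon => hpO (mem_dil_image.2 hcon)), zero_mul])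
    (fun p hp => by
      have d1 := hasDerivAt_slice_fst (hu.hasFDerivAt_zeroExt_dil (mem_dil_image.1 hp))
      have d2 := (hasDerivAt_slice_fst (hu.deriv_x p (hsub hp))).const_mul (p.2 ^ m₁)
      convert! d1.mul d2 using 1
      ring) hcP' hbP' (by positivity)
  refine key.trans ((setIntegral_edgeX (vertex_fst_pos hx) (vertex_snd_neg hx)
    (by rw [charPow_vertex_fst hx, charPow_vertex_snd hx])
    (fun p => zeroExt Ω u (dil m₁ m₂ (-t) p) * (p.2 ^ m₁ * ux p))).trans ?_)
  simp only [dil_edgeCurve, edgeVal]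

/-- The vertical part of Green's formula. -/
theorem IsTricomiDomain.green_snd (h : IsTricomiDomain m₁ m₂ x₀ σ Ω)
    (hs : IsDStarShaped ((m₁ : ℝ) + 2) ((m₂ : ℝ) + 2) Ω)
    (hu : HasC2Bounds Ω u ux uy C) (h0 : ∀ p ∈ charAC m₁ m₂ x₀ ∪ σ, u p = 0) {t : ℝ}
    (ht : 0 ≤ t) :
    IntegrableOn (fun p => p.1 ^ m₂ * uy p *
      (Real.exp (((m₂ : ℝ) + 2) * t) * uy (dil m₁ m₂ (-t) p)) +
      zeroExt Ω u (dil m₁ m₂ (-t) p) * (p.1 ^ m₂ * partialY (partialY u) p)) (dil m₁ m₂ t '' Ω) ∧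
    ∫ p in dil m₁ m₂ t '' Ω, (p.1 ^ m₂ * uy p *
      (Real.exp (((m₂ : ℝ) + 2) * t) * uy (dil m₁ m₂ (-t) p)) +
      zeroExt Ω u (dil m₁ m₂ (-t) p) * (p.1 ^ m₂ * partialY (partialY u) p)) =
    ∫ τ : ℝ, -(((m₁ : ℝ) + 2) * (edgeCurve m₁ m₂ (vertex m₁ m₂ x₀) τ).1 *
      (edgeVal m₁ m₂ x₀ Ω u (τ + t) * ((edgeCurve m₁ m₂ (vertex m₁ m₂ x₀) τ).1 ^ m₂ *
        uy (edgeCurve m₁ m₂ (vertex m₁ m₂ x₀) τ)))) := by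
  have hsub := h.dil_image_subset hs ht
  have hO := isOpen_dil_image (m₁ := m₁) (m₂ := m₂) hu.isOpen t
  have hC := hu.C_nonneg
  have hx := h.x₀_pos
  have hv := h.continuousOn_zeroExt_dil hu h0 (-t)
  have hreg := h.subset_openCharRegion
  have hcP' : ContinuousOn (fun p => p.1 ^ m₂ * uy p *
      (Real.exp (((m₂ : ℝ) + 2) * t) * uy (dil m₁ m₂ (-t) p)) +
      zeroExt Ω u (dil m₁ m₂ (-t) p) * (p.1 ^ m₂ * partialY (partialY u) p))
      (dil m₁ m₂ t '' Ω) := by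
    have c1 : Continuous fun p : ℝ × ℝ => p.1 ^ m₂ * uy p *
        (Real.exp (((m₂ : ℝ) + 2) * t) * uy (dil m₁ m₂ (-t) p)) :=
      ((continuous_fst.pow _).mul hu.cont_y).mul
        (continuous_const.mul (hu.cont_y.comp (continuous_dFlow _ _ _)))
    exact c1.continuousOn.add ((hv.mono (hsub.trans (hreg.trans openCharRegion_subset))).mul
      ((continuous_fst.pow _).continuousOn.mul (hu.cont_yy.mono hsub)))
  have hbP' : ∀ p ∈ dil m₁ m₂ t '' Ω, |p.1 ^ m₂ * uy p *
      (Real.exp (((m₂ : ℝ) + 2) * t) * uy (dil m₁ m₂ (-t) p)) +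
      zeroExt Ω u (dil m₁ m₂ (-t) p) * (p.1 ^ m₂ * partialY (partialY u) p)| ≤
      C ^ m₂ * C * (Real.exp (((m₂ : ℝ) + 2) * t) * C) + C * (C ^ m₂ * C) := by
    intro p hp
    have hp' := hsub hp
    have b1 := (hu.bound_pos p hp').1
    have b2 := hu.bound_y p hp'
    have b3 := hu.bound_y _ (mem_dil_image.1 hp)
    have b4 := hu.abs_zeroExt_le (dil m₁ m₂ (-t) p)
    have b5 := hu.bound_yy p hp'
    refine (abs_add_le _ _).trans (add_le_add ?_ ?_)
    · rw [abs_mul, abs_mul, abs_mul, abs_pow, abs_of_pos (Real.exp_pos _)]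
      gcongr
    · rw [abs_mul, abs_mul, abs_pow]
      gcongr
  refine ⟨integrableOn_of_continuousOn_of_bounded hO (hu.isBounded.subset hsub) hcP' hbP', ?_⟩
  have key := setIntegral_partial_snd (m₁ := m₁) (m₂ := m₂) (O := dil m₁ m₂ t '' Ω)
    (P := fun p => zeroExt Ω u (dil m₁ m₂ (-t) p) * (p.1 ^ m₂ * uy p))
    hO (hu.isBounded.subset hsub) (hsub.trans hreg)
    (hv.mul ((continuous_fst.pow _).mul hu.cont_y).continuousOn)
    (fun p hp hpO => by
      rw [h.zeroExt_dil_eq_zero h0 hp (fun hcon => hpO (mem_dil_image.2 hcon)), zero_mul])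
    (fun p hp => by
      have d1 := hasDerivAt_slice_snd (hu.hasFDerivAt_zeroExt_dil (mem_dil_image.1 hp))
      have d2 := (hasDerivAt_slice_snd (hu.deriv_y p (hsub hp))).const_mul (p.1 ^ m₂)
      convert! d1.mul d2 using 1
      ring) hcP' hbP' (by positivity)
  refine key.trans ((setIntegral_edgeY (vertex_fst_pos hx) (vertex_snd_neg hx)
    (by rw [charPow_vertex_fst hx, charPow_vertex_snd hx])
    (fun p => zeroExt Ω u (dil m₁ m₂ (-t) p) * (p.1 ^ m₂ * uy p))).trans ?_)
  simp only [dil_edgeCurve, edgeVal]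

/-- The boundary integral over `BC'` for the dilated test function. -/
noncomputable def edgeIntegral (m₁ m₂ : ℕ) (x₀ : ℝ) (Ω : Set (ℝ × ℝ)) (u ux uy : ℝ × ℝ → ℝ)
    (t : ℝ) : ℝ :=
  ∫ τ : ℝ, Real.exp (homDeg m₁ m₂ * τ) * edgeVal m₁ m₂ x₀ Ω u (τ + t) *
    edgeDeriv m₁ m₂ x₀ ux uy τ

/-- A bound for the two integrands over `BC'` which arise from Green's formula. -/
theorem edge_exp_bound (hu : HasC2Bounds Ω u ux uy C) (h : IsTricomiDomain m₁ m₂ x₀ σ Ω)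
    {τ t : ℝ} (hτ : τ ≤ 0) {w z w' k : ℝ} {n : ℕ} {F : ℝ × ℝ → ℝ} (hk : 0 ≤ k)
    (hw : w' = z * Real.exp (k * τ))
    (hw' : |w| ≤ C) (hF : ∀ p ∈ closure Ω, |F p| ≤ C) :
    |k * w' * (edgeVal m₁ m₂ x₀ Ω u (τ + t) * (w ^ n *
      F (edgeCurve m₁ m₂ (vertex m₁ m₂ x₀) τ)))| ≤
    k * |z| * (C * (C ^ n * C)) * Real.exp (k * τ) := by
  have hC := hu.C_nonneg
  have b1 := hu.abs_zeroExt_le (edgeCurve m₁ m₂ (vertex m₁ m₂ x₀) (τ + t))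
  have b2 := hF _ (h.edgeCurve_mem_closure hτ)
  rw [abs_mul, abs_mul, abs_mul, abs_mul, abs_pow, hw, abs_mul, abs_of_nonneg hk,
    abs_of_pos (Real.exp_pos _), edgeVal]
  calc k * (|z| * Real.exp (k * τ)) * (|zeroExt Ω u (edgeCurve m₁ m₂ (vertex m₁ m₂ x₀) (τ + t))| *
        (|w| ^ n * |F (edgeCurve m₁ m₂ (vertex m₁ m₂ x₀) τ)|))
      ≤ k * (|z| * Real.exp (k * τ)) * (C * (C ^ n * C)) := by gcongr
    _ = _ := by ring

/-- Green's formula on the dilated domain, with the dilation of `u` as a test function. -/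
theorem IsTricomiDomain.green (h : IsTricomiDomain m₁ m₂ x₀ σ Ω) (hm₁ : Odd m₁)
    (hs : IsDStarShaped ((m₁ : ℝ) + 2) ((m₂ : ℝ) + 2) Ω)
    (hu : HasC2Bounds Ω u ux uy C) (h0 : ∀ p ∈ charAC m₁ m₂ x₀ ∪ σ, u p = 0) {t : ℝ}
    (ht : 0 ≤ t) :
    ∫ p in dil m₁ m₂ t '' Ω, (p.2 ^ m₁ * ux p *
        (Real.exp (((m₁ : ℝ) + 2) * t) * ux (dil m₁ m₂ (-t) p)) +
      p.1 ^ m₂ * uy p * (Real.exp (((m₂ : ℝ) + 2) * t) * uy (dil m₁ m₂ (-t) p)) -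
      opO m₁ m₂ u p * zeroExt Ω u (dil m₁ m₂ (-t) p)) =
    edgeConst m₁ m₂ x₀ * edgeIntegral m₁ m₂ x₀ Ω u ux uy t := by
  obtain ⟨i1, e1⟩ := h.green_fst hs hu h0 ht
  obtain ⟨i2, e2⟩ := h.green_snd hs hu h0 ht
  have hx := h.x₀_pos
  have hC := hu.C_nonneg
  have hsum := integral_add i1 i2
  rw [e1, e2] at hsum
  have hcφ : Continuous fun τ => edgeVal m₁ m₂ x₀ Ω u (τ + t) :=
    (h.continuous_edgeVal hu.cont h0).comp (continuous_id.add continuous_const)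
  have hcc := continuous_edgeCurve (m₁ := m₁) (m₂ := m₂) (vertex m₁ m₂ x₀)
  have hzero : ∀ τ, 0 < τ → edgeVal m₁ m₂ x₀ Ω u (τ + t) = 0 := fun τ hτ =>
    h.zeroExt_edge_eq_zero h0 (by linarith)
  have j1 : Integrable fun τ => ((m₂ : ℝ) + 2) * (edgeCurve m₁ m₂ (vertex m₁ m₂ x₀) τ).2 *
      (edgeVal m₁ m₂ x₀ Ω u (τ + t) * ((edgeCurve m₁ m₂ (vertex m₁ m₂ x₀) τ).2 ^ m₁ *
        ux (edgeCurve m₁ m₂ (vertex m₁ m₂ x₀) τ))) := by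
    refine integrable_of_exp_bound (T := 0) (k := (m₂ : ℝ) + 2) (Continuous.aestronglyMeasurable ?_)
      (two_add_pos m₂) (M := ((m₂ : ℝ) + 2) * |(vertex m₁ m₂ x₀).2| * (C * (C ^ m₁ * C))) ?_ ?_
    · exact (continuous_const.mul (continuous_snd.comp hcc)).mul (hcφ.mul
        (((continuous_snd.comp hcc).pow _).mul (hu.cont_x.comp hcc)))
    · intro τ hτ
      refine edge_exp_bound hu h hτ (two_add_pos m₂).le (by rw [edgeCurve_eq])
        (hu.bound_closure (h.edgeCurve_mem_closure hτ)).2.2.2.2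
        (fun p hp => (hu.bound_closure hp).2.1)
    · intro τ hτ
      rw [hzero τ hτ]; ring
  have j2 : Integrable fun τ => -(((m₁ : ℝ) + 2) * (edgeCurve m₁ m₂ (vertex m₁ m₂ x₀) τ).1 *
      (edgeVal m₁ m₂ x₀ Ω u (τ + t) * ((edgeCurve m₁ m₂ (vertex m₁ m₂ x₀) τ).1 ^ m₂ *
        uy (edgeCurve m₁ m₂ (vertex m₁ m₂ x₀) τ)))) := by
    refine Integrable.neg ?_
    refine integrable_of_exp_bound (T := 0) (k := (m₁ : ℝ) + 2) (Continuous.aestronglyMeasurable ?_)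
      (two_add_pos m₁) (M := ((m₁ : ℝ) + 2) * |(vertex m₁ m₂ x₀).1| * (C * (C ^ m₂ * C))) ?_ ?_
    · exact (continuous_const.mul (continuous_fst.comp hcc)).mul (hcφ.mul
        (((continuous_fst.comp hcc).pow _).mul (hu.cont_y.comp hcc)))
    · intro τ hτ
      refine edge_exp_bound hu h hτ (two_add_pos m₁).le (by rw [edgeCurve_eq])
        (hu.bound_closure (h.edgeCurve_mem_closure hτ)).2.2.2.1
        (fun p hp => (hu.bound_closure hp).2.2.1)
    · intro τ hτ
      rw [hzero τ hτ]; ring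
  rw [← integral_add j1 j2] at hsum
  rw [edgeIntegral, ← integral_const_mul]
  refine Eq.trans (integral_congr_ae (Eventually.of_forall fun p => ?_)) (hsum.trans
    (integral_congr_ae (Eventually.of_forall fun τ => ?_)))
  · simp only [opO_eq]; ring
  · have k1 := conormal_edge_fst (m₁ := m₁) (m₂ := m₂) hx τ
    have k2 := conormal_edge_snd (m₁ := m₁) (m₂ := m₂) hm₁ hx τ
    simp only [edgeDeriv]
    linear_combination (edgeVal m₁ m₂ x₀ Ω u (τ + t) *
      ux (edgeCurve m₁ m₂ (vertex m₁ m₂ x₀) τ)) * k1 - (edgeVal m₁ m₂ x₀ Ω u (τ + t) *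
      uy (edgeCurve m₁ m₂ (vertex m₁ m₂ x₀) τ)) * k2

end GreenIdentity

/-! ### The energy of the dilated solution -/

section Energy

variable {m₁ m₂ : ℕ} {x₀ C : ℝ} {σ Ω : Set (ℝ × ℝ)} {u ux uy : ℝ × ℝ → ℝ}

theorem det_prod_smul (α β : ℝ) : ((α • ContinuousLinearMap.fst ℝ ℝ ℝ).prod
    (β • ContinuousLinearMap.snd ℝ ℝ ℝ)).det = α * β := by
  have : (((α • ContinuousLinearMap.fst ℝ ℝ ℝ).prod (β • ContinuousLinearMap.snd ℝ ℝ ℝ) :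
      ℝ × ℝ →L[ℝ] ℝ × ℝ) : ℝ × ℝ →ₗ[ℝ] ℝ × ℝ) =
      (α • (LinearMap.id : ℝ →ₗ[ℝ] ℝ)).prodMap (β • (LinearMap.id : ℝ →ₗ[ℝ] ℝ)) := by
    ext <;> simp
  rw [ContinuousLinearMap.det, this, LinearMap.det_prodMap]
  simp

/-- The change of variables given by the dilations. -/
theorem setIntegral_comp_dil (hΩ : MeasurableSet Ω) (t : ℝ) (G : ℝ × ℝ → ℝ) :
    ∫ p in dil m₁ m₂ t '' Ω, G (dil m₁ m₂ (-t) p) =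
      Real.exp (-(((m₁ : ℝ) + m₂ + 4) * t)) * ∫ p in Ω, G p := by
  have hL : dil m₁ m₂ t = ((Real.exp (-((m₁ : ℝ) + 2) * t) • ContinuousLinearMap.fst ℝ ℝ ℝ).prod
      (Real.exp (-((m₂ : ℝ) + 2) * t) • ContinuousLinearMap.snd ℝ ℝ ℝ)) := by
    ext q <;> simp only [dFlow] <;> simp [mul_comm]
  have hinj : InjOn (dil m₁ m₂ t) Ω :=
    (Function.LeftInverse.injective (dFlow_neg_dFlow _ _ t)).injOn
  have hd : ∀ p ∈ Ω, HasFDerivWithinAt (dil m₁ m₂ t)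
      ((Real.exp (-((m₁ : ℝ) + 2) * t) • ContinuousLinearMap.fst ℝ ℝ ℝ).prod
      (Real.exp (-((m₂ : ℝ) + 2) * t) • ContinuousLinearMap.snd ℝ ℝ ℝ)) Ω p := by
    intro p _
    rw [hL]
    exact (ContinuousLinearMap.hasFDerivAt _).hasFDerivWithinAt
  rw [integral_image_eq_integral_abs_det_fderiv_smul volume hΩ hd hinj, ← integral_const_mul]
  congr 1
  ext p
  rw [det_prod_smul, abs_of_pos (by positivity), ← Real.exp_add, smul_eq_mul]
  change _ * G (dFlow _ _ (-t) (dFlow _ _ t p)) = _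
  rw [dFlow_neg_dFlow]
  congr 2; ring

/-- The quadratic form of the principal part, evaluated on the covector `(α, β)` at `p`. -/
def quad (m₁ m₂ : ℕ) (p : ℝ × ℝ) (α β : ℝ) : ℝ := p.2 ^ m₁ * α ^ 2 + p.1 ^ m₂ * β ^ 2

theorem HasC2Bounds.continuous_quad (hu : HasC2Bounds Ω u ux uy C) :
    Continuous fun p => quad m₁ m₂ p (ux p) (uy p) :=
  ((continuous_snd.pow _).mul (hu.cont_x.pow 2)).add ((continuous_fst.pow _).mul (hu.cont_y.pow 2))

theorem abs_quad_le {p : ℝ × ℝ} {α β M : ℝ} (hp : |p.1| ≤ C ∧ |p.2| ≤ C)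
    (hα : |α| ≤ M) (hβ : |β| ≤ M) : |quad m₁ m₂ p α β| ≤ (C ^ m₁ + C ^ m₂) * M ^ 2 := by
  obtain ⟨h1, h2⟩ := hp
  have hC : 0 ≤ C := (abs_nonneg _).trans h1
  rw [add_mul]
  refine (abs_add_le _ _).trans (add_le_add ?_ ?_)
  · rw [abs_mul, abs_pow, abs_pow]; gcongr
  · rw [abs_mul, abs_pow, abs_pow]; gcongr

theorem quad_dil (p : ℝ × ℝ) (t α β : ℝ) :
    quad m₁ m₂ p (Real.exp (((m₁ : ℝ) + 2) * t) * α) (Real.exp (((m₂ : ℝ) + 2) * t) * β) =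
      Real.exp ((4 - (m₁ : ℝ) * m₂) * t) * quad m₁ m₂ (dil m₁ m₂ (-t) p) α β := by
  have h1 : Real.exp (((m₁ : ℝ) + 2) * t) ^ 2 =
      Real.exp ((4 - (m₁ : ℝ) * m₂) * t) * Real.exp (((m₂ : ℝ) + 2) * t) ^ m₁ := by
    rw [← Real.exp_nat_mul, ← Real.exp_nat_mul, ← Real.exp_add]
    congr 1; push_cast; ring
  have h2 : Real.exp (((m₂ : ℝ) + 2) * t) ^ 2 =
      Real.exp ((4 - (m₁ : ℝ) * m₂) * t) * Real.exp (((m₁ : ℝ) + 2) * t) ^ m₂ := by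
    rw [← Real.exp_nat_mul, ← Real.exp_nat_mul, ← Real.exp_add]
    congr 1; push_cast; ring
  simp only [quad, dFlow, neg_mul_neg, mul_pow, h1, h2]
  ring

theorem HasC2Bounds.integrableOn_quad (hu : HasC2Bounds Ω u ux uy C) :
    IntegrableOn (fun p => quad m₁ m₂ p (ux p) (uy p)) Ω :=
  integrableOn_of_continuousOn_of_bounded hu.isOpen hu.isBounded hu.continuous_quad.continuousOn
    fun p hp => abs_quad_le (hu.bound_pos p hp) (hu.bound_x p hp) (hu.bound_y p hp)

theorem HasC2Bounds.continuousOn_opO (hu : HasC2Bounds Ω u ux uy C) :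
    ContinuousOn (opO m₁ m₂ u) Ω :=
  ((continuous_snd.pow _).neg.continuousOn.mul hu.cont_xx).sub
    ((continuous_fst.pow _).continuousOn.mul hu.cont_yy)

theorem HasC2Bounds.abs_opO_le (hu : HasC2Bounds Ω u ux uy C) {p : ℝ × ℝ} (hp : p ∈ Ω) :
    |opO m₁ m₂ u p| ≤ C ^ m₁ * C + C ^ m₂ * C := by
  have hC := hu.C_nonneg
  obtain ⟨h1, h2⟩ := hu.bound_pos p hp
  have h3 := hu.bound_xx p hp
  have h4 := hu.bound_yy p hp
  rw [opO_eq]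
  refine (abs_sub _ _).trans (add_le_add ?_ ?_)
  · rw [abs_mul, abs_neg, abs_pow]; gcongr
  · rw [abs_mul, abs_pow]; gcongr

theorem IsTricomiDomain.integrableOn_opO_mul (h : IsTricomiDomain m₁ m₂ x₀ σ Ω)
    (hs : IsDStarShaped ((m₁ : ℝ) + 2) ((m₂ : ℝ) + 2) Ω)
    (hu : HasC2Bounds Ω u ux uy C) (h0 : ∀ p ∈ charAC m₁ m₂ x₀ ∪ σ, u p = 0) {t : ℝ}
    (ht : 0 ≤ t) : IntegrableOn (fun p => opO m₁ m₂ u p * zeroExt Ω u (dil m₁ m₂ (-t) p))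
      (dil m₁ m₂ t '' Ω) := by
  have hsub := h.dil_image_subset hs ht
  have hC := hu.C_nonneg
  refine integrableOn_of_continuousOn_of_bounded (C := (C ^ m₁ * C + C ^ m₂ * C) * C)
    (isOpen_dil_image hu.isOpen t)
    (hu.isBounded.subset hsub) ((hu.continuousOn_opO.mono hsub).mul
      ((h.continuousOn_zeroExt_dil hu h0 (-t)).mono
        (hsub.trans (h.subset_openCharRegion.trans openCharRegion_subset)))) fun p hp => ?_
  rw [abs_mul]
  exact mul_le_mul (hu.abs_opO_le (hsub hp)) (hu.abs_zeroExt_le _) (abs_nonneg _) (by positivity)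

/-- Green's formula with `u` itself as a test function. -/
theorem IsTricomiDomain.green_self (h : IsTricomiDomain m₁ m₂ x₀ σ Ω) (hm₁ : Odd m₁)
    (hs : IsDStarShaped ((m₁ : ℝ) + 2) ((m₂ : ℝ) + 2) Ω)
    (hu : HasC2Bounds Ω u ux uy C) (h0 : ∀ p ∈ charAC m₁ m₂ x₀ ∪ σ, u p = 0) :
    (∫ p in Ω, quad m₁ m₂ p (ux p) (uy p)) - ∫ p in Ω, opO m₁ m₂ u p * u p =
      edgeConst m₁ m₂ x₀ * edgeIntegral m₁ m₂ x₀ Ω u ux uy 0 := by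
  have hgreen0 := h.green hm₁ hs hu h0 le_rfl
  have himg0 : dil m₁ m₂ 0 '' Ω = Ω := by
    rw [dFlow_image_eq_preimage, neg_zero]
    ext p; simp [dFlow_zero]
  rw [himg0] at hgreen0
  simp only [neg_zero, dFlow_zero, mul_zero, Real.exp_zero, one_mul] at hgreen0
  have ifu : IntegrableOn (fun p => opO m₁ m₂ u p * zeroExt Ω u p) Ω := by
    have := h.integrableOn_opO_mul hs hu h0 le_rfl
    rw [himg0] at this
    simpa only [neg_zero, dFlow_zero] using this
  have efu : ∫ p in Ω, opO m₁ m₂ u p * zeroExt Ω u p = ∫ p in Ω, opO m₁ m₂ u p * u p :=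
    setIntegral_congr_fun hu.isOpen.measurableSet fun p hp => by
      simp only [zeroExt_of_mem (subset_closure hp)]
  have iQ := hu.integrableOn_quad (m₁ := m₁) (m₂ := m₂)
  rw [← hgreen0, ← efu, ← integral_sub iQ ifu]
  congr 1; ext p; simp only [quad]; ring

/-- The energy identity which compares `u` with its dilation. -/
theorem IsTricomiDomain.energy_identity (h : IsTricomiDomain m₁ m₂ x₀ σ Ω) (hm₁ : Odd m₁)
    (hs : IsDStarShaped ((m₁ : ℝ) + 2) ((m₂ : ℝ) + 2) Ω)
    (hu : HasC2Bounds Ω u ux uy C) (h0 : ∀ p ∈ charAC m₁ m₂ x₀ ∪ σ, u p = 0) {t : ℝ}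
    (ht : 0 ≤ t) :
    (∫ p in dil m₁ m₂ t '' Ω, quad m₁ m₂ p
        (Real.exp (((m₁ : ℝ) + 2) * t) * ux (dil m₁ m₂ (-t) p) - ux p)
        (Real.exp (((m₂ : ℝ) + 2) * t) * uy (dil m₁ m₂ (-t) p) - uy p)) +
      ∫ p in Ω \ dil m₁ m₂ t '' Ω, quad m₁ m₂ p (ux p) (uy p) =
    (Real.exp (-(homDeg m₁ m₂ * t)) - 1) * (∫ p in Ω, quad m₁ m₂ p (ux p) (uy p)) +
      2 * ((∫ p in Ω, opO m₁ m₂ u p * u p) -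
        ∫ p in dil m₁ m₂ t '' Ω, opO m₁ m₂ u p * zeroExt Ω u (dil m₁ m₂ (-t) p)) -
      2 * edgeConst m₁ m₂ x₀ *
        (edgeIntegral m₁ m₂ x₀ Ω u ux uy t - edgeIntegral m₁ m₂ x₀ Ω u ux uy 0) := by
  have hsub := h.dil_image_subset hs ht
  have hO := isOpen_dil_image (m₁ := m₁) (m₂ := m₂) hu.isOpen t
  have hC := hu.C_nonneg
  -- the energy of the dilated function
  have hscale : ∫ p in dil m₁ m₂ t '' Ω, quad m₁ m₂ p
        (Real.exp (((m₁ : ℝ) + 2) * t) * ux (dil m₁ m₂ (-t) p))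
        (Real.exp (((m₂ : ℝ) + 2) * t) * uy (dil m₁ m₂ (-t) p)) =
      Real.exp (-(homDeg m₁ m₂ * t)) * ∫ p in Ω, quad m₁ m₂ p (ux p) (uy p) := by
    simp only [quad_dil]
    rw [integral_const_mul, setIntegral_comp_dil hu.isOpen.measurableSet t
      (fun q => quad m₁ m₂ q (ux q) (uy q)), ← mul_assoc, ← Real.exp_add]
    congr 2
    rw [homDeg]; ring
  have hgreen := h.green hm₁ hs hu h0 ht
  have hgreen0 := h.green_self hm₁ hs hu h0
  -- integrability of all the terms
  have hcd : Continuous fun p => dil m₁ m₂ (-t) p := continuous_dFlow _ _ _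
  have hvx : Continuous fun p => Real.exp (((m₁ : ℝ) + 2) * t) * ux (dil m₁ m₂ (-t) p) :=
    continuous_const.mul (hu.cont_x.comp hcd)
  have hvy : Continuous fun p => Real.exp (((m₂ : ℝ) + 2) * t) * uy (dil m₁ m₂ (-t) p) :=
    continuous_const.mul (hu.cont_y.comp hcd)
  have hint : ∀ f : ℝ × ℝ → ℝ, Continuous f → ∀ S ⊆ Ω, IntegrableOn f S := fun f hf S hS =>
    (hf.continuousOn.integrableOn_compact hu.isBounded.isCompact_closure).mono_set
      (hS.trans subset_closure)
  have cQv : Continuous fun p => quad m₁ m₂ p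
        (Real.exp (((m₁ : ℝ) + 2) * t) * ux (dil m₁ m₂ (-t) p))
        (Real.exp (((m₂ : ℝ) + 2) * t) * uy (dil m₁ m₂ (-t) p)) :=
    ((continuous_snd.pow _).mul (hvx.pow 2)).add ((continuous_fst.pow _).mul (hvy.pow 2))
  have cQ := hu.continuous_quad (m₁ := m₁) (m₂ := m₂)
  have cA : Continuous fun p => p.2 ^ m₁ * ux p *
        (Real.exp (((m₁ : ℝ) + 2) * t) * ux (dil m₁ m₂ (-t) p)) +
      p.1 ^ m₂ * uy p * (Real.exp (((m₂ : ℝ) + 2) * t) * uy (dil m₁ m₂ (-t) p)) :=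
    (((continuous_snd.pow _).mul hu.cont_x).mul hvx).add
      (((continuous_fst.pow _).mul hu.cont_y).mul hvy)
  have ifv := h.integrableOn_opO_mul hs hu h0 ht
  rw [integral_sub (hint _ cA _ hsub) ifv] at hgreen
  have e2 : ∫ p in dil m₁ m₂ t '' Ω, quad m₁ m₂ p
        (Real.exp (((m₁ : ℝ) + 2) * t) * ux (dil m₁ m₂ (-t) p) - ux p)
        (Real.exp (((m₂ : ℝ) + 2) * t) * uy (dil m₁ m₂ (-t) p) - uy p) =
      (∫ p in dil m₁ m₂ t '' Ω, quad m₁ m₂ p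
        (Real.exp (((m₁ : ℝ) + 2) * t) * ux (dil m₁ m₂ (-t) p))
        (Real.exp (((m₂ : ℝ) + 2) * t) * uy (dil m₁ m₂ (-t) p))) +
      (∫ p in dil m₁ m₂ t '' Ω, quad m₁ m₂ p (ux p) (uy p)) -
      2 * ∫ p in dil m₁ m₂ t '' Ω, (p.2 ^ m₁ * ux p *
        (Real.exp (((m₁ : ℝ) + 2) * t) * ux (dil m₁ m₂ (-t) p)) +
      p.1 ^ m₂ * uy p * (Real.exp (((m₂ : ℝ) + 2) * t) * uy (dil m₁ m₂ (-t) p))) := by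
    have cS : Continuous fun p => quad m₁ m₂ p
        (Real.exp (((m₁ : ℝ) + 2) * t) * ux (dil m₁ m₂ (-t) p))
        (Real.exp (((m₂ : ℝ) + 2) * t) * uy (dil m₁ m₂ (-t) p)) +
        quad m₁ m₂ p (ux p) (uy p) := cQv.add cQ
    rw [← integral_add (hint _ cQv _ hsub) (hint _ cQ _ hsub), ← integral_const_mul,
      ← integral_sub (hint _ cS _ hsub) ((hint _ cA _ hsub).const_mul 2)]
    congr 1; ext p; simp only [quad]; ring
  have e3 := setIntegral_sdiff hO.measurableSet (hint _ cQ _ Subset.rfl) hsub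
  rw [e2, e3, hscale]
  linear_combination (-2) * hgreen + 2 * hgreen0

/-- The mean value inequality along the flow. -/
theorem abs_sub_le_of_hasDerivAt {G G' : ℝ → ℝ} {t M : ℝ} (ht : 0 ≤ t)
    (hd : ∀ s ∈ Icc 0 t, HasDerivAt G (G' s) s) (hM : ∀ s ∈ Icc 0 t, |G' s| ≤ M) :
    |G t - G 0| ≤ M * t := by
  have := (convex_Icc (0 : ℝ) t).norm_image_sub_le_of_norm_hasDerivWithin_le
    (fun s hs => (hd s hs).hasDerivWithinAt) hM ⟨le_rfl, ht⟩ ⟨ht, le_rfl⟩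
  simpa [Real.norm_eq_abs, abs_of_nonneg ht] using this

theorem IsTricomiDomain.dil_neg_mem (h : IsTricomiDomain m₁ m₂ x₀ σ Ω)
    (hs : IsDStarShaped ((m₁ : ℝ) + 2) ((m₂ : ℝ) + 2) Ω) {t s : ℝ} {p : ℝ × ℝ}
    (hp : dil m₁ m₂ (-t) p ∈ Ω) (hst : s ≤ t) : dil m₁ m₂ (-s) p ∈ Ω := by
  have h1 := h.dil_mem hs (sub_nonneg.2 hst) hp
  have h2 : dil m₁ m₂ (t - s) (dil m₁ m₂ (-t) p) = dil m₁ m₂ (-s) p := by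
    change dFlow _ _ _ (dFlow _ _ _ p) = dFlow _ _ _ p
    rw [dFlow_dFlow]
    congr 1; ring
  rwa [h2] at h1

theorem hasDerivAt_comp_dil {F : ℝ × ℝ → ℝ} {α β s : ℝ} {p : ℝ × ℝ}
    (hF : HasFDerivAt F (gradForm α β) (dil m₁ m₂ (-s) p)) :
    HasDerivAt (fun s => F (dil m₁ m₂ (-s) p))
      (α * (((m₁ : ℝ) + 2) * (dil m₁ m₂ (-s) p).1) +
        β * (((m₂ : ℝ) + 2) * (dil m₁ m₂ (-s) p).2)) s := by
  have := hF.comp_hasDerivAt s (hasDerivAt_dFlow_neg _ _ p s)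
  rw [gradForm_apply] at this
  exact this

theorem abs_flow_deriv_le {α β M C : ℝ} {q : ℝ × ℝ} (hα : |α| ≤ M) (hβ : |β| ≤ M)
    (hq : |q.1| ≤ C ∧ |q.2| ≤ C) :
    |α * (((m₁ : ℝ) + 2) * q.1) + β * (((m₂ : ℝ) + 2) * q.2)| ≤
      ((m₁ : ℝ) + m₂ + 4) * (M * C) := by
  have hM : 0 ≤ M := (abs_nonneg _).trans hα
  have e : ((m₁ : ℝ) + m₂ + 4) * (M * C) =
      M * (((m₁ : ℝ) + 2) * C) + M * (((m₂ : ℝ) + 2) * C) := by ring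
  rw [e]
  refine (abs_add_le _ _).trans (add_le_add ?_ ?_)
  · rw [abs_mul, abs_mul, abs_of_pos (two_add_pos m₁)]
    have := hq.1; gcongr
  · rw [abs_mul, abs_mul, abs_of_pos (two_add_pos m₂)]
    have := hq.2; gcongr

end Energy

/-! ### Limits along the dilations -/

section Limits

variable {m₁ m₂ : ℕ} {x₀ C : ℝ} {σ Ω : Set (ℝ × ℝ)} {u ux uy : ℝ × ℝ → ℝ}

/-- The difference between `u` and its dilation is of first order in the energy norm. -/
theorem IsTricomiDomain.exists_energy_sub_le (h : IsTricomiDomain m₁ m₂ x₀ σ Ω)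
    (hs : IsDStarShaped ((m₁ : ℝ) + 2) ((m₂ : ℝ) + 2) Ω) (hu : HasC2Bounds Ω u ux uy C) :
    ∃ K, ∀ t ∈ Icc (0 : ℝ) 1, |∫ p in dil m₁ m₂ t '' Ω, quad m₁ m₂ p
        (Real.exp (((m₁ : ℝ) + 2) * t) * ux (dil m₁ m₂ (-t) p) - ux p)
        (Real.exp (((m₂ : ℝ) + 2) * t) * uy (dil m₁ m₂ (-t) p) - uy p)| ≤ K * t ^ 2 := by
  have hC := hu.C_nonneg
  set A : ℝ := (m₁ : ℝ) + m₂ + 4 with hA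
  set M : ℝ := Real.exp A * (A * C) + Real.exp A * (A * (C * C)) with hM
  have hA0 : 0 ≤ A := by positivity
  -- a bound for one weighted derivative along the flow
  have key : ∀ (k : ℝ) (F Fx Fy : ℝ × ℝ → ℝ), 0 ≤ k → k ≤ A →
      (∀ p ∈ Ω, HasFDerivAt F (gradForm (Fx p) (Fy p)) p) → (∀ p ∈ Ω, |F p| ≤ C) →
      (∀ p ∈ Ω, |Fx p| ≤ C) → (∀ p ∈ Ω, |Fy p| ≤ C) → ∀ t ∈ Icc (0 : ℝ) 1, ∀ p,
      dil m₁ m₂ (-t) p ∈ Ω → |Real.exp (k * t) * F (dil m₁ m₂ (-t) p) - F p| ≤ M * t := by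
    intro k F Fx Fy hk hkA hF hFb hFx hFy t ht p hp
    have hmem : ∀ s ∈ Icc 0 t, dil m₁ m₂ (-s) p ∈ Ω := fun s hs' => h.dil_neg_mem hs hp hs'.2
    have hd : ∀ s ∈ Icc 0 t, HasDerivAt (fun s => Real.exp (k * s) * F (dil m₁ m₂ (-s) p))
        (Real.exp (k * s) * (k * F (dil m₁ m₂ (-s) p)) + Real.exp (k * s) *
          (Fx (dil m₁ m₂ (-s) p) * (((m₁ : ℝ) + 2) * (dil m₁ m₂ (-s) p).1) +
          Fy (dil m₁ m₂ (-s) p) * (((m₂ : ℝ) + 2) * (dil m₁ m₂ (-s) p).2))) s := by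
      intro s hs'
      have h1 : HasDerivAt (fun s : ℝ => k * s) k s := by
        simpa using (hasDerivAt_id s).const_mul k
      convert! h1.exp.mul (hasDerivAt_comp_dil (hF _ (hmem s hs'))) using 1
      ring
    have := abs_sub_le_of_hasDerivAt ht.1 hd (M := M) fun s hs' => by
      have hq := hmem s hs'
      have he : Real.exp (k * s) ≤ Real.exp A := by
        refine Real.exp_le_exp.2 ?_
        have : s ≤ 1 := hs'.2.trans ht.2
        nlinarith [hs'.1]
      have b1 := hFb _ hq
      have b2 := abs_flow_deriv_le (m₁ := m₁) (m₂ := m₂) (hFx _ hq) (hFy _ hq) (hu.bound_pos _ hq)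
      refine (abs_add_le _ _).trans (add_le_add ?_ ?_)
      · rw [abs_mul, abs_mul, abs_of_pos (Real.exp_pos _), abs_of_nonneg hk]
        gcongr
      · rw [abs_mul, abs_of_pos (Real.exp_pos _)]
        gcongr
    simpa [dFlow_zero] using this
  refine ⟨(C ^ m₁ + C ^ m₂) * M ^ 2 * volume.real Ω, fun t ht => ?_⟩
  have hsub := h.dil_image_subset hs ht.1
  have hfin : volume Ω < ⊤ := hu.isBounded.measure_lt_top
  have hb : ∀ p ∈ dil m₁ m₂ t '' Ω, ‖quad m₁ m₂ p
        (Real.exp (((m₁ : ℝ) + 2) * t) * ux (dil m₁ m₂ (-t) p) - ux p)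
        (Real.exp (((m₂ : ℝ) + 2) * t) * uy (dil m₁ m₂ (-t) p) - uy p)‖ ≤
        (C ^ m₁ + C ^ m₂) * (M * t) ^ 2 := by
    intro p hp
    have hp' := mem_dil_image.1 hp
    refine abs_quad_le (hu.bound_pos p (hsub hp)) ?_ ?_
    · exact key _ ux _ _ (two_add_pos m₁).le (by rw [hA]; linarith [two_add_pos m₂]) hu.deriv_x
        hu.bound_x hu.bound_xx hu.bound_xy t ht p hp'
    · exact key _ uy _ _ (two_add_pos m₂).le (by rw [hA]; linarith [two_add_pos m₁]) hu.deriv_y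
        hu.bound_y hu.bound_yx hu.bound_yy t ht p hp'
  have := norm_setIntegral_le_of_norm_le_const ((measure_mono hsub).trans_lt hfin) hb
  rw [Real.norm_eq_abs] at this
  refine this.trans ?_
  have hvol : volume.real (dil m₁ m₂ t '' Ω) ≤ volume.real Ω :=
    measureReal_mono hsub hfin.ne
  calc (C ^ m₁ + C ^ m₂) * (M * t) ^ 2 * volume.real (dil m₁ m₂ t '' Ω)
      ≤ (C ^ m₁ + C ^ m₂) * (M * t) ^ 2 * volume.real Ω := by gcongr
    _ = _ := by ring

/-- The strip between the domain and the dilated domain has area `O(t)`. -/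
theorem IsTricomiDomain.measureReal_strip_le (h : IsTricomiDomain m₁ m₂ x₀ σ Ω)
    (hs : IsDStarShaped ((m₁ : ℝ) + 2) ((m₂ : ℝ) + 2) Ω) {t : ℝ} (ht : 0 ≤ t) :
    volume.real (Ω \ dil m₁ m₂ t '' Ω) ≤ ((m₁ : ℝ) + m₂ + 4) * volume.real Ω * t := by
  have hsub := h.dil_image_subset hs ht
  have hO := isOpen_dil_image (m₁ := m₁) (m₂ := m₂) h.isOpen t
  have hfin : volume Ω < ⊤ := h.isBounded.measure_lt_top
  have h1 := setIntegral_comp_dil (m₁ := m₁) (m₂ := m₂) h.isOpen.measurableSet t (fun _ => 1)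
  simp only [setIntegral_const, smul_eq_mul, mul_one] at h1
  rw [measureReal_sdiff hsub hO.measurableSet hfin.ne, h1]
  have h2 := Real.add_one_le_exp (-(((m₁ : ℝ) + m₂ + 4) * t))
  have h3 : 0 ≤ volume.real Ω := measureReal_nonneg
  nlinarith

/-- If `φ` is asymptotically nonnegative on the strip between the domain and the dilated domain,
then the integral of `φ` over the strip is bounded below by `o(t)`. -/
theorem IsTricomiDomain.eventually_le_strip (h : IsTricomiDomain m₁ m₂ x₀ σ Ω)
    (hs : IsDStarShaped ((m₁ : ℝ) + 2) ((m₂ : ℝ) + 2) Ω) {φ : ℝ × ℝ → ℝ}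
    (hφ : IntegrableOn φ Ω)
    (hlow : ∀ ε > 0, ∀ᶠ t in 𝓝[>] (0 : ℝ), ∀ p ∈ Ω \ dil m₁ m₂ t '' Ω, -ε ≤ φ p) :
    ∀ ε > 0, ∀ᶠ t in 𝓝[>] (0 : ℝ), -ε * t ≤ ∫ p in Ω \ dil m₁ m₂ t '' Ω, φ p := by
  intro ε hε
  set A : ℝ := ((m₁ : ℝ) + m₂ + 4) * volume.real Ω with hA
  have hA0 : 0 ≤ A := by positivity
  filter_upwards [hlow (ε / (A + 1)) (by positivity), self_mem_nhdsWithin] with t ht1 ht0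
  have ht0 : 0 < t := ht0
  have hO := isOpen_dil_image (m₁ := m₁) (m₂ := m₂) h.isOpen t
  have hm : MeasurableSet (Ω \ dil m₁ m₂ t '' Ω) := h.isOpen.measurableSet.diff hO.measurableSet
  have hfin : volume (Ω \ dil m₁ m₂ t '' Ω) < ⊤ :=
    (measure_mono sdiff_subset).trans_lt h.isBounded.measure_lt_top
  have h1 : ∫ _ in Ω \ dil m₁ m₂ t '' Ω, (-(ε / (A + 1))) ≤ ∫ p in Ω \ dil m₁ m₂ t '' Ω, φ p :=
    setIntegral_mono_on (integrableOn_const hfin.ne) (hφ.mono_set sdiff_subset) hm ht1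
  rw [setIntegral_const, smul_eq_mul] at h1
  refine le_trans ?_ h1
  have h2 := h.measureReal_strip_le hs ht0.le
  rw [← hA] at h2
  have h3 : volume.real (Ω \ dil m₁ m₂ t '' Ω) * (ε / (A + 1)) ≤ ε * t := by
    calc _ ≤ (A * t) * (ε / (A + 1)) := by gcongr
      _ = ε * t * (A / (A + 1)) := by ring
      _ ≤ ε * t * 1 := by
          gcongr
          rw [div_le_one (by positivity)]; linarith
      _ = ε * t := mul_one _
  linarith

/-- The flow moves the points of a bounded set by a small amount in a short time. -/
theorem eventually_dist_dil_lt (hb : ∀ p ∈ Ω, |p.1| ≤ C ∧ |p.2| ≤ C) {δ : ℝ} (hδ : 0 < δ) :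
    ∀ᶠ t in 𝓝[>] (0 : ℝ), ∀ s ∈ Icc 0 t, ∀ p ∈ Ω, dist (dil m₁ m₂ (-s) p) p < δ := by
  have hlim : ∀ k : ℝ, ∀ᶠ t in 𝓝[>] (0 : ℝ), C * (Real.exp (k * t) - 1) < δ := by
    intro k
    have hc : Continuous fun t : ℝ => C * (Real.exp (k * t) - 1) := by fun_prop
    have : Tendsto (fun t : ℝ => C * (Real.exp (k * t) - 1)) (𝓝[>] 0) (𝓝 0) := by
      have := hc.tendsto 0
      simp only [mul_zero, Real.exp_zero, sub_self] at this
      exact this.mono_left nhdsWithin_le_nhds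
    exact this.eventually_lt_const hδ
  filter_upwards [hlim ((m₁ : ℝ) + 2), hlim ((m₂ : ℝ) + 2)] with t h1 h2 s hs p hp
  have key : ∀ k z : ℝ, 0 ≤ k → |z| ≤ C → C * (Real.exp (k * t) - 1) < δ →
      |z * Real.exp (-k * -s) - z| < δ := by
    intro k z hk hz hlt
    have hC : 0 ≤ C := (abs_nonneg _).trans hz
    have e1 : z * Real.exp (-k * -s) - z = z * (Real.exp (k * s) - 1) := by
      rw [neg_mul_neg]; ring
    have e2 : 0 ≤ Real.exp (k * s) - 1 := sub_nonneg.2 (Real.one_le_exp (mul_nonneg hk hs.1))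
    have e3 : Real.exp (k * s) ≤ Real.exp (k * t) :=
      Real.exp_le_exp.2 (mul_le_mul_of_nonneg_left hs.2 hk)
    rw [e1, abs_mul, abs_of_nonneg e2]
    refine lt_of_le_of_lt ?_ hlt
    gcongr
  rw [Prod.dist_eq, Real.dist_eq, Real.dist_eq]
  exact max_lt (key _ _ (two_add_pos m₁).le (hb p hp).1 h1)
    (key _ _ (two_add_pos m₂).le (hb p hp).2 h2)

theorem isCompact_cthickening_of_isBounded (hb : Bornology.IsBounded Ω) :
    IsCompact (Metric.cthickening 1 Ω) :=
  Metric.isCompact_of_isClosed_isBounded Metric.isClosed_cthickening hb.cthickening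

/-- Uniform continuity along the flow. -/
theorem eventually_abs_sub_dil_lt (hΩ : Bornology.IsBounded Ω)
    (hb : ∀ p ∈ Ω, |p.1| ≤ C ∧ |p.2| ≤ C) (hreg : Ω ⊆ charRegion m₁ m₂) {φ : ℝ × ℝ → ℝ}
    (hφ : ContinuousOn φ (charRegion m₁ m₂)) {ε : ℝ} (hε : 0 < ε) :
    ∀ᶠ t in 𝓝[>] (0 : ℝ), ∀ s ∈ Icc 0 t, ∀ p ∈ Ω, |φ (dil m₁ m₂ (-s) p) - φ p| < ε := by
  have hcomp : IsCompact (Metric.cthickening 1 Ω ∩ charRegion m₁ m₂) :=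
    (isCompact_cthickening_of_isBounded hΩ).inter_right (isClosed_charRegion _ _)
  have huc := hcomp.uniformContinuousOn_of_continuous (hφ.mono inter_subset_right)
  obtain ⟨δ, hδ, hδε⟩ := Metric.uniformContinuousOn_iff.1 huc ε hε
  filter_upwards [eventually_dist_dil_lt (m₁ := m₁) (m₂ := m₂) hb (lt_min hδ zero_lt_one)]
    with t ht s hs p hp
  have hd := ht s hs p hp
  have := hδε (dil m₁ m₂ (-s) p) ⟨Metric.mem_cthickening_of_dist_le _ p _ _ hp
    (hd.trans_le (min_le_right _ _)).le, dil_mem_charRegion (hreg hp) _⟩ p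
    ⟨Metric.self_subset_cthickening _ hp, hreg hp⟩ (hd.trans_le (min_le_left _ _))
  rwa [Real.dist_eq] at this

/-- The quadratic form of the gradient is asymptotically nonnegative on the strip: it is nonnegative
in the elliptic region, and it vanishes on the characteristic `AC'`. -/
theorem IsTricomiDomain.eventually_quad_strip (h : IsTricomiDomain m₁ m₂ x₀ σ Ω) (hm₁ : Odd m₁)
    (hm₂ : Even m₂) (hu : HasC2Bounds Ω u ux uy C)
    (h0 : ∀ p ∈ charAC m₁ m₂ x₀ ∪ σ, u p = 0) {ε : ℝ} (hε : 0 < ε) :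
    ∀ᶠ t in 𝓝[>] (0 : ℝ), ∀ p ∈ Ω \ dil m₁ m₂ t '' Ω, -ε ≤ quad m₁ m₂ p (ux p) (uy p) := by
  filter_upwards [eventually_abs_sub_dil_lt (m₁ := m₁) (m₂ := m₂) hu.isBounded hu.bound_pos
    (subset_closure.trans h.subset_charRegion) hu.continuous_quad.continuousOn hε,
    self_mem_nhdsWithin] with t ht ht0 p hp
  have ht0 : 0 < t := ht0
  rcases lt_or_ge p.2 0 with hy | hy
  · obtain ⟨h1, h2, h3, h4⟩ := h.mem_triangle_of_mem hp.1 hy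
    have hnot : dil m₁ m₂ (-t) p ∉ charTriangle m₁ m₂ x₀ := fun hcon =>
      hp.2 (mem_dil_image.2 (h.triangle_subset hcon))
    set κ : ℝ := ((m₁ : ℝ) + 2) * ((m₂ : ℝ) + 2) / 2 with hκ
    have hκ0 : 0 < κ := by positivity
    set S := charPow m₁ (-p.2) + charPow m₂ p.1 with hS
    have hSpos : 0 < S := add_pos (charPow_pos (by linarith)) (charPow_pos h1)
    have hsum : ∀ s, charPow m₁ (-(dil m₁ m₂ (-s) p).2) + charPow m₂ (dil m₁ m₂ (-s) p).1 =
        S * Real.exp (κ * s) := by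
      intro s
      rw [charPow_dil_fst h1.le, charPow_dil_snd h2.le, hS, ← hκ, mul_neg, neg_neg]; ring
    have hst : charPow m₂ (2 * x₀) ≤ S * Real.exp (κ * t) := by
      by_contra! hcon
      refine hnot ⟨mul_pos h1 (Real.exp_pos _), dil_snd_neg_iff.2 h2, ?_, ?_⟩
      · exact (dil_mem_openCharRegion (h.subset_openCharRegion hp.1) (-t)
          (dil_snd_neg_iff.2 h2)).2
      · rw [hsum]; exact hcon
    -- the flow line through `p` meets `AC'` before the time `t`
    set s := Real.log (charPow m₂ (2 * x₀) / S) / κ with hsdef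
    have hexp : S * Real.exp (κ * s) = charPow m₂ (2 * x₀) := by
      rw [hsdef, mul_div_cancel₀ _ hκ0.ne', Real.exp_log (div_pos h.charE_pos hSpos)]
      field_simp
    have hs0 : 0 ≤ s := by
      refine div_nonneg (Real.log_nonneg ?_) hκ0.le
      rw [one_le_div hSpos]; exact h4.le
    have hs1 : s ≤ t := by
      have h5 : Real.exp (κ * s) ≤ Real.exp (κ * t) := by
        refine le_of_mul_le_mul_left ?_ hSpos
        rw [hexp]; exact hst
      exact le_of_mul_le_mul_left (Real.exp_le_exp.1 h5) hκ0
    have hiso := h.isotropic_grad hm₁ hu h0 (q := dil m₁ m₂ (-s) p) (dil_snd_neg_iff.2 h2)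
      (mul_pos h1 (Real.exp_pos _)) (dil_mem_openCharRegion (h.subset_openCharRegion hp.1) (-s)
          (dil_snd_neg_iff.2 h2)).2 (by rw [hsum, hexp])
    have := ht s ⟨hs0, hs1⟩ p hp.1
    rw [quad, hiso, zero_sub, abs_neg] at this
    linarith [(abs_lt.1 this).1]
  · have h1 : 0 ≤ quad m₁ m₂ p (ux p) (uy p) := by
      have := hm₂.pow_nonneg p.1
      unfold quad
      positivity
    linarith

/-- The solution is small on the strip. -/
theorem IsTricomiDomain.eventually_rpow_strip (h : IsTricomiDomain m₁ m₂ x₀ σ Ω)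
    (hu : HasC2Bounds Ω u ux uy C) (h0 : ∀ p ∈ charAC m₁ m₂ x₀ ∪ σ, u p = 0) {q : ℝ} (hq : 0 < q)
    {ε : ℝ} (hε : 0 < ε) :
    ∀ᶠ t in 𝓝[>] (0 : ℝ), ∀ p ∈ Ω \ dil m₁ m₂ t '' Ω, |u p| ^ q ≤ ε := by
  have hc : ContinuousOn (fun p => |zeroExt Ω u p| ^ q) (charRegion m₁ m₂) :=
    (h.continuousOn_zeroExt hu.cont h0).abs.rpow_const fun _ _ => Or.inr hq.le
  filter_upwards [eventually_abs_sub_dil_lt (m₁ := m₁) (m₂ := m₂) hu.isBounded hu.bound_pos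
    (subset_closure.trans h.subset_charRegion) hc hε, self_mem_nhdsWithin] with t ht ht0 p hp
  have := ht t ⟨le_of_lt ht0, le_rfl⟩ p hp.1
  rw [h.zeroExt_dil_eq_zero h0 (h.subset_openCharRegion hp.1) (fun hcon => hp.2
    (mem_dil_image.2 hcon)), zeroExt_of_mem (subset_closure hp.1), abs_zero,
    Real.zero_rpow hq.ne', zero_sub, abs_neg] at this
  exact (le_abs_self _).trans this.le

/-- First order Taylor expansion of the potential energy of the dilated function. -/
theorem IsTricomiDomain.tendsto_potential (h : IsTricomiDomain m₁ m₂ x₀ σ Ω)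
    (hs : IsDStarShaped ((m₁ : ℝ) + 2) ((m₂ : ℝ) + 2) Ω) (hu : HasC2Bounds Ω u ux uy C)
    (h0 : ∀ p ∈ charAC m₁ m₂ x₀ ∪ σ, u p = 0) {F : ℝ → ℝ} (hFc : Continuous F)
    (hF : ∀ p ∈ Ω, HasDerivAt F (opO m₁ m₂ u p) (u p)) :
    Tendsto (fun t => t⁻¹ * ∫ p in dil m₁ m₂ t '' Ω,
      (opO m₁ m₂ u p * (zeroExt Ω u (dil m₁ m₂ (-t) p) - u p) -
        (F (zeroExt Ω u (dil m₁ m₂ (-t) p)) - F (u p)))) (𝓝[>] 0) (𝓝 0) := by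
  have hC := hu.C_nonneg
  set B : ℝ := C ^ m₁ * C + C ^ m₂ * C with hB
  have hB0 : 0 ≤ B := by positivity
  set M : ℝ := (B + B) * (((m₁ : ℝ) + m₂ + 4) * (C * C)) with hM
  have hM0 : 0 ≤ M := by positivity
  set R : ℝ → ℝ × ℝ → ℝ := fun t p =>
    opO m₁ m₂ u p * (zeroExt Ω u (dil m₁ m₂ (-t) p) - u p) -
        (F (zeroExt Ω u (dil m₁ m₂ (-t) p)) - F (u p)) with hR
  -- derivative of `R` along the flow
  have hd : ∀ p ∈ Ω, ∀ s, dil m₁ m₂ (-s) p ∈ Ω → HasDerivAt (fun s => R s p)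
      ((opO m₁ m₂ u p - opO m₁ m₂ u (dil m₁ m₂ (-s) p)) *
        (ux (dil m₁ m₂ (-s) p) * (((m₁ : ℝ) + 2) * (dil m₁ m₂ (-s) p).1) +
          uy (dil m₁ m₂ (-s) p) * (((m₂ : ℝ) + 2) * (dil m₁ m₂ (-s) p).2))) s := by
    intro p _ s hsp
    have hz : HasFDerivAt (zeroExt Ω u) (gradForm (ux (dil m₁ m₂ (-s) p))
        (uy (dil m₁ m₂ (-s) p))) (dil m₁ m₂ (-s) p) := by
      refine (hu.deriv _ hsp).congr_of_eventuallyEq ?_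
      filter_upwards [hu.isOpen.mem_nhds hsp] with q hq using zeroExt_of_mem (subset_closure hq)
    have h1 := hasDerivAt_comp_dil hz
    have hF' := hF _ hsp
    rw [← zeroExt_of_mem (u := u) (subset_closure hsp)] at hF'
    have h2 := hF'.comp s h1
    convert! ((h1.sub_const (u p)).const_mul (opO m₁ m₂ u p)).sub (h2.sub_const (F (u p))) using 1
    ring
  have hR0 : ∀ p ∈ Ω, R 0 p = 0 := by
    intro p hp
    simp only [hR, neg_zero, dFlow_zero, zeroExt_of_mem (subset_closure hp), sub_self, mul_zero]
  have hbound : ∀ t, 0 ≤ t → ∀ p, dil m₁ m₂ (-t) p ∈ Ω → |R t p| ≤ M * t := by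
    intro t ht p hp
    have hp0 : p ∈ Ω := by
      have := h.dil_neg_mem hs hp ht
      rwa [neg_zero, dil, dFlow_zero] at this
    have := abs_sub_le_of_hasDerivAt (M := M) ht
      (fun s hs' => hd p hp0 s (h.dil_neg_mem hs hp hs'.2)) fun s hs' => by
        have hq := h.dil_neg_mem hs hp hs'.2
        rw [abs_mul]
        refine mul_le_mul ((abs_sub _ _).trans
          (add_le_add (hu.abs_opO_le hp0) (hu.abs_opO_le hq)))
          (abs_flow_deriv_le (hu.bound_x _ hq) (hu.bound_y _ hq) (hu.bound_pos _ hq))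
          (abs_nonneg _) (by positivity)
    rwa [hR0 p hp0, sub_zero] at this
  have hlim : ∀ p ∈ Ω, Tendsto (fun t => t⁻¹ * R t p) (𝓝[>] 0) (𝓝 0) := by
    intro p hp
    have h1 := hd p hp 0 (by rwa [neg_zero, dil, dFlow_zero])
    rw [neg_zero, dil, dFlow_zero, sub_self, zero_mul] at h1
    have h2 := h1.tendsto_slope_zero_right
    simpa [hR0 p hp] using h2
  have hmeas : ∀ t, 0 ≤ t → ContinuousOn (R t) (dil m₁ m₂ t '' Ω) := by
    intro t ht
    have hsub := h.dil_image_subset hs ht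
    have hv := (h.continuousOn_zeroExt_dil hu h0 (-t)).mono
        (hsub.trans (h.subset_openCharRegion.trans openCharRegion_subset))
    have hucont := hu.cont.mono (hsub.trans subset_closure)
    exact ((hu.continuousOn_opO.mono hsub).mul (hv.sub hucont)).sub
      ((hFc.comp_continuousOn hv).sub (hFc.comp_continuousOn hucont))
  have hdct : Tendsto (fun t => ∫ p in Ω, (dil m₁ m₂ t '' Ω).indicator
      (fun p => t⁻¹ * R t p) p) (𝓝[>] 0) (𝓝 (∫ _ in Ω, (0 : ℝ))) := by
    refine tendsto_integral_filter_of_dominated_convergence (fun _ => M) ?_ ?_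
      (integrableOn_const h.isBounded.measure_lt_top.ne) ?_
    · filter_upwards [self_mem_nhdsWithin] with t ht
      have ht : 0 < t := ht
      have hO := isOpen_dil_image (m₁ := m₁) (m₂ := m₂) h.isOpen t
      refine AEStronglyMeasurable.restrict ?_
      rw [aestronglyMeasurable_indicator_iff hO.measurableSet]
      exact (continuousOn_const.mul (hmeas t ht.le)).aestronglyMeasurable hO.measurableSet
    · filter_upwards [self_mem_nhdsWithin] with t ht
      have ht : 0 < t := ht
      refine Eventually.of_forall fun p => ?_
      by_cases hp : p ∈ dil m₁ m₂ t '' Ω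
      · rw [indicator_of_mem hp, Real.norm_eq_abs, abs_mul, abs_of_pos (inv_pos.2 ht)]
        have := hbound t ht.le p (mem_dil_image.1 hp)
        rw [inv_mul_le_iff₀ ht]
        linarith
      · rw [indicator_of_notMem hp, norm_zero]; exact hM0
    · filter_upwards [ae_restrict_mem h.isOpen.measurableSet] with p hp
      refine squeeze_zero_norm (fun t => ?_) (tendsto_zero_iff_norm_tendsto_zero.1 (hlim p hp))
      by_cases hpt : p ∈ dil m₁ m₂ t '' Ω
      · rw [indicator_of_mem hpt]
      · rw [indicator_of_notMem hpt, norm_zero]; exact norm_nonneg _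
  rw [integral_zero] at hdct
  refine hdct.congr' ?_
  filter_upwards [self_mem_nhdsWithin] with t ht
  have ht : 0 < t := ht
  have hO := isOpen_dil_image (m₁ := m₁) (m₂ := m₂) h.isOpen t
  rw [setIntegral_indicator hO.measurableSet, inter_eq_right.2 (h.dil_image_subset hs ht.le),
    integral_const_mul]

end Limits

/-! ### The boundary terms on the characteristic -/

section HalfLine

variable {φ ψ : ℝ → ℝ} {N C M : ℝ}

theorem integrable_exp_mul_mul (hφ : Continuous φ) (hψ : Continuous ψ) (hN : 0 < N)
    (hzero : ∀ τ, 0 ≤ τ → φ τ = 0) (hC : ∀ τ, |φ τ| ≤ C) (hM : ∀ τ ≤ 0, |ψ τ| ≤ M) {t : ℝ}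
    (ht : 0 ≤ t) : Integrable fun τ => Real.exp (N * τ) * φ (τ + t) * ψ τ := by
  refine integrable_of_exp_bound (M := C * M) (k := N) (T := 0)
    (Continuous.aestronglyMeasurable (by fun_prop)) hN (fun τ hτ => ?_) fun τ hτ => by
      rw [hzero _ (by linarith)]; ring
  have hC0 : 0 ≤ C := (abs_nonneg _).trans (hC 0)
  rw [abs_mul, abs_mul, abs_of_pos (Real.exp_pos _)]
  calc Real.exp (N * τ) * |φ (τ + t)| * |ψ τ| ≤ Real.exp (N * τ) * C * M := by
        gcongr
        · exact hC _
        · exact hM τ hτ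
    _ = _ := by ring

/-- Lipschitz bound for a function on a half line which is continued by zero. -/
theorem abs_add_sub_le_of_eq_zero (hφ : Continuous φ) (hzero : ∀ τ, 0 ≤ τ → φ τ = 0)
    (hd : ∀ τ < 0, HasDerivAt φ (ψ τ) τ) (hM : ∀ τ ≤ 0, |ψ τ| ≤ M) {τ t : ℝ} (hτ : τ ≤ 0)
    (ht : 0 ≤ t) : |φ (τ + t) - φ τ| ≤ M * t := by
  have hM0 : 0 ≤ M := (abs_nonneg _).trans (hM 0 le_rfl)
  have key : ∀ b ∈ Icc τ 0, |φ b - φ τ| ≤ M * (b - τ) := by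
    intro b hb
    have := image_norm_le_of_norm_deriv_right_le_deriv_boundary' (a := τ) (b := b)
      (f := fun s => φ s - φ τ) (f' := ψ) (B := fun s => M * (s - τ)) (B' := fun _ => M)
      (by fun_prop) (fun s hs => ((hd s (hs.2.trans_le hb.2)).sub_const _).hasDerivWithinAt)
      (by simp) (by fun_prop) (fun s _ => by
        simpa using (((hasDerivAt_id s).sub_const τ).const_mul M).hasDerivWithinAt)
      (fun s hs => hM s (hs.2.le.trans hb.2)) ⟨hb.1, le_rfl⟩
    simpa using this
  rcases le_or_gt (τ + t) 0 with h1 | h1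
  · have := key (τ + t) ⟨by linarith, h1⟩
    simpa using this
  · have := key 0 ⟨hτ, le_rfl⟩
    rw [hzero _ h1.le, ← hzero 0 le_rfl]
    refine this.trans ?_
    gcongr; linarith

/-- The derivative at `0` of the weighted correlation of `φ` with its derivative. -/
theorem tendsto_exp_correlation (hφ : Continuous φ) (hψ : Continuous ψ) (hN : 0 < N)
    (hzero : ∀ τ, 0 ≤ τ → φ τ = 0) (hd : ∀ τ < 0, HasDerivAt φ (ψ τ) τ) (hC : ∀ τ, |φ τ| ≤ C)
    (hM : ∀ τ ≤ 0, |ψ τ| ≤ M) :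
    Tendsto (fun t => t⁻¹ * ((∫ τ, Real.exp (N * τ) * φ (τ + t) * ψ τ) -
      ∫ τ, Real.exp (N * τ) * φ (τ + 0) * ψ τ)) (𝓝[>] 0)
      (𝓝 (∫ τ in Iio 0, Real.exp (N * τ) * ψ τ ^ 2)) := by
  have hM0 : 0 ≤ M := (abs_nonneg _).trans (hM 0 le_rfl)
  have hdct : Tendsto (fun t => ∫ τ in Iio 0,
      t⁻¹ * (Real.exp (N * τ) * (φ (τ + t) - φ τ) * ψ τ)) (𝓝[>] 0)
      (𝓝 (∫ τ in Iio 0, Real.exp (N * τ) * ψ τ ^ 2)) := by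
    refine tendsto_integral_filter_of_dominated_convergence (fun τ => M * M * Real.exp (N * τ))
      ?_ ?_ ?_ ?_
    · filter_upwards with t
      exact Continuous.aestronglyMeasurable (by fun_prop)
    · filter_upwards [self_mem_nhdsWithin] with t ht
      have ht : 0 < t := ht
      filter_upwards [ae_restrict_mem measurableSet_Iio] with τ hτ
      have h1 := abs_add_sub_le_of_eq_zero hφ hzero hd hM (le_of_lt hτ) ht.le
      have h2 := hM τ (le_of_lt hτ)
      rw [Real.norm_eq_abs, abs_mul, abs_mul, abs_mul, abs_of_pos (inv_pos.2 ht),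
        abs_of_pos (Real.exp_pos _), inv_mul_le_iff₀ ht]
      calc Real.exp (N * τ) * |φ (τ + t) - φ τ| * |ψ τ|
          ≤ Real.exp (N * τ) * (M * t) * M := by gcongr
        _ = _ := by ring
    · exact ((integrableOn_exp_mul_Iic hN 0).mono_set Iio_subset_Iic_self).const_mul _
    · filter_upwards [ae_restrict_mem measurableSet_Iio] with τ hτ
      have h1 := ((hd τ hτ).tendsto_slope_zero_right.const_mul (Real.exp (N * τ))).mul_const (ψ τ)
      rw [show Real.exp (N * τ) * ψ τ ^ 2 = Real.exp (N * τ) * ψ τ * ψ τ by ring]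
      refine h1.congr fun t => ?_
      rw [smul_eq_mul]; ring
  refine hdct.congr' ?_
  filter_upwards [self_mem_nhdsWithin] with t ht
  have ht : 0 < t := ht
  rw [← integral_sub (integrable_exp_mul_mul hφ hψ hN hzero hC hM ht.le)
    (integrable_exp_mul_mul hφ hψ hN hzero hC hM le_rfl), ← integral_const_mul,
    ← integral_indicator measurableSet_Iio]
  congr 1; ext τ
  by_cases hτ : τ ∈ Iio (0 : ℝ)
  · rw [indicator_of_mem hτ, add_zero]; ring
  · rw [indicator_of_notMem hτ]
    have : 0 ≤ τ := not_lt.1 hτ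
    rw [hzero _ (by linarith), hzero _ (by linarith)]; ring

/-- The Hardy-type inequality `∫ e^{Nτ} (φ'² + (N / 2) φ φ') ≥ 0` on the half line: it is obtained
from `∫ e^{Nτ} (φ' + (N / 2) φ)² ≥ 0` and `∫ (e^{Nτ} φ²)' = 0`. -/
theorem exp_hardy (hφ : Continuous φ) (hψ : Continuous ψ) (hN : 0 < N)
    (hzero : ∀ τ, 0 ≤ τ → φ τ = 0) (hd : ∀ τ < 0, HasDerivAt φ (ψ τ) τ) (hC : ∀ τ, |φ τ| ≤ C)
    (hM : ∀ τ ≤ 0, |ψ τ| ≤ M) :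
    0 ≤ (∫ τ in Iio 0, Real.exp (N * τ) * ψ τ ^ 2) +
      N / 2 * ∫ τ, Real.exp (N * τ) * φ (τ + 0) * ψ τ := by
  have hM0 : 0 ≤ M := (abs_nonneg _).trans (hM 0 le_rfl)
  have hexp : IntegrableOn (fun τ => Real.exp (N * τ)) (Iio 0) :=
    (integrableOn_exp_mul_Iic hN 0).mono_set Iio_subset_Iic_self
  have hbd : ∀ {f : ℝ → ℝ} {K : ℝ}, Continuous f → (∀ τ < 0, |f τ| ≤ K) →
      IntegrableOn (fun τ => Real.exp (N * τ) * f τ) (Iio 0) := by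
    intro f K hf hK
    refine hexp.mul_bdd (c := K) hf.aestronglyMeasurable ?_
    filter_upwards [ae_restrict_mem measurableSet_Iio] with τ hτ using hK τ hτ
  have i1 := hbd (K := M ^ 2) (f := fun τ => ψ τ ^ 2) (by fun_prop) fun τ hτ => by
    rw [abs_pow]; have := hM τ hτ.le; gcongr
  have i2 := hbd (K := C * M) (f := fun τ => φ τ * ψ τ) (by fun_prop) fun τ hτ => by
    rw [abs_mul]
    exact mul_le_mul (hC τ) (hM τ hτ.le) (abs_nonneg _) ((abs_nonneg _).trans (hC 0))
  have i3 := hbd (K := C ^ 2) (f := fun τ => φ τ ^ 2) (by fun_prop) fun τ hτ => by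
    rw [abs_pow]; have := hC τ; gcongr
  have e0 : ∫ τ, Real.exp (N * τ) * φ (τ + 0) * ψ τ =
      ∫ τ in Iio 0, Real.exp (N * τ) * (φ τ * ψ τ) := by
    rw [← integral_indicator measurableSet_Iio]
    congr 1; ext τ
    by_cases hτ : τ ∈ Iio (0 : ℝ)
    · rw [indicator_of_mem hτ, add_zero]; ring
    · rw [indicator_of_notMem hτ, hzero _ (by rw [add_zero]; exact not_lt.1 hτ)]; ring
  have e1 : ∫ τ in Iic 0, (N * (Real.exp (N * τ) * φ τ ^ 2) +
      2 * (Real.exp (N * τ) * (φ τ * ψ τ))) = 0 := by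
    have := integral_Iic_of_hasDerivAt_of_tendsto (a := 0) (m := 0)
      (f := fun τ => Real.exp (N * τ) * φ τ ^ 2)
      (f' := fun τ => N * (Real.exp (N * τ) * φ τ ^ 2) + 2 * (Real.exp (N * τ) * (φ τ * ψ τ)))
      (by fun_prop) (fun τ hτ => by
        have h1 : HasDerivAt (fun s : ℝ => N * s) N τ := by
          simpa using (hasDerivAt_id τ).const_mul N
        convert! h1.exp.mul ((hd τ hτ).pow 2) using 1
        simp only [Nat.cast_ofNat, Pi.pow_apply]; ring) ?_ ?_
    · simpa [hzero 0 le_rfl] using this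
    · rw [integrableOn_Iic_iff_integrableOn_Iio]
      exact (i3.const_mul N).add (i2.const_mul 2)
    · have h1 : Tendsto (fun τ => Real.exp (N * τ) * C ^ 2) atBot (𝓝 0) := by
        have := (Real.tendsto_exp_atBot.comp
          (tendsto_id.const_mul_atBot hN)).mul_const (C ^ 2)
        simpa using this
      refine squeeze_zero (fun τ => by positivity) (fun τ => ?_) h1
      have := hC τ
      rw [← sq_abs (φ τ)]
      gcongr
  rw [integral_Iic_eq_integral_Iio, integral_add (i3.const_mul N) (i2.const_mul 2),
    integral_const_mul, integral_const_mul] at e1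
  have e2 : 0 ≤ ∫ τ in Iio 0, Real.exp (N * τ) * (ψ τ + N / 2 * φ τ) ^ 2 :=
    setIntegral_nonneg measurableSet_Iio fun τ _ => by positivity
  have e3 : ∫ τ in Iio 0, Real.exp (N * τ) * (ψ τ + N / 2 * φ τ) ^ 2 =
      (∫ τ in Iio 0, Real.exp (N * τ) * ψ τ ^ 2) +
      (N * (∫ τ in Iio 0, Real.exp (N * τ) * (φ τ * ψ τ)) +
        N ^ 2 / 4 * ∫ τ in Iio 0, Real.exp (N * τ) * φ τ ^ 2) := by
    have i4 : IntegrableOn (fun τ => N * (Real.exp (N * τ) * (φ τ * ψ τ)) +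
        N ^ 2 / 4 * (Real.exp (N * τ) * φ τ ^ 2)) (Iio 0) := (i2.const_mul N).add (i3.const_mul _)
    rw [← integral_const_mul, ← integral_const_mul, ← integral_add (i2.const_mul N)
      (i3.const_mul _), ← integral_add i1 i4]
    congr 1; ext τ; ring
  rw [e0]
  rw [e3] at e2
  linear_combination e2 + N / 4 * e1

end HalfLine

section EdgeLimits

variable {m₁ m₂ : ℕ} {x₀ C : ℝ} {σ Ω : Set (ℝ × ℝ)} {u ux uy : ℝ × ℝ → ℝ}

theorem IsTricomiDomain.hasDerivAt_edgeVal (h : IsTricomiDomain m₁ m₂ x₀ σ Ω)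
    (hu : HasC2Bounds Ω u ux uy C) {τ : ℝ} (hτ : τ < 0) :
    HasDerivAt (edgeVal m₁ m₂ x₀ Ω u) (edgeDeriv m₁ m₂ x₀ ux uy τ) τ := by
  refine (h.hasDerivAt_edge hu hτ).congr_of_eventuallyEq ?_
  filter_upwards [Iio_mem_nhds hτ] with s hs
  exact zeroExt_of_mem (h.edgeCurve_mem_closure (le_of_lt hs))

theorem homDeg_pos (hm₁ : Odd m₁) : 0 < homDeg m₁ m₂ := by
  have : (0 : ℝ) < m₁ := by exact_mod_cast hm₁.pos
  unfold homDeg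
  positivity

theorem IsTricomiDomain.exists_tendsto_edgeIntegral (h : IsTricomiDomain m₁ m₂ x₀ σ Ω)
    (hm₁ : Odd m₁) (hu : HasC2Bounds Ω u ux uy C)
    (h0 : ∀ p ∈ charAC m₁ m₂ x₀ ∪ σ, u p = 0) :
    ∃ S, Tendsto (fun t => t⁻¹ * (edgeIntegral m₁ m₂ x₀ Ω u ux uy t -
        edgeIntegral m₁ m₂ x₀ Ω u ux uy 0)) (𝓝[>] 0) (𝓝 S) ∧
      0 ≤ S + homDeg m₁ m₂ / 2 * edgeIntegral m₁ m₂ x₀ Ω u ux uy 0 := by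
  have hφ := h.continuous_edgeVal hu.cont h0
  have hψ := hu.continuous_edgeDeriv (m₁ := m₁) (m₂ := m₂) (x₀ := x₀)
  have hN := homDeg_pos (m₂ := m₂) hm₁
  have hz : ∀ τ, 0 ≤ τ → edgeVal m₁ m₂ x₀ Ω u τ = 0 := fun τ hτ => h.zeroExt_edge_eq_zero h0 hτ
  exact ⟨_, tendsto_exp_correlation hφ hψ hN hz (fun τ hτ => h.hasDerivAt_edgeVal hu hτ)
      (fun τ => hu.abs_zeroExt_le _) (fun τ hτ => h.abs_edgeDeriv_le hu hτ),
    exp_hardy hφ hψ hN hz (fun τ hτ => h.hasDerivAt_edgeVal hu hτ)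
      (fun τ => hu.abs_zeroExt_le _) (fun τ hτ => h.abs_edgeDeriv_le hu hτ)⟩

end EdgeLimits

/-! ### The Pohožaev inequality and the conclusion -/

section PohozaevInequality

variable {m₁ m₂ : ℕ} {x₀ C α : ℝ} {σ Ω : Set (ℝ × ℝ)} {u ux uy : ℝ × ℝ → ℝ}

theorem mul_abs_rpow_mul_self {α s : ℝ} (hα : 0 < α + 1) :
    s * |s| ^ (α - 1) * s = |s| ^ (α + 1) := by
  rcases eq_or_ne s 0 with rfl | hs
  · simp [Real.zero_rpow hα.ne']
  · rw [show α + 1 = α - 1 + 2 by ring, Real.rpow_add (abs_pos.2 hs), Real.rpow_two, sq_abs]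
    ring

/-- The primitive of the nonlinearity; at `s = 0` it is differentiable only for `α > 0`. -/
theorem hasDerivAt_abs_rpow_div {α s : ℝ} (hα : 0 < α + 1) (hs : 0 < α ∨ s ≠ 0) :
    HasDerivAt (fun s => |s| ^ (α + 1) / (α + 1)) (s * |s| ^ (α - 1)) s := by
  rcases eq_or_ne s 0 with rfl | hs0
  · have h0 : 0 < α := by simpa using hs
    convert! (hasDerivAt_abs_rpow 0 (show 1 < α + 1 by linarith)).div_const (α + 1) using 1
    simp
  · convert! ((hasDerivAt_abs hs0).rpow_const (p := α + 1)
      (Or.inl (abs_ne_zero.2 hs0))).div_const (α + 1) using 1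
    have h1 : (SignType.sign s : ℝ) * |s| = s := sign_mul_abs s
    rw [show α + 1 - 1 = α - 1 + 1 by ring, Real.rpow_add_one (abs_ne_zero.2 hs0)]
    nth_rw 1 [← h1]
    field_simp

/-- When `α ≤ 0`, the nonlinearity is discontinuous at `0`, whereas `𝒪u` is continuous, so that a
solution either vanishes identically or has no zero. -/
theorem eq_zero_or_ne_zero_of_nonpos (hΩ : IsPreconnected Ω) (hu : HasC2Bounds Ω u ux uy C)
    (hα : α ≤ 0) (hpde : ∀ p ∈ Ω, opO m₁ m₂ u p = u p * |u p| ^ (α - 1)) :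
    (∀ p ∈ Ω, u p = 0) ∨ ∀ p ∈ Ω, u p ≠ 0 := by
  by_contra! hcon
  obtain ⟨⟨a, ha, hua⟩, b, hb, hub⟩ := hcon
  have hC : 0 < C := (abs_pos.2 hua).trans_le (hu.bound a ha)
  have hlow : ∀ p ∈ Ω, u p ≠ 0 → C ^ α ≤ |opO m₁ m₂ u p| := by
    intro p hp hp0
    have h1 := abs_pos.2 hp0
    rw [hpde p hp, abs_mul, abs_of_nonneg (Real.rpow_nonneg (abs_nonneg _) _), mul_comm,
      ← Real.rpow_add_one h1.ne', sub_add_cancel]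
    exact Real.rpow_le_rpow_of_nonpos h1 (hu.bound p hp) hα
  have hzero : ∀ p ∈ Ω, u p = 0 → opO m₁ m₂ u p = 0 := by
    intro p hp hp0
    rw [hpde p hp, hp0, zero_mul]
  have hA : IsOpen (Ω ∩ u ⁻¹' {0}ᶜ) :=
    (hu.cont.mono subset_closure).isOpen_inter_preimage hu.isOpen isOpen_compl_singleton
  have hB : IsOpen (Ω ∩ opO m₁ m₂ u ⁻¹' Metric.ball 0 (C ^ α)) :=
    hu.continuousOn_opO.isOpen_inter_preimage hu.isOpen Metric.isOpen_ball
  have hcover : Ω ⊆ Ω ∩ u ⁻¹' {0}ᶜ ∪ Ω ∩ opO m₁ m₂ u ⁻¹' Metric.ball 0 (C ^ α) := by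
    intro p hp
    rcases eq_or_ne (u p) 0 with hp0 | hp0
    · exact Or.inr ⟨hp, by
        rw [mem_preimage, hzero p hp hp0]; exact Metric.mem_ball_self (Real.rpow_pos_of_pos hC _)⟩
    · exact Or.inl ⟨hp, hp0⟩
  obtain ⟨c, hc, hc1, hc2⟩ := hΩ _ _ hA hB hcover ⟨a, ha, ha, hua⟩ ⟨b, hb, hb, by
    rw [mem_preimage, hzero b hb hub]; exact Metric.mem_ball_self (Real.rpow_pos_of_pos hC _)⟩
  have h2 : |opO m₁ m₂ u c| < C ^ α := by simpa using hc2.2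
  exact absurd (hlow c hc hc1.2) (not_le.2 h2)

/-- Change of the potential energy under the dilations. -/
theorem IsTricomiDomain.integral_opO_sub (h : IsTricomiDomain m₁ m₂ x₀ σ Ω)
    (hs : IsDStarShaped ((m₁ : ℝ) + 2) ((m₂ : ℝ) + 2) Ω) (hu : HasC2Bounds Ω u ux uy C)
    (h0 : ∀ p ∈ charAC m₁ m₂ x₀ ∪ σ, u p = 0) (hα : 0 < α + 1)
    (hpde : ∀ p ∈ Ω, opO m₁ m₂ u p = u p * |u p| ^ (α - 1)) {t : ℝ} (ht : 0 ≤ t) :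
    (∫ p in Ω, opO m₁ m₂ u p * u p) -
        ∫ p in dil m₁ m₂ t '' Ω, opO m₁ m₂ u p * zeroExt Ω u (dil m₁ m₂ (-t) p) =
      (1 - Real.exp (-(((m₁ : ℝ) + m₂ + 4) * t))) * ((∫ p in Ω, |u p| ^ (α + 1)) / (α + 1)) +
      (1 - 1 / (α + 1)) * (∫ p in Ω \ dil m₁ m₂ t '' Ω, |u p| ^ (α + 1)) -
      ∫ p in dil m₁ m₂ t '' Ω, (opO m₁ m₂ u p * (zeroExt Ω u (dil m₁ m₂ (-t) p) - u p) -
        (|zeroExt Ω u (dil m₁ m₂ (-t) p)| ^ (α + 1) / (α + 1) - |u p| ^ (α + 1) / (α + 1))) := by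
  have hsub := h.dil_image_subset hs ht
  have hO := isOpen_dil_image (m₁ := m₁) (m₂ := m₂) hu.isOpen t
  have hfu : ∀ p ∈ Ω, opO m₁ m₂ u p * u p = |u p| ^ (α + 1) := fun p hp => by
    rw [hpde p hp, mul_abs_rpow_mul_self hα]
  have iu : IntegrableOn (fun p => |u p| ^ (α + 1)) Ω :=
    ((hu.cont.abs.rpow_const fun _ _ => Or.inr hα.le).integrableOn_compact
      hu.isBounded.isCompact_closure).mono_set subset_closure
  have ifv := h.integrableOn_opO_mul hs hu h0 ht
  have iFv : IntegrableOn (fun p => |zeroExt Ω u (dil m₁ m₂ (-t) p)| ^ (α + 1))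
      (dil m₁ m₂ t '' Ω) := by
    refine integrableOn_of_continuousOn_of_bounded (C := C ^ (α + 1)) hO
      (hu.isBounded.subset hsub) (((h.continuousOn_zeroExt_dil hu h0 (-t)).mono
        (hsub.trans (h.subset_openCharRegion.trans openCharRegion_subset))).abs.rpow_const
          fun _ _ => Or.inr hα.le) fun p _ => ?_
    rw [abs_of_nonneg (Real.rpow_nonneg (abs_nonneg _) _)]
    exact Real.rpow_le_rpow (abs_nonneg _) (hu.abs_zeroExt_le _) hα.le
  have eFv : ∫ p in dil m₁ m₂ t '' Ω, |zeroExt Ω u (dil m₁ m₂ (-t) p)| ^ (α + 1) =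
      Real.exp (-(((m₁ : ℝ) + m₂ + 4) * t)) * ∫ p in Ω, |u p| ^ (α + 1) := by
    rw [setIntegral_comp_dil hu.isOpen.measurableSet t (fun q => |zeroExt Ω u q| ^ (α + 1))]
    congr 1
    exact setIntegral_congr_fun hu.isOpen.measurableSet fun p hp => by
      simp only [zeroExt_of_mem (subset_closure hp)]
  have e1 : ∫ p in Ω, opO m₁ m₂ u p * u p = ∫ p in Ω, |u p| ^ (α + 1) :=
    setIntegral_congr_fun hu.isOpen.measurableSet hfu
  have e2 : ∫ p in dil m₁ m₂ t '' Ω, (opO m₁ m₂ u p * (zeroExt Ω u (dil m₁ m₂ (-t) p) - u p) -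
        (|zeroExt Ω u (dil m₁ m₂ (-t) p)| ^ (α + 1) / (α + 1) - |u p| ^ (α + 1) / (α + 1))) =
      (∫ p in dil m₁ m₂ t '' Ω, opO m₁ m₂ u p * zeroExt Ω u (dil m₁ m₂ (-t) p)) -
      (α + 1)⁻¹ * (∫ p in dil m₁ m₂ t '' Ω, |zeroExt Ω u (dil m₁ m₂ (-t) p)| ^ (α + 1)) -
      (1 - 1 / (α + 1)) * ∫ p in dil m₁ m₂ t '' Ω, |u p| ^ (α + 1) := by
    have i1 : IntegrableOn (fun p => opO m₁ m₂ u p * zeroExt Ω u (dil m₁ m₂ (-t) p) -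
        (α + 1)⁻¹ * |zeroExt Ω u (dil m₁ m₂ (-t) p)| ^ (α + 1)) (dil m₁ m₂ t '' Ω) :=
      ifv.sub (iFv.const_mul _)
    rw [← integral_const_mul, ← integral_const_mul, ← integral_sub ifv (iFv.const_mul _),
      ← integral_sub i1 ((iu.mono_set hsub).const_mul _)]
    refine setIntegral_congr_fun hO.measurableSet fun p hp => ?_
    have := hfu p (hsub hp)
    linear_combination -this
  have e3 := setIntegral_sdiff hO.measurableSet iu hsub
  rw [e1, e2, e3, eFv]
  ring

/-- The Pohožaev inequality, obtained from the energy identity as `t → 0+`. -/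
theorem IsTricomiDomain.pohozaev (h : IsTricomiDomain m₁ m₂ x₀ σ Ω) (hm₁ : Odd m₁)
    (hm₂ : Even m₂) (hs : IsDStarShaped ((m₁ : ℝ) + 2) ((m₂ : ℝ) + 2) Ω)
    (hu : HasC2Bounds Ω u ux uy C) (h0 : ∀ p ∈ charAC m₁ m₂ x₀ ∪ σ, u p = 0) (hα : 0 < α + 1)
    (hpde : ∀ p ∈ Ω, opO m₁ m₂ u p = u p * |u p| ^ (α - 1))
    (hreg : 0 < α ∨ ∀ p ∈ Ω, u p ≠ 0) :
    homDeg m₁ m₂ * (∫ p in Ω, |u p| ^ (α + 1)) ≤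
      2 * ((m₁ : ℝ) + m₂ + 4) / (α + 1) * ∫ p in Ω, |u p| ^ (α + 1) := by
  set N := homDeg m₁ m₂ with hN
  set A : ℝ := (m₁ : ℝ) + m₂ + 4 with hA
  set G := ∫ p in Ω, |u p| ^ (α + 1) with hG
  set k := edgeConst m₁ m₂ x₀ with hk
  set J : ℝ → ℝ := fun t => edgeIntegral m₁ m₂ x₀ Ω u ux uy t with hJ
  set B := ∫ p in Ω, quad m₁ m₂ p (ux p) (uy p) with hBdef
  have hk0 : 0 < k := edgeConst_pos hm₁ h.x₀_pos
  have hFc : Continuous fun s : ℝ => |s| ^ (α + 1) / (α + 1) :=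
    (continuous_abs.rpow_const fun _ => Or.inr hα.le).div_const _
  have hF : ∀ p ∈ Ω, HasDerivAt (fun s : ℝ => |s| ^ (α + 1) / (α + 1)) (opO m₁ m₂ u p) (u p) :=
    fun p hp => by
      rw [hpde p hp]
      exact hasDerivAt_abs_rpow_div hα (hreg.imp_right fun hne => hne p hp)
  have hpot := h.tendsto_potential hs hu h0 hFc hF
  set D : ℝ → ℝ := fun t => ∫ p in dil m₁ m₂ t '' Ω,
    (opO m₁ m₂ u p * (zeroExt Ω u (dil m₁ m₂ (-t) p) - u p) -
        (|zeroExt Ω u (dil m₁ m₂ (-t) p)| ^ (α + 1) / (α + 1) - |u p| ^ (α + 1) / (α + 1)))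
    with hD
  obtain ⟨S, hS, hhardy⟩ := h.exists_tendsto_edgeIntegral hm₁ hu h0
  obtain ⟨K, hK⟩ := h.exists_energy_sub_le hs hu
  have hself : B - G = k * J 0 := by
    rw [← h.green_self hm₁ hs hu h0, hBdef, hG]
    congr 1
    exact (setIntegral_congr_fun hu.isOpen.measurableSet fun p hp => by
      rw [hpde p hp, mul_abs_rpow_mul_self hα]).symm
  have iu : IntegrableOn (fun p => |u p| ^ (α + 1)) Ω :=
    ((hu.cont.abs.rpow_const fun _ _ => Or.inr hα.le).integrableOn_compact
      hu.isBounded.isCompact_closure).mono_set subset_closure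
  -- the contribution of the strip to the potential energy
  set T : ℝ → ℝ := fun t => ∫ p in Ω \ dil m₁ m₂ t '' Ω, |u p| ^ (α + 1) with hT
  have hT0 : Tendsto (fun t => t⁻¹ * T t) (𝓝[>] 0) (𝓝 0) := by
    rw [Metric.tendsto_nhds]
    intro ε hε
    filter_upwards [h.eventually_le_strip hs iu.neg (fun δ hδ => by
      filter_upwards [h.eventually_rpow_strip hu h0 hα hδ] with t ht p hp
      simpa using ht p hp) (ε / 2) (by positivity), self_mem_nhdsWithin] with t ht ht0
    have ht0 : 0 < t := ht0
    have h1 : 0 ≤ T t := integral_nonneg fun p => Real.rpow_nonneg (abs_nonneg _) _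
    have h2 : T t ≤ ε / 2 * t := by
      have : ∫ p in Ω \ dil m₁ m₂ t '' Ω, (-fun p => |u p| ^ (α + 1)) p = - T t :=
        integral_neg _
      rw [this] at ht
      linarith
    rw [Real.dist_eq, sub_zero, abs_of_nonneg (mul_nonneg (inv_pos.2 ht0).le h1)]
    calc t⁻¹ * T t ≤ t⁻¹ * (ε / 2 * t) := by gcongr
      _ = ε / 2 := by field_simp
      _ < ε := by linarith
  have hexp : ∀ c : ℝ, Tendsto (fun t => t⁻¹ * (Real.exp (-(c * t)) - 1)) (𝓝[>] 0) (𝓝 (-c)) := by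
    intro c
    have h1 : HasDerivAt (fun t : ℝ => -(c * t)) (-c) 0 := by
      simpa using (hasDerivAt_id (0 : ℝ)).const_mul (-c)
    have := h1.exp.tendsto_slope_zero_right
    simpa using this
  have hlim : Tendsto (fun t => t⁻¹ * ((Real.exp (-(N * t)) - 1) * B +
      2 * ((1 - Real.exp (-(A * t))) * (G / (α + 1)) + (1 - 1 / (α + 1)) * T t - D t) -
      2 * k * (J t - J 0))) (𝓝[>] 0) (𝓝 (-N * B + 2 * (A * (G / (α + 1))) - 2 * k * S)) := by
    have := ((((hexp N).mul_const B).add ((((hexp A).mul_const (-(G / (α + 1)))).add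
      (hT0.const_mul (1 - 1 / (α + 1)))).sub hpot |>.const_mul 2)).sub (hS.const_mul (2 * k)))
    convert! this using 2
    · simp only [hD, hJ]; ring
    · ring
  have hquad := h.eventually_le_strip hs (hu.integrableOn_quad (m₁ := m₁) (m₂ := m₂))
    fun ε hε => h.eventually_quad_strip hm₁ hm₂ hu h0 hε
  have hnonneg : 0 ≤ -N * B + 2 * (A * (G / (α + 1))) - 2 * k * S := by
    refine le_of_forall_pos_le_add fun ε hε => ?_
    have hlow : Tendsto (fun t => -(K * t) - ε) (𝓝[>] (0 : ℝ)) (𝓝 (-(K * 0) - ε)) :=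
      (Continuous.tendsto (by fun_prop) 0).mono_left nhdsWithin_le_nhds
    have := le_of_tendsto_of_tendsto hlow hlim ?_
    · simp only [mul_zero, neg_zero] at this
      linarith
    filter_upwards [hquad ε hε, Ioc_mem_nhdsGT one_pos] with t ht ht1
    have h1 := h.energy_identity hm₁ hs hu h0 ht1.1.le
    rw [h.integral_opO_sub hs hu h0 hα hpde ht1.1.le] at h1
    have h2 := (abs_le.1 (hK t ⟨ht1.1.le, ht1.2⟩)).1
    have ht2 := ht1.1
    rw [← div_eq_inv_mul, le_div_iff₀ ht2]
    calc (-(K * t) - ε) * t = -(K * t ^ 2) + -ε * t := by ring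
      _ ≤ _ := add_le_add h2 ht
      _ = _ := h1
  -- the boundary terms `- N k J(0) - 2 k S` are nonpositive
  have e1 : B = G + k * J 0 := by linarith
  have e2 : 0 ≤ k * (S + N / 2 * J 0) := mul_nonneg hk0.le hhardy
  rw [e1] at hnonneg
  have e3 : 2 * A / (α + 1) * G = 2 * (A * (G / (α + 1))) := by ring
  rw [e3]
  linarith

theorem critExponent_eq : critExponent m₁ m₂ = 2 * ((m₁ : ℝ) + m₂ + 4) / homDeg m₁ m₂ := by
  rw [critExponent, homDeg]; ring

end PohozaevInequality

theorem theorem4 (m₁ m₂ : ℕ) (hm₁ : Odd m₁) (hm₂ : Even m₂)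
    (x₀ : ℝ) (σ Ω : Set (ℝ × ℝ))
    (hΩ : IsTricomiDomain m₁ m₂ x₀ σ Ω)
    (hstar : IsDStarShaped ((m₁ : ℝ) + 2) ((m₂ : ℝ) + 2) Ω)
    (α : ℝ) (hα : critExponent m₁ m₂ - 1 < α)
    (u : ℝ × ℝ → ℝ) (hu : IsC2UpToBoundary Ω u)
    (hpde : ∀ p ∈ Ω, opO m₁ m₂ u p = u p * |u p| ^ (α - 1))
    (hbdry : ∀ p ∈ charAC m₁ m₂ x₀ ∪ σ, u p = 0) :
    ∀ p ∈ Ω, u p = 0 := by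
  obtain ⟨ux, uy, C, hb⟩ := hu.exists_hasC2Bounds hΩ.isOpen hΩ.isBounded
  have hN := homDeg_pos (m₂ := m₂) hm₁
  rw [critExponent_eq] at hα
  have hA : 0 < 2 * ((m₁ : ℝ) + m₂ + 4) := by positivity
  have hq : 0 < α + 1 := by
    have := div_pos hA hN
    linarith
  have hcrit : 2 * ((m₁ : ℝ) + m₂ + 4) / (α + 1) < homDeg m₁ m₂ := by
    rw [div_lt_iff₀ hq, ← div_lt_iff₀' hN]
    linarith
  have main : (0 < α ∨ ∀ p ∈ Ω, u p ≠ 0) → ∀ p ∈ Ω, u p = 0 := by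
    intro hreg
    have hpoh := hΩ.pohozaev hm₁ hm₂ hstar hb hbdry hq hpde hreg
    have hcont : ContinuousOn (fun p => |u p| ^ (α + 1)) (closure Ω) :=
      hb.cont.abs.rpow_const fun _ _ => Or.inr hq.le
    have hint : IntegrableOn (fun p => |u p| ^ (α + 1)) Ω :=
      (hcont.integrableOn_compact hb.isBounded.isCompact_closure).mono_set subset_closure
    have hnn : 0 ≤ ∫ p in Ω, |u p| ^ (α + 1) :=
      integral_nonneg fun p => Real.rpow_nonneg (abs_nonneg _) _
    have hG : ∫ p in Ω, |u p| ^ (α + 1) = 0 := by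
      by_contra hne
      exact absurd hpoh (not_le.2 (mul_lt_mul_of_pos_right hcrit (hnn.lt_of_ne' hne)))
    rw [integral_eq_zero_iff_of_nonneg (fun p => Real.rpow_nonneg (abs_nonneg _) _) hint] at hG
    have heq := Measure.eqOn_open_of_ae_eq hG hΩ.isOpen (hcont.mono subset_closure)
      continuousOn_const
    intro p hp
    have := heq hp
    exact abs_eq_zero.1 ((Real.rpow_eq_zero (abs_nonneg _) hq.ne').1 this)
  rcases lt_or_ge 0 α with h0 | h0
  · exact main (Or.inl h0)
  · have hpre := hΩ.isSimplyConnected.isPathConnected.isConnected.isPreconnected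
    rcases eq_zero_or_ne_zero_of_nonpos hpre hb h0 hpde with h1 | h1
    · exact h1
    · exact main (Or.inr h1)
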